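/- **Setting.** All graphs are finite, simple and undirected. A set $M\subseteq V(G)$ is a *module* of $G$ if $N(v)\setminus M=N(w)\setminus M$ for all $v,w\in M$; it is *strong* if for every module $M'$ of $G$ we have $M\cap M'=\emptyset$, $M\subseteq M'$ or $M'\subseteq M$. A graph is *prime* if its only modules are $\emptyset$, the whole vertex set and the singletons. For a graph $H$ with at least two vertices, $\Pi_{mod}(H)$ denotes the partition of $V(H)$ into the inclusion-maximal nonempty strong modules different from $V(H)$. For a strong module $M$ of $G$ with $|M|\ge 2$, the *quotient graph* $G^q_M=G[M]/\Pi_{mod}(G[M])$ has vertex set $\Pi_{mod}(G[M])$, two distinct parts being adjacent if some edge of $G$ joins them. A *prime node* is a strong module $M$ of $G$ with $|M|\ge2$ for which $G^q_M$ is prime. The *width* of a tree decomposition is the maximum size of its bags minus one. **Problem.** In Connected Vertex Cover the input is a connected graph $G=(V,E)$ with at least one vertex, a cost function $c\colon V\to\mathbb N\setminus\{0\}$ and an integer $b$; the question is whether there is a set $X\subseteq V$ with $c(X)=\sum_{v\in X}c(v)\le b$ such that every edge of $G$ has an endpoint in $X$ and $G[X]$ is connected (the empty graph counts as connected). The input additionally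 contains a tree decomposition of $G^q_M$ for every prime node $M$ of $G$. Costs and budget are encoded in binary. **Theorem.** There is a Monte-Carlo algorithm $A$, using a number of independent uniformly random bits that is polynomial in the input size, with the following properties. 1. On every input, $A$ halts for every outcome of its random bits and answers yes or no. If the answer to the instance is no, then $A$ always answers no (no false positives). If the answer to the instance is yes, then $A$ answers no with probability at most $1/2$. 2. If the costs are polynomially bounded, then $A$ runs in time $O^*(5^k)$, where $k$ bounds the widths of the given tree decompositions. That is, for every polynomial $p$ there is a polynomial $q$ such that, on every input with $c(v)\le p(|V|)$ for all $v\in V$ whose given tree decompositions all have width at most $k$, and for every outcome of the random bits, $A$ halts after at most $5^k\cdot q(s)$ steps, where $s$ is the size of the input. Steps are counted for programs on binary trees built from the constant nil, pairing, the two projections, composition, branching and while loops, each executed operation or test costing one step. -/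

import Mathlib

namespace CVC

/-! ## Machine model: programs on binary trees with a step count -/

/-- The data manipulated by programs: binary trees (LISP-style lists and pairs). -/
inductive Val : Type
  | nil : Val
  | pair : Val → Val → Val

/-- The number of nodes of a tree. -/
def Val.size : Val → ℕ
  | .nil => 1
  | .pair a b => a.size + b.size + 1

/-- Programs. A program maps a tree to a tree. The primitives are the constant `nil`, pairing,
the two projections, sequential composition, branching and while loops.
In tests, the tree `nil` counts as "false" and every other tree as "true". -/
inductive Prog : Type
  | id : Prog
  | nil : Prog
  | cons : Prog → Prog → Prog
  | hd : Prog
  | tl : Prog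
  | comp : Prog → Prog → Prog
  | ite : Prog → Prog → Prog → Prog
  | while : Prog → Prog → Prog

/-- `Eval A x y t`: on input `x`, the program `A` halts with output `y` after exactly `t` steps.
Every primitive operation, every composition, every branching and every loop test costs one step,
in addition to the steps of the parts that are executed. With trees stored as pointers to immutable
cells, every step is a constant number of operations of a random access machine. -/
inductive Prog.Eval : Prog → Val → Val → ℕ → Prop
  | id (x : Val) : Eval .id x x 1
  | nil (x : Val) : Eval .nil x .nil 1
  | cons {A B : Prog} {x y z : Val} {s t : ℕ} :
      Eval A x y s → Eval B x z t → Eval (.cons A B) x (.pair y z) (s + t + 1)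
  | hd_pair (a b : Val) : Eval .hd (.pair a b) a 1
  | hd_nil : Eval .hd .nil .nil 1
  | tl_pair (a b : Val) : Eval .tl (.pair a b) b 1
  | tl_nil : Eval .tl .nil .nil 1
  /- `comp A B` first runs `A` and then runs `B` on the output of `A`. -/
  | comp {A B : Prog} {x y z : Val} {s t : ℕ} :
      Eval A x y s → Eval B y z t → Eval (.comp A B) x z (s + t + 1)
  | ite_true {C A B : Prog} {x a b y : Val} {s t : ℕ} :
      Eval C x (.pair a b) s → Eval A x y t → Eval (.ite C A B) x y (s + t + 1)
  | ite_false {C A B : Prog} {x y : Val} {s t : ℕ} :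
      Eval C x .nil s → Eval B x y t → Eval (.ite C A B) x y (s + t + 1)
  | while_stop {C A : Prog} {x : Val} {s : ℕ} :
      Eval C x .nil s → Eval (.while C A) x x (s + 1)
  | while_step {C A : Prog} {x a b y z : Val} {s t u : ℕ} :
      Eval C x (.pair a b) s → Eval A x y t → Eval (.while C A) y z u →
      Eval (.while C A) x z (s + t + u + 1)

/-- Programs are deterministic: output and number of steps are determined by the input. -/
theorem Prog.Eval.det {A : Prog} {x y y' : Val} {t t' : ℕ}
    (h : A.Eval x y t) (h' : A.Eval x y' t') : y = y' ∧ t = t' := by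
  induction h generalizing y' t' with
  | id | nil | hd_pair | hd_nil | tl_pair | tl_nil => cases h'; exact ⟨rfl, rfl⟩
  | cons _ _ ih1 ih2 =>
    cases h' with
    | cons h1 h2 => obtain ⟨rfl, rfl⟩ := ih1 h1; obtain ⟨rfl, rfl⟩ := ih2 h2; exact ⟨rfl, rfl⟩
  | comp _ _ ih1 ih2 =>
    cases h' with
    | comp h1 h2 => obtain ⟨rfl, rfl⟩ := ih1 h1; obtain ⟨rfl, rfl⟩ := ih2 h2; exact ⟨rfl, rfl⟩
  | ite_true _ _ ih1 ih2 =>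
    cases h' with
    | ite_true h1 h2 => obtain ⟨_, rfl⟩ := ih1 h1; obtain ⟨rfl, rfl⟩ := ih2 h2; exact ⟨rfl, rfl⟩
    | ite_false h1 h2 => cases (ih1 h1).1
  | ite_false _ _ ih1 ih2 =>
    cases h' with
    | ite_true h1 h2 => cases (ih1 h1).1
    | ite_false h1 h2 => obtain ⟨_, rfl⟩ := ih1 h1; obtain ⟨rfl, rfl⟩ := ih2 h2; exact ⟨rfl, rfl⟩
  | while_stop _ ih1 =>
    cases h' with
    | while_stop h1 => obtain ⟨_, rfl⟩ := ih1 h1; exact ⟨rfl, rfl⟩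
    | while_step h1 h2 h3 => cases (ih1 h1).1
  | while_step _ _ _ ih1 ih2 ih3 =>
    cases h' with
    | while_stop h1 => cases (ih1 h1).1
    | while_step h1 h2 h3 =>
      obtain ⟨_, rfl⟩ := ih1 h1; obtain ⟨rfl, rfl⟩ := ih2 h2; obtain ⟨rfl, rfl⟩ := ih3 h3
      exact ⟨rfl, rfl⟩

/-- `A` halts on input `x` after at most `T` steps. -/
def Prog.HaltsWithin (A : Prog) (x : Val) (T : ℕ) : Prop :=
  ∃ y t, A.Eval x y t ∧ t ≤ T

/-- `A` halts on input `x` and answers "true" (its output is not `nil`). -/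
def Prog.Accepts (A : Prog) (x : Val) : Prop :=
  ∃ a b t, A.Eval x (.pair a b) t

/-- `A` halts on input `x` and answers "false" (its output is `nil`). -/
def Prog.Rejects (A : Prog) (x : Val) : Prop :=
  ∃ t, A.Eval x .nil t

/-! ## Encodings by trees -/

def encBool : Bool → Val
  | false => .nil
  | true => .pair .nil .nil

def encList : List Val → Val
  | [] => .nil
  | a :: l => .pair a (encList l)

def encBits (l : List Bool) : Val := encList (l.map encBool)

/-- Natural numbers in binary, least significant bit first. -/
def encNat (a : ℕ) : Val := encBits a.bits

/-- Integers as a sign bit (true for negative integers) and the absolute value in binary. -/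
def encInt (a : ℤ) : Val := .pair (encBool (decide (a < 0))) (encNat a.natAbs)

open Classical in
/-- A set of elements of `Fin n` as its characteristic bit vector. -/
noncomputable def encSet {n : ℕ} (S : Set (Fin n)) : Val :=
  encBits (List.ofFn fun i => decide (i ∈ S))

/-- A graph on `Fin n` as its adjacency matrix. -/
noncomputable def encGraph {n : ℕ} (G : SimpleGraph (Fin n)) : Val :=
  encList (List.ofFn fun i => encSet (G.neighborSet i))

/-- A random string of `m` bits is given to a program as a second input. -/
def withRandom {m : ℕ} (x : Val) (r : Fin m → Bool) : Val :=
  .pair x (encBits (List.ofFn r))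

open Classical in
/-- The probability that `A` answers "false" on input `x`, when it is given `m` independent
uniformly random bits. -/
noncomputable def Prog.rejectProb (A : Prog) (x : Val) (m : ℕ) : ℝ :=
  (Finset.univ.filter fun r : Fin m → Bool => A.Rejects (withRandom x r)).card / 2 ^ m

/-! ## Tree decompositions -/

/-- A tree decomposition of the graph `H` with a bag for every node of a finite tree. -/
structure TreeDecomposition {W : Type} (H : SimpleGraph W) where
  numNodes : ℕ
  tree : SimpleGraph (Fin numNodes)
  isTree : tree.IsTree
  bag : Fin numNodes → Finset W
  vertex_mem : ∀ v : W, ∃ t, v ∈ bag t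
  edge_mem : ∀ u v : W, H.Adj u v → ∃ t, u ∈ bag t ∧ v ∈ bag t
  connected : ∀ v : W, (tree.induce {t | v ∈ bag t}).Connected

/-- The maximum bag size minus one. -/
def TreeDecomposition.width {W : Type} {H : SimpleGraph W} (D : TreeDecomposition H) : ℕ :=
  (Finset.univ.sup fun t => (D.bag t).card) - 1

/-! ## Modular decomposition -/

section Modules

variable {W : Type}

def IsModule (H : SimpleGraph W) (M : Set W) : Prop :=
  ∀ v ∈ M, ∀ w ∈ M, H.neighborSet v \ M = H.neighborSet w \ M

def IsStrongModule (H : SimpleGraph W) (M : Set W) : Prop :=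
  IsModule H M ∧ ∀ N, IsModule H N → Disjoint M N ∨ M ⊆ N ∨ N ⊆ M

/-- A graph is prime if all its modules are trivial. -/
def IsPrime (H : SimpleGraph W) : Prop :=
  ∀ M, IsModule H M → M = ∅ ∨ M = Set.univ ∨ ∃ v, M = {v}

/-- The quotient graph with respect to a family of vertex sets. -/
def quotientGraph (H : SimpleGraph W) (P : Set (Set W)) : SimpleGraph P where
  Adj B C := B ≠ C ∧ ∃ u ∈ B.1, ∃ v ∈ C.1, H.Adj u v
  symm := ⟨fun _ _ h => ⟨h.1.symm, by
    obtain ⟨u, hu, v, hv, huv⟩ := h.2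
    exact ⟨v, hv, u, hu, huv.symm⟩⟩⟩
  loopless := ⟨fun _ h => h.1 rfl⟩

/-- The canonical modular partition: the inclusion-maximal proper nonempty strong modules. -/
def canonicalPartition (H : SimpleGraph W) : Set (Set W) :=
  {M | Maximal (fun N => IsStrongModule H N ∧ N.Nonempty ∧ N ≠ Set.univ) M}

/-- The quotient graph of `G[M]` by its canonical modular partition. -/
def nodeQuotient (G : SimpleGraph W) (M : Set W) :
    SimpleGraph (canonicalPartition (G.induce M)) :=
  quotientGraph (G.induce M) (canonicalPartition (G.induce M))

/-- `M` is a node of the modular decomposition tree (a nonempty strong module) that is not a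
singleton, and the quotient graph at `M` is prime. -/
def IsPrimeNode (G : SimpleGraph W) (M : Set W) : Prop :=
  IsStrongModule G M ∧ M.Nontrivial ∧ IsPrime (nodeQuotient G M)

end Modules

/-! ## Connected Vertex Cover -/

/-- `X` covers all edges of `G`, and `G[X]` is connected. The empty set counts as connected; it
covers all edges only if there are none. -/
def IsConnectedVertexCover {W : Type} (G : SimpleGraph W) (X : Set W) : Prop :=
  G.IsVertexCover X ∧ (G.induce X).Preconnected

/-- An input: a graph with vertex set `Fin n`, positive vertex costs, an integer budget, and tree
decompositions of the quotient graphs at precisely the prime nodes, listed in any order. -/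
structure Input where
  n : ℕ
  graph : SimpleGraph (Fin n)
  cost : Fin n → ℕ
  cost_pos : ∀ v, 0 < cost v
  budget : ℤ
  decomps : List (Σ M : Set (Fin n), TreeDecomposition (nodeQuotient graph M))
  decomps_iff : ∀ M, (∃ D, ⟨M, D⟩ ∈ decomps) ↔ IsPrimeNode graph M

/-- The question asked by Connected Vertex Cover. -/
def Input.IsYes (I : Input) : Prop :=
  ∃ X : Finset (Fin I.n), ((∑ v ∈ X, I.cost v : ℕ) : ℤ) ≤ I.budget ∧
    IsConnectedVertexCover I.graph (X : Set (Fin I.n))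

/-- All tree decompositions in the input have width at most `k`. -/
def Input.WidthAtMost (I : Input) (k : ℕ) : Prop :=
  ∀ D ∈ I.decomps, D.2.width ≤ k

/-- A tree decomposition of the quotient graph at `M`, as the adjacency matrix of the tree and
the list of the bags. The vertices of the quotient graph are disjoint nonempty sets of vertices
of `G[M]`, and a bag is written down as the union of its elements. -/
noncomputable def encDecomp {n : ℕ} {G : SimpleGraph (Fin n)} {M : Set (Fin n)}
    (D : TreeDecomposition (nodeQuotient G M)) : Val :=
  .pair (encGraph D.tree) (encList (List.ofFn fun t =>
    encSet {v : Fin n | ∃ B ∈ D.bag t, ∃ h : v ∈ M, (⟨v, h⟩ : M) ∈ B.1}))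

noncomputable def Input.encode (I : Input) : Val :=
  .pair (encGraph I.graph)
    (.pair (encList (List.ofFn fun v => encNat (I.cost v)))
      (.pair (encInt I.budget)
        (encList (I.decomps.map fun D => .pair (encSet D.1) (encDecomp D.2)))))

/-- The size of an input is the number of nodes of the tree that encodes it. -/
noncomputable def Input.size (I : Input) : ℕ := I.encode.size

end CVC

/-!
# Connected Vertex Cover on graphs with prime quotients of small treewidth

The algorithm computes the polynomial `∑ z ^ w X` over the field with two elements, where `X` ranges
over the connected vertex covers of `G`. The weight `w X` is the cost of `X`, multiplied by a large
factor, plus the sum of random weights of the vertices in `X`. So weights order sets by their costs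
first, and truncating the polynomial at a suitable degree keeps exactly the covers within the budget
(`wgt_lt_iff`). If there is no such cover, then the truncated polynomial is zero for every choice of
the random weights. Otherwise, by the isolation lemma (`isolation`), with probability at least one
half only one of them has minimum weight, and its monomial does not cancel (`sum_zz_ne_zero`).

The polynomial is computed along a recursive partition of the vertex set into modules. A module that
is disconnected or whose complement is disconnected is split into two submodules. Every other module
is a prime node (`isPrimeNode_of_indec`) and is split by its canonical partition, in which two
vertices are equivalent if some smaller module contains both (`same_part_iff`). So every quotient has
either two vertices or one of the given tree decompositions (`bagOK_bags`).

Below the root, only the sum `coverSum` of the monomials of all vertex covers of a module is needed.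
A set is a vertex cover if and only if it covers every part and contains one of any two adjacent
parts (`Parts.covers_iff`), so that two states of a part suffice: contained in the set or not. At the
root, a vertex cover that is not a single part is connected if and only if the parts it meets are
connected in the quotient (`Parts.connIn_iff`). This is counted modulo two by consistent cuts: the
number of ways to put the parts that are met on two sides, without edges between the sides and with
the first part on the left, is odd if and only if these parts are connected (`Parts.sum_root`). The
five states of a part record whether it is not met, met or contained, and on which side it is. Covers
that are single parts are corrected separately (`Parts.sum_connected`, `ev_total`).

All these sums are sums over assignments of states to the vertices of a quotient that are compatible
at its edges. They are evaluated by variable elimination (`ev_zval`). If the vertex to be eliminated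
is chosen such that a single bag contains all remaining vertices that share a bag with it, then the
scopes of the tables stay within the bags. A leaf of the tree whose bag is not contained in the
neighbouring bag has such a vertex, and other leaves can be dropped (`exists_pick`). Thus every table
has at most `5 ^ (k + 1)` entries (`elimCost_le`).

The algorithm is a function on lists of Booleans and numbers. The relation `PTK K f` says that a
program computes `f` in time `K` times a polynomial, and its closure properties, above all under loops
(`PTK.foldlBig`), yield the program for the whole algorithm (`ptk_solve`).
-/

namespace CVC

/-! ### Typed functions computed by programs -/

/-- A type whose elements are represented by trees. The size `sz` is the measure in which running
times are bounded; it need not be the size of the representing tree. -/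
class Enc (α : Type) where
  enc : α → Val
  sz : α → ℕ

open Enc

instance : Enc Bool := ⟨encBool, fun _ => 1⟩
instance {α β : Type} [Enc α] [Enc β] : Enc (α × β) :=
  ⟨fun x => .pair (enc x.1) (enc x.2), fun x => sz x.1 + sz x.2 + 1⟩
instance {α : Type} [Enc α] : Enc (List α) :=
  ⟨fun l => encList (l.map enc), fun l => (l.map (fun x => sz x + 1)).sum + 1⟩
/-- Natural numbers in unary. -/
instance : Enc ℕ := ⟨fun n => encList (List.replicate n .nil), fun n => n + 1⟩

/-- A natural number represented in binary, whose size is nevertheless its value. -/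
structure BinNat where
  val : ℕ

instance : Enc BinNat := ⟨fun n => encNat n.val, fun n => n.val + 1⟩

/-- An element of `α` whose size is regarded as constant. Programs handle trees without copying them,
so exponentially large objects need not enter the polynomial factor of the running time. -/
structure Big (α : Type) where
  val : α

instance {α : Type} [Enc α] : Enc (Big α) := ⟨fun n => enc n.val, fun _ => 1⟩

/-- An arbitrary tree, used as a table; its size is regarded as constant. -/
structure Trie where
  val : Val

instance : Enc Trie := ⟨fun t => t.val, fun _ => 1⟩

/-- The function `f` is computed by a program in time `(K a + 1) * p (sz a)` for some polynomial
`p`, and the size of its values is polynomially bounded. The factor `K` is the part of the running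
time that may be exponential. -/
def PTK {α β : Type} [Enc α] [Enc β] (K : α → ℕ) (f : α → β) : Prop :=
  ∃ (A : Prog) (p : Polynomial ℕ), ∀ a,
    (∃ t, A.Eval (enc a) (enc (f a)) t ∧ t ≤ (K a + 1) * p.eval (sz a)) ∧ sz (f a) ≤ p.eval (sz a)

/-- The function `f` is computed by a program in polynomial time. -/
@[fun_prop] def PT {α β : Type} [Enc α] [Enc β] (f : α → β) : Prop := PTK (fun _ => 0) f

theorem polyMono (p : Polynomial ℕ) {a b : ℕ} (h : a ≤ b) : p.eval a ≤ p.eval b := by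
  induction p using Polynomial.induction_on' with
  | add p q hp hq => simp only [Polynomial.eval_add]; omega
  | monomial n c => simp only [Polynomial.eval_monomial]; gcongr

section basic
variable {α β γ δ σ : Type} [Enc α] [Enc β] [Enc γ] [Enc δ] [Enc σ]

theorem sz_pair (x : α × β) : sz x = sz x.1 + sz x.2 + 1 := rfl

theorem sz_list_nil : sz ([] : List α) = 1 := rfl

theorem sz_list_cons (x : α) (l : List α) : sz (x :: l) = sz x + sz l + 1 := by
  simp [sz]; omega

theorem sz_append (l m : List α) : sz (l ++ m) + 1 = sz l + sz m := by
  simp [sz]; omega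

theorem sz_take_le (l : List α) (i : ℕ) : sz (l.take i) ≤ sz l := by
  have := sz_append (l.take i) (l.drop i)
  rw [List.take_append_drop] at this
  have h : 1 ≤ sz (l.drop i) := by simp [sz]
  omega

theorem sz_reverse (l : List α) : sz l.reverse = sz l := by
  simp [sz]

theorem PTK.mono {K K' : α → ℕ} {f : α → β} (hf : PTK K f) (h : ∀ a, K a ≤ K' a) : PTK K' f := by
  obtain ⟨A, p, hA⟩ := hf
  refine ⟨A, p, fun a => ?_⟩
  obtain ⟨⟨t, h1, h2⟩, h3⟩ := hA a
  exact ⟨⟨t, h1, h2.trans (Nat.mul_le_mul_right _ (Nat.succ_le_succ (h a)))⟩, h3⟩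

theorem PT.toK {f : α → β} (hf : PT f) (K : α → ℕ) : PTK K f := PTK.mono hf fun _ => Nat.zero_le _

/-- A constant factor in the time bound can be absorbed. -/
theorem PTK.of_le {K K' : α → ℕ} {f : α → β} (hf : PTK K f) (P : Polynomial ℕ)
    (h : ∀ a, K a + 1 ≤ (K' a + 1) * P.eval (sz a)) : PTK K' f := by
  obtain ⟨A, p, hA⟩ := hf
  refine ⟨A, P * p + p, fun a => ?_⟩
  obtain ⟨⟨t, h1, h2⟩, h3⟩ := hA a
  refine ⟨⟨t, h1, h2.trans ?_⟩, h3.trans (by simp)⟩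
  calc (K a + 1) * p.eval (sz a) ≤ (K' a + 1) * P.eval (sz a) * p.eval (sz a) :=
        Nat.mul_le_mul_right _ (h a)
    _ ≤ (K' a + 1) * (P * p + p).eval (sz a) := by
        rw [mul_assoc]; apply Nat.mul_le_mul_left; simp

/-- The factors `K` are not multiplied under composition: a common bound for both functions suffices. -/
theorem PTK.comp {K : α → ℕ} {Kg : β → ℕ} {g : β → γ} {f : α → β} (hg : PTK Kg g) (hf : PTK K f)
    (hK : ∀ a, Kg (f a) ≤ K a) : PTK K (fun a => g (f a)) := by
  obtain ⟨A, p, hA⟩ := hf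
  obtain ⟨B, q, hB⟩ := hg
  refine ⟨.comp A B, p + q.comp p + 1, fun a => ?_⟩
  obtain ⟨⟨t, h1, h2⟩, h3⟩ := hA a
  obtain ⟨⟨u, h4, h5⟩, h6⟩ := hB (f a)
  have hq := polyMono q h3
  refine ⟨⟨_, .comp h1 h4, ?_⟩, ?_⟩
  · have : u ≤ (K a + 1) * q.eval (p.eval (sz a)) := h5.trans (Nat.mul_le_mul (by simpa using hK a) hq)
    simp only [Polynomial.eval_add, Polynomial.eval_comp, Polynomial.eval_one, mul_add]
    omega
  · simp only [Polynomial.eval_add, Polynomial.eval_comp, Polynomial.eval_one]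
    omega

theorem PTK.pair {K : α → ℕ} {f : α → β} {g : α → γ} (hf : PTK K f) (hg : PTK K g) :
    PTK K (fun a => (f a, g a)) := by
  obtain ⟨A, p, hA⟩ := hf
  obtain ⟨B, q, hB⟩ := hg
  refine ⟨.cons A B, p + q + 1, fun a => ?_⟩
  obtain ⟨⟨t, h1, h2⟩, h3⟩ := hA a
  obtain ⟨⟨u, h4, h5⟩, h6⟩ := hB a
  refine ⟨⟨_, .cons h1 h4, ?_⟩, ?_⟩
  · simp only [Polynomial.eval_add, Polynomial.eval_one, mul_add]
    omega
  · simp only [Polynomial.eval_add, Polynomial.eval_one, sz_pair]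
    omega

theorem PTK.cond {K : α → ℕ} {c : α → Bool} {f g : α → β} (hc : PTK K c) (hf : PTK K f)
    (hg : PTK K g) : PTK K (fun a => cond (c a) (f a) (g a)) := by
  obtain ⟨A, p, hA⟩ := hf
  obtain ⟨B, q, hB⟩ := hg
  obtain ⟨C, r, hC⟩ := hc
  refine ⟨.ite C A B, p + q + r + 1, fun a => ?_⟩
  obtain ⟨⟨t, h1, h2⟩, h3⟩ := hA a
  obtain ⟨⟨u, h4, h5⟩, h6⟩ := hB a
  obtain ⟨⟨v, h7, h8⟩, h9⟩ := hC a
  simp only [Polynomial.eval_add, Polynomial.eval_one, mul_add]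
  cases hca : c a with
  | true =>
    rw [hca] at h7
    refine ⟨⟨_, .ite_true h7 h1, ?_⟩, ?_⟩ <;> (try simp only [cond_true]) <;> omega
  | false =>
    rw [hca] at h7
    refine ⟨⟨_, .ite_false h7 h4, ?_⟩, ?_⟩ <;> (try simp only [cond_false]) <;> omega

/-- A program with a constant number of steps. -/
theorem PT.of_prog (A : Prog) (c : ℕ) {f : α → β} (h : ∀ a, ∃ t, A.Eval (enc a) (enc (f a)) t ∧ t ≤ c)
    (p : Polynomial ℕ) (hs : ∀ a, sz (f a) ≤ p.eval (sz a)) : PT f := by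
  refine ⟨A, p + c, fun a => ⟨?_, by have := hs a; simp; omega⟩⟩
  obtain ⟨t, h1, h2⟩ := h a
  exact ⟨t, h1, by simp; omega⟩

@[fun_prop] theorem PT.id : PT (fun a : α => a) :=
  .of_prog .id 1 (fun _ => ⟨1, .id _, le_rfl⟩) .X (by simp)

/-- A program with constant output. -/
def constProg : Val → Prog
  | .nil => .nil
  | .pair a b => .cons (constProg a) (constProg b)

theorem constProg_eval (v x : Val) : ∃ t, (constProg v).Eval x v t ∧ t ≤ v.size := by
  induction v with
  | nil => exact ⟨1, .nil _, le_rfl⟩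
  | pair a b iha ihb =>
    obtain ⟨t, h1, h2⟩ := iha
    obtain ⟨u, h3, h4⟩ := ihb
    exact ⟨_, .cons h1 h3, by simp only [Val.size]; omega⟩

@[fun_prop] theorem PT.const (b : β) : PT (fun _ : α => b) :=
  .of_prog (constProg (enc b)) _ (fun _ => constProg_eval _ _) (Polynomial.C (sz b)) (by simp)

@[fun_prop] theorem PT.comp {g : β → γ} {f : α → β} (hg : PT g) (hf : PT f) :
    PT (fun a => g (f a)) := PTK.comp hg hf fun _ => le_rfl

@[fun_prop] theorem PT.pair {f : α → β} {g : α → γ} (hf : PT f) (hg : PT g) :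
    PT (fun a => (f a, g a)) := PTK.pair hf hg

theorem PT.fst' : PT (fun a : α × β => a.1) :=
  .of_prog .hd 1 (fun _ => ⟨1, .hd_pair _ _, le_rfl⟩) .X (by simp [sz]; intros; omega)

theorem PT.snd' : PT (fun a : α × β => a.2) :=
  .of_prog .tl 1 (fun _ => ⟨1, .tl_pair _ _, le_rfl⟩) .X (by simp [sz]; intros; omega)

@[fun_prop] theorem PT.fst {f : α → β × γ} (hf : PT f) : PT (fun a => (f a).1) := PT.fst'.comp hf
@[fun_prop] theorem PT.snd {f : α → β × γ} (hf : PT f) : PT (fun a => (f a).2) := PT.snd'.comp hf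

@[fun_prop] theorem PT.cond {c : α → Bool} {f g : α → β} (hc : PT c) (hf : PT f)
    (hg : PT g) : PT (fun a => cond (c a) (f a) (g a)) := PTK.cond hc hf hg

@[fun_prop] theorem PT.and {f g : α → Bool} (hf : PT f) (hg : PT g) : PT (fun a => f a && g a) := by
  have : PT (fun a => _root_.cond (f a) (g a) false) := by fun_prop
  convert this using 2 with a; cases f a <;> rfl

@[fun_prop] theorem PT.or {f g : α → Bool} (hf : PT f) (hg : PT g) : PT (fun a => f a || g a) := by
  have : PT (fun a => _root_.cond (f a) true (g a)) := by fun_prop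
  convert this using 2 with a; cases f a <;> rfl

@[fun_prop] theorem PT.not {f : α → Bool} (hf : PT f) : PT (fun a => !(f a)) := by
  have : PT (fun a => _root_.cond (f a) false true) := by fun_prop
  convert this using 2 with a; cases f a <;> rfl

@[fun_prop] theorem PT.xor {f g : α → Bool} (hf : PT f) (hg : PT g) : PT (fun a => xor (f a) (g a)) := by
  have : PT (fun a => _root_.cond (f a) (!(g a)) (g a)) := by fun_prop
  convert this using 2 with a; cases f a <;> simp

@[fun_prop] theorem PT.beq_bool {f g : α → Bool} (hf : PT f) (hg : PT g) : PT (fun a => f a == g a) := by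
  have : PT (fun a => _root_.cond (f a) (g a) (!(g a))) := by fun_prop
  convert this using 2 with a; cases f a <;> simp

@[fun_prop] theorem PT.listCons {f : α → β} {g : α → List β} (hf : PT f) (hg : PT g) :
    PT (fun a => f a :: g a) := by
  have : PT (fun x : β × List β => x.1 :: x.2) :=
    .of_prog .id 1 (fun _ => ⟨1, .id _, le_rfl⟩) (.X) (by simp [sz]; intros; omega)
  exact this.comp (hf.pair hg)

@[fun_prop] theorem PT.tail {f : α → List β} (hf : PT f) : PT (fun a => (f a).tail) := by
  have : PT (fun x : List β => x.tail) :=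
    .of_prog .tl 1 (fun l => by cases l <;> exact ⟨1, by constructor, le_rfl⟩) (.X) (by
      intro a; cases a <;> simp [sz])
  exact this.comp hf

@[fun_prop] theorem PT.isEmpty {f : α → List β} (hf : PT f) : PT (fun a => (f a).isEmpty) := by
  have : PT (fun x : List β => x.isEmpty) :=
    .of_prog (.ite .id .nil (.cons .nil .nil)) 5 (fun l => by
      cases l with
      | nil => exact ⟨_, .ite_false (.id _) (.cons (.nil _) (.nil _)), by norm_num⟩
      | cons a l => exact ⟨_, .ite_true (.id _) (.nil _), by norm_num⟩) 1 (by
      intro a; simp [sz])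
  exact this.comp hf

@[fun_prop] theorem PT.headD {f : α → List β} {g : α → β} (hf : PT f) (hg : PT g) :
    PT (fun a => (f a).headD (g a)) := by
  have : PT (fun x : List β × β => x.1.headD x.2) :=
    .of_prog (.ite .hd (.comp .hd .hd) .tl) 5 (fun l => by
      rcases l with ⟨_ | ⟨a, l⟩, b⟩
      · exact ⟨_, .ite_false (.hd_pair _ _) (.tl_pair _ _), by norm_num⟩
      · exact ⟨_, .ite_true (.hd_pair _ _) (.comp (.hd_pair _ _) (.hd_pair _ _)), by norm_num⟩) .X (by
      rintro ⟨_ | ⟨a, l⟩, b⟩ <;> simp [sz] <;> omega)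
  exact this.comp (hf.pair hg)

/-! ### Loops over lists -/

/-- The sum of `c s x` over the states `s` and list elements `x` met by a left fold. -/
def foldCost {σ β : Type} (c : σ → β → ℕ) (f : σ → β → σ) : σ → List β → ℕ
  | _, [] => 0
  | s, x :: l => c s x + foldCost c f (f s x) l

/-- The loop of a left fold. On `(env, acc, list)` it applies `F` to `((env, acc), head)`. -/
def foldProg (F : Prog) : Prog :=
  .while (.comp .tl .tl)
    (.cons .hd (.cons (.comp (.cons (.cons .hd (.comp .tl .hd)) (.comp (.comp .tl .tl) .hd)) F)
      (.comp (.comp .tl .tl) .tl)))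

/-- If one step of the fold costs `c s x`, then the loop costs the sum of these, up to a constant
for every element. -/
theorem foldProg_eval (F : Prog) (e : Val) (f : σ → β → σ) (c : σ → β → ℕ)
    (hF : ∀ s x, ∃ t, F.Eval (.pair (.pair e (enc s)) (enc x)) (enc (f s x)) t ∧ t ≤ c s x)
    (l : List β) (s : σ) :
    ∃ t, (foldProg F).Eval (.pair e (.pair (enc s) (enc l)))
      (.pair e (.pair (enc (l.foldl f s)) (enc ([] : List β)))) t ∧
      t ≤ foldCost c f s l + 30 * l.length + 4 := by
  induction l generalizing s with
  | nil =>
    have h : (foldProg F).Eval (.pair e (.pair (enc s) (enc ([] : List β))))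
        (.pair e (.pair (enc s) (enc ([] : List β)))) (1 + 1 + 1 + 1) := by
      constructor
      exact .comp (.tl_pair _ _) (.tl_pair _ _)
    exact ⟨_, h, by simp [foldCost]⟩
  | cons x l ih =>
    obtain ⟨t, h1, h2⟩ := hF s x
    obtain ⟨u, h3, h4⟩ := ih (f s x)
    refine ⟨_, .while_step (.comp (.tl_pair _ _) (.tl_pair _ _))
      (.cons (.hd_pair _ _) (.cons (.comp (.cons (.cons (.hd_pair _ _) (.comp (.tl_pair _ _) (.hd_pair _ _)))
        (.comp (.comp (.tl_pair _ _) (.tl_pair _ _)) (.hd_pair _ _))) h1)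
        (.comp (.comp (.tl_pair _ _) (.tl_pair _ _)) (.tl_pair _ _)))) h3, ?_⟩
    simp only [foldCost, List.length_cons]
    omega

omit [Enc β] [Enc σ] in
/-- Step costs of the form `(d s x + 1) * Q` on states that satisfy the invariant add up to the sum
of the `d s x` plus the number of steps, times `Q`. -/
theorem foldCost_le (c d : σ → β → ℕ) (f : σ → β → σ) (Q : ℕ) (Inv : ℕ → σ → Prop) (l : List β)
    (s : σ) (h0 : Inv 0 s) (hstep : ∀ i s x, l[i]? = some x → Inv i s → Inv (i + 1) (f s x))
    (hc : ∀ i s x, l[i]? = some x → Inv i s → c s x ≤ (d s x + 1) * Q) :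
    foldCost c f s l ≤ (foldCost d f s l + l.length) * Q := by
  induction l generalizing s Inv with
  | nil => simp [foldCost]
  | cons x l ih =>
    have h1 := hc 0 s x rfl h0
    have h2 := ih (fun i => Inv (i + 1)) (f s x) (hstep 0 s x rfl h0)
      (fun i s y hy => hstep (i + 1) s y (by simpa using hy))
      (fun i s y hy => hc (i + 1) s y (by simpa using hy))
    simp only [foldCost, List.length_cons]
    calc _ ≤ (d s x + 1) * Q + _ := Nat.add_le_add h1 h2
      _ = _ := by ring

/-- A left fold costs the sum of the costs of its steps. The family `Inv` of invariants, indexed by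
the number of elements already processed, serves to bound the sizes of the states. -/
theorem PTK.foldlBig {K : α → ℕ} {Kf : (α × σ) × β → ℕ} {l : α → List β} {b : α → σ}
    {f : α → σ → β → σ} (hl : PTK K (fun a => Big.mk (l a))) (hb : PTK K b)
    (hf : PTK Kf (fun x : (α × σ) × β => f x.1.1 x.1.2 x.2))
    (Inv : α → ℕ → σ → Prop) (P : Polynomial ℕ) (h0 : ∀ a, Inv a 0 (b a))
    (hstep : ∀ a i s x, (l a)[i]? = some x → Inv a i s → Inv a (i + 1) (f a s x))
    (hsz : ∀ a i s, i ≤ (l a).length → Inv a i s → sz s ≤ P.eval (sz a))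
    (hx : ∀ a, ∀ x ∈ l a, sz x ≤ P.eval (sz a))
    (hK : ∀ a, foldCost (fun s x => Kf ((a, s), x)) (f a) (b a) (l a) + (l a).length ≤
      (K a + 1) * P.eval (sz a)) :
    PTK K (fun a => (l a).foldl (f a) (b a)) := by
  obtain ⟨A, p, hA⟩ := hl
  obtain ⟨B, q, hB⟩ := hb
  obtain ⟨F, r, hF⟩ := hf
  let S : Polynomial ℕ := r.comp (.X + P + P + 2)
  refine ⟨.comp (.comp (.cons .id (.cons B A)) (foldProg F)) (.comp .tl .hd),
    p + q + P * S + 30 * P + P + 20, fun a => ?_⟩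
  have hc : ∀ i s x, (l a)[i]? = some x → Inv a i s →
      (Kf ((a, s), x) + 1) * r.eval (sz ((a, s), x)) ≤ (Kf ((a, s), x) + 1) * S.eval (sz a) := by
    intro i s x hi hs
    have hil : i ≤ (l a).length := by
      obtain ⟨h, _⟩ := List.getElem?_eq_some_iff.1 hi; omega
    apply Nat.mul_le_mul_left
    simp only [S, Polynomial.eval_comp]
    apply polyMono
    have h1 := hsz a i s hil hs
    have h2 := hx a x (List.mem_of_getElem? hi)
    simp only [sz_pair, Polynomial.eval_add, Polynomial.eval_X, Polynomial.eval_ofNat]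
    omega
  have hcost := foldCost_le _ (fun s x => Kf ((a, s), x)) (f a) _ (Inv a) (l a) (b a) (h0 a)
    (hstep a) hc
  obtain ⟨⟨t, h1, h2⟩, -⟩ := hA a
  obtain ⟨⟨u, h3, h4⟩, -⟩ := hB a
  obtain ⟨v, h5, h6⟩ := foldProg_eval F (enc a) (f a) _ (fun s x => (hF ((a, s), x)).1) (l a) (b a)
  refine ⟨⟨_, .comp (.comp (.cons (.id _) (.cons h3 h1)) h5) (.comp (.tl_pair _ _) (.hd_pair _ _)), ?_⟩, ?_⟩
  · have h7 := hcost.trans (Nat.mul_le_mul_right _ (hK a))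
    have h8 : (l a).length ≤ (K a + 1) * P.eval (sz a) := le_trans (Nat.le_add_left _ _) (hK a)
    simp only [Polynomial.eval_add, Polynomial.eval_mul, Polynomial.eval_ofNat, mul_add]
    rw [mul_assoc] at h7
    rw [mul_left_comm _ 30]
    omega
  · have key : ∀ (l' : List β) (i : ℕ) (s : σ), (∀ j, l'[j]? = (l a)[i + j]?) → Inv a i s →
        Inv a (i + l'.length) (l'.foldl (f a) s) := by
      intro l'
      induction l' with
      | nil => intro i s _ h; simpa using h
      | cons x l' ih =>
        intro i s hj h
        have := ih (i + 1) (f a s x) (fun j => by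
          have := hj (j + 1); simp only [List.getElem?_cons_succ] at this; rw [this]; congr 1; omega)
          (hstep a i s x (by simpa using (hj 0).symm) h)
        simpa [add_assoc, add_comm 1] using this
    have := hsz a _ _ le_rfl (by simpa using key (l a) 0 (b a) (by simp) (h0 a))
    simp only [Polynomial.eval_add, Polynomial.eval_mul, Polynomial.eval_ofNat]
    omega

theorem sz_le_of_mem {l : List β} {x : β} (h : x ∈ l) : sz x + 1 ≤ sz l := by
  induction l with
  | nil => simp at h
  | cons y l ih =>
    simp only [sz, List.map_cons, List.sum_cons] at *
    rcases List.mem_cons.1 h with rfl | h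
    · omega
    · have := ih h; omega

theorem length_lt_sz (l : List β) : l.length < sz l := by
  induction l with
  | nil => simp [sz]
  | cons y l ih => simp only [sz, List.map_cons, List.sum_cons, List.length_cons] at *; omega

theorem PTK.mkBig {K : α → ℕ} {f : α → β} (hf : PTK K f) : PTK K (fun a => Big.mk (f a)) := by
  have : PT (fun x : β => Big.mk x) :=
    .of_prog .id 1 (fun _ => ⟨1, .id _, le_rfl⟩) 1 (by simp [sz])
  exact (this.toK (fun _ => 0)).comp hf (fun _ => Nat.zero_le _)

/-- The variant of `PTK.foldlBig` in which the list itself has polynomial size. -/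
theorem PTK.foldl {K : α → ℕ} {Kf : (α × σ) × β → ℕ} {l : α → List β} {b : α → σ}
    {f : α → σ → β → σ} (hl : PT l) (hb : PTK K b)
    (hf : PTK Kf (fun x : (α × σ) × β => f x.1.1 x.1.2 x.2))
    (Inv : α → ℕ → σ → Prop) (P : Polynomial ℕ) (h0 : ∀ a, Inv a 0 (b a))
    (hstep : ∀ a i s x, (l a)[i]? = some x → Inv a i s → Inv a (i + 1) (f a s x))
    (hsz : ∀ a i s, i ≤ (l a).length → Inv a i s → sz s ≤ P.eval (sz a))
    (hK : ∀ a, foldCost (fun s x => Kf ((a, s), x)) (f a) (b a) (l a) ≤ K a) :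
    PTK K (fun a => (l a).foldl (f a) (b a)) := by
  obtain ⟨A, p, hA⟩ := id hl
  refine PTK.foldlBig (PTK.mkBig (hl.toK K)) hb hf Inv (P + p + 1) h0 hstep ?_ ?_ ?_
  · intro a i s hi hs
    have := hsz a i s hi hs
    simp only [Polynomial.eval_add]; omega
  · intro a x hx
    have := (hA a).2
    have := sz_le_of_mem hx
    simp only [Polynomial.eval_add]; omega
  · intro a
    have h1 := (hA a).2
    have h2 := length_lt_sz (l a)
    have h3 := hK a
    simp only [Polynomial.eval_add, Polynomial.eval_one, add_mul, mul_add, one_mul, mul_one]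
    omega

omit [Enc β] [Enc σ] in
theorem foldCost_zero (f : σ → β → σ) (s : σ) (l : List β) : foldCost (fun _ _ => 0) f s l = 0 := by
  induction l generalizing s with
  | nil => rfl
  | cons x l ih => simp [foldCost, ih]

theorem PT.foldl {l : α → List β} {b : α → σ}
    {f : α → σ → β → σ} (hl : PT l) (hb : PT b)
    (hf : PT (fun x : (α × σ) × β => f x.1.1 x.1.2 x.2))
    (Inv : α → ℕ → σ → Prop) (P : Polynomial ℕ) (h0 : ∀ a, Inv a 0 (b a))
    (hstep : ∀ a i s x, (l a)[i]? = some x → Inv a i s → Inv a (i + 1) (f a s x))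
    (hsz : ∀ a i s, i ≤ (l a).length → Inv a i s → sz s ≤ P.eval (sz a)) :
    PT (fun a => (l a).foldl (f a) (b a)) :=
  PTK.foldl hl hb hf Inv P h0 hstep hsz (fun a => by simp [foldCost_zero])

theorem PT.exists_sz {f : α → β} (hf : PT f) : ∃ p : Polynomial ℕ, ∀ a, sz (f a) ≤ p.eval (sz a) := by
  obtain ⟨_, p, h⟩ := hf
  exact ⟨p, fun a => (h a).2⟩

/-- A fold whose state always has size bounded by the size of some polynomial time function. -/
theorem PT.foldl_const {l : α → List β} {b : α → σ}
    {f : α → σ → β → σ} (hl : PT l) (hb : PT b)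
    (hf : PT (fun x : (α × σ) × β => f x.1.1 x.1.2 x.2)) (P : Polynomial ℕ)
    (hsz : ∀ a s x, sz (f a s x) ≤ P.eval (sz a)) :
    PT (fun a => (l a).foldl (f a) (b a)) := by
  obtain ⟨p, hp⟩ := hb.exists_sz
  refine PT.foldl hl hb hf (fun a _ s => sz s ≤ (P + p).eval (sz a)) (P + p) ?_ ?_ ?_
  · intro a; have := hp a; simp only [Polynomial.eval_add]; omega
  · intro a i s x _ _; have := hsz a s x; simp only [Polynomial.eval_add]; omega
  · intro a i s _ h; exact h

@[fun_prop] theorem PT.foldl_bool {l : α → List β} {b : α → Bool}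
    {f : α → Bool → β → Bool} (hl : PT l) (hb : PT b)
    (hf : PT (fun x : (α × Bool) × β => f x.1.1 x.1.2 x.2)) :
    PT (fun a => (l a).foldl (f a) (b a)) :=
  PT.foldl_const hl hb hf 1 (by simp [sz])

@[fun_prop] theorem PT.reverse {l : α → List β} (hl : PT l) : PT (fun a => (l a).reverse) := by
  have : PT (fun l : List β => l.foldl (fun acc x => x :: acc) []) := by
    refine PT.foldl (by fun_prop) (by fun_prop) (by fun_prop)
      (fun a i s => sz s ≤ sz (a.take i)) .X (by intro a; simp [sz]) ?_ ?_
    · intro a i s x hx hs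
      rw [List.take_add_one, hx]
      simp [sz] at *
      omega
    · intro a i s _ hs
      simpa using hs.trans (sz_take_le a i)
  have h2 : ∀ l : List β, l.foldl (fun acc x => x :: acc) [] = l.reverse := by intro l; simp
  simpa only [h2] using this.comp hl

theorem sz_list_le {l : List β} {Q m : ℕ} (h : ∀ x ∈ l, sz x ≤ Q) (hm : l.length ≤ m) :
    sz l ≤ m * (Q + 1) + 1 := by
  have h2 : sz l ≤ l.length * (Q + 1) + 1 := by
    clear hm
    induction l with
    | nil => simp [sz]
    | cons y l ih =>
      have := ih fun x hx => h x (List.mem_cons_of_mem _ hx)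
      have := h y (by simp)
      simp only [sz, List.map_cons, List.sum_cons, List.length_cons, add_mul, one_mul] at *
      omega
  exact h2.trans (by gcongr)

omit [Enc β] [Enc σ] in
theorem foldCost_map (c : β → ℕ) (f : σ → β → σ) (s : σ) (l : List β) :
    foldCost (fun _ x => c x) f s l = (l.map c).sum := by
  induction l generalizing s with
  | nil => rfl
  | cons x l ih => simp [foldCost, ih]

/-- Mapping costs the sum of the costs over all elements of the list. -/
theorem PTK.map {Kf : α × β → ℕ} {l : α → List β} {f : α → β → γ} (hl : PT l)
    (hf : PTK Kf (fun x : α × β => f x.1 x.2)) :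
    PTK (fun a => ((l a).map fun x => Kf (a, x)).sum) (fun a => (l a).map (f a)) := by
  obtain ⟨p, hp⟩ := hl.exists_sz
  have hf' : PTK (fun x : (α × List γ) × β => Kf (x.1.1, x.2))
      (fun x : (α × List γ) × β => f x.1.1 x.2 :: x.1.2) := by
    have h1 : PTK (fun x : (α × List γ) × β => Kf (x.1.1, x.2))
      (fun x : (α × List γ) × β => f x.1.1 x.2) :=
      PTK.comp (f := fun x : (α × List γ) × β => (x.1.1, x.2)) hf
        (PT.toK (by fun_prop) _) (fun _ => le_rfl)
    have h2 : PT (fun x : γ × List γ => x.1 :: x.2) := by fun_prop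
    exact PTK.comp h2 (h1.pair (PT.toK (f := fun x : (α × List γ) × β => x.1.2) (by fun_prop) _))
      (fun _ => Nat.zero_le _)
  obtain ⟨A, q, hq⟩ := id hf
  have hb : ∀ a, ∀ x ∈ l a, sz (f a x) ≤ q.eval (sz a + p.eval (sz a) + 1) := by
    intro a x hx
    refine (hq (a, x)).2.trans (polyMono _ ?_)
    have := sz_le_of_mem hx
    have := hp a
    simp only [sz] at *; omega
  have : PTK (fun a => ((l a).map fun x => Kf (a, x)).sum)
      (fun a => (l a).foldl (fun acc x => f a x :: acc) []) := by
    refine PTK.foldl hl (PT.toK (by fun_prop) _) hf'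
      (fun a i s => s.length = i ∧ ∀ y ∈ s, sz y ≤ q.eval (sz a + p.eval (sz a) + 1))
      (p * (q.comp (.X + p + 1) + 1) + 1) (by simp) ?_ ?_ ?_
    · rintro a i s x hx ⟨h1, h2⟩
      refine ⟨by simp [h1], ?_⟩
      simp only [List.mem_cons, forall_eq_or_imp]
      exact ⟨hb a x (List.mem_of_getElem? hx), h2⟩
    · rintro a i s hi ⟨h1, h2⟩
      have h3 := sz_list_le (m := p.eval (sz a)) h2 (by
        have := length_lt_sz (l a); have := hp a; omega)
      simpa [Polynomial.eval_comp] using h3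
    · intro a
      rw [foldCost_map (fun x => Kf (a, x))]
  have h4 := PTK.comp (PT.reverse (l := fun x : List γ => x) (by fun_prop)) this
    (fun _ => Nat.zero_le _)
  convert h4 using 2 with a
  have : ∀ (l : List β) (f : β → γ) acc, l.foldl (fun acc x => f x :: acc) acc = (l.map f).reverse ++ acc := by
    intro l f
    induction l with
    | nil => simp
    | cons x l ih => intro acc; simp [ih]
  simp [this]

@[fun_prop] theorem PT.map {l : α → List β} {f : α → β → γ} (hl : PT l)
    (hf : PT (fun x : α × β => f x.1 x.2)) : PT (fun a => (l a).map (f a)) :=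
  PTK.mono (PTK.map hl hf) (by simp)

@[fun_prop] theorem PT.filter {l : α → List β} {f : α → β → Bool} (hl : PT l)
    (hf : PT (fun x : α × β => f x.1 x.2)) : PT (fun a => (l a).filter (f a)) := by
  obtain ⟨p, hp⟩ := hl.exists_sz
  have : PT (fun a => (l a).foldl (fun acc x => _root_.cond (f a x) (x :: acc) acc) []) := by
    refine PT.foldl hl (by fun_prop) (by fun_prop)
      (fun a i s => s.length ≤ i ∧ ∀ y ∈ s, sz y ≤ p.eval (sz a))
      (p * (p + 1) + 1) (by simp) ?_ ?_
    · rintro a i s x hx ⟨h1, h2⟩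
      cases f a x
      · exact ⟨by simp; omega, h2⟩
      · refine ⟨by simp [h1], ?_⟩
        simp only [cond_true, List.mem_cons, forall_eq_or_imp]
        have := sz_le_of_mem (List.mem_of_getElem? hx)
        have := hp a
        exact ⟨by omega, h2⟩
    · rintro a i s hi ⟨h1, h2⟩
      have h3 := sz_list_le (m := p.eval (sz a)) h2 (by
        have := length_lt_sz (l a); have := hp a; omega)
      simpa using h3
  have h4 := this.reverse
  convert h4 using 2 with a
  have : ∀ (l : List β) (f : β → Bool) acc, l.foldl (fun acc x => _root_.cond (f x) (x :: acc) acc) acc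
      = (l.filter f).reverse ++ acc := by
    intro l f
    induction l with
    | nil => simp
    | cons x l ih => intro acc; cases h : f x <;> simp [ih, h]
  simp [this]

@[fun_prop] theorem PT.any {l : α → List β} {f : α → β → Bool} (hl : PT l)
    (hf : PT (fun x : α × β => f x.1 x.2)) : PT (fun a => (l a).any (f a)) := by
  have : PT (fun a => !((l a).filter (f a)).isEmpty) := by fun_prop
  convert this using 2 with a
  rw [Bool.eq_iff_iff]; simp

@[fun_prop] theorem PT.all {l : α → List β} {f : α → β → Bool} (hl : PT l)
    (hf : PT (fun x : α × β => f x.1 x.2)) : PT (fun a => (l a).all (f a)) := by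
  have : PT (fun a => !(l a).any (fun x => !(f a x))) := by fun_prop
  convert this using 2 with a
  rw [Bool.eq_iff_iff]; simp

@[fun_prop] theorem PT.append {f g : α → List β} (hf : PT f) (hg : PT g) :
    PT (fun a => f a ++ g a) := by
  have : PT (fun x : List β × List β => x.1.reverse.foldl (fun acc x => x :: acc) x.2) := by
    refine PT.foldl (by fun_prop) (by fun_prop) (by fun_prop)
      (fun a i s => sz s ≤ sz (a.1.reverse.take i) + sz a.2) (.X) (by intro a; simp [sz]) ?_ ?_
    · intro a i s x hx hs
      rw [List.take_add_one, hx]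
      simp [sz] at *
      omega
    · intro a i s _ hs
      refine hs.trans ?_
      have := sz_take_le a.1.reverse i
      rw [sz_reverse] at this
      simp only [Polynomial.eval_X, sz_pair]
      omega
  have h2 := this.comp (hf.pair hg)
  simpa using h2

end basic

/-! ### Unary numbers, ranges and indexing -/

section nat
variable {α β γ σ : Type} [Enc α] [Enc β] [Enc γ] [Enc σ]

theorem sz_nat (n : ℕ) : sz n = n + 1 := rfl

/-- A unary number is the list of its units. -/
def units (n : ℕ) : List Bool := List.replicate n false

@[fun_prop] theorem pt_units {f : α → ℕ} (hf : PT f) : PT (fun a => units (f a)) := by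
  have : PT (fun n => CVC.units n) :=
    .of_prog .id 1 (fun n => ⟨1, by
      have : enc (CVC.units n) = enc n := by simp [enc, CVC.units, encBool]
      rw [this]; exact .id _, le_rfl⟩) (2 * .X) (by
      intro a; simp [sz, CVC.units]; omega)
  exact this.comp hf

@[fun_prop] theorem PT.length {f : α → List β} (hf : PT f) : PT (fun a => (f a).length) := by
  have h0 : PT (fun l : List Bool => l.foldl (fun (acc : List Bool) _ => false :: acc) []) := by
    have : PT (fun l : List Bool => l.map (fun _ => false)) := by fun_prop
    convert this using 2 with l
    have : ∀ (l : List Bool) acc, l.foldl (fun (acc : List Bool) _ => false :: acc) acc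
      = l.map (fun _ => false) ++ acc := by
      intro l
      induction l with
      | nil => simp
      | cons x l ih =>
        intro acc
        rw [List.foldl_cons, ih]
        simp only [List.map_const', List.length_cons, List.replicate_succ', List.append_assoc,
          List.singleton_append]
    simp [this]
  have h1 : PT (fun l : List Bool => (l.map (fun _ => false)).length) := by
    have h2 : PT (fun l : List Bool => l.map (fun _ => false)) := by fun_prop
    obtain ⟨A, p, hA⟩ := h2
    refine ⟨A, p + .X, fun l => ?_⟩
    obtain ⟨⟨t, h3, h4⟩, -⟩ := hA l
    refine ⟨⟨t, ?_, h4.trans (by simp)⟩, ?_⟩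
    · have : enc (l.map (fun _ => false)).length = enc (l.map (fun _ => false)) := by
        simp [enc, encBool]
      rw [this]; exact h3
    · have := length_lt_sz l
      simp only [sz_nat, List.length_map, Polynomial.eval_add, Polynomial.eval_X]; omega
  have h3 : PT (fun a => (f a).map fun _ => false) := by fun_prop
  simpa using h1.comp h3

@[fun_prop] theorem PT.succ {f : α → ℕ} (hf : PT f) : PT (fun a => f a + 1) := by
  have : PT (fun a => (false :: units (f a)).length) := by fun_prop
  simpa [CVC.units] using this

@[fun_prop] theorem PT.add {f g : α → ℕ} (hf : PT f) (hg : PT g) : PT (fun a => f a + g a) := by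
  have : PT (fun a => (units (f a) ++ units (g a)).length) := by fun_prop
  simpa [CVC.units] using this

@[fun_prop] theorem PT.mul {f g : α → ℕ} (hf : PT f) (hg : PT g) : PT (fun a => f a * g a) := by
  have : PT (fun x : ℕ × ℕ => (CVC.units x.1).foldl (fun acc _ => acc + x.2) 0) := by
    refine PT.foldl (by fun_prop) (by fun_prop) (by fun_prop) (fun a i s => s = i * a.2)
      (.X * .X + 1) (by simp) (by rintro a i s x - rfl; ring) ?_
    rintro ⟨a, b⟩ i s hi rfl
    simp only [CVC.units, List.length_replicate] at hi
    simp only [sz_nat, sz_pair, Polynomial.eval_add, Polynomial.eval_mul, Polynomial.eval_X,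
      Polynomial.eval_one]
    have : i * b ≤ (a + 1 + (b + 1) + 1) * (a + 1 + (b + 1) + 1) :=
      Nat.mul_le_mul (by omega) (by omega)
    omega
  have h2 : ∀ a b : ℕ, (CVC.units a).foldl (fun acc _ => acc + b) 0 = a * b := by
    intro a b
    have : ∀ a acc, (CVC.units a).foldl (fun acc _ => acc + b) acc = acc + a * b := by
      intro a
      induction a with
      | zero => simp [CVC.units]
      | succ a ih =>
        intro acc
        simp only [CVC.units, List.replicate_succ, List.foldl_cons] at *
        rw [ih]; ring
    simpa using this a 0
  simpa only [h2] using this.comp (hf.pair hg)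

@[fun_prop] theorem PT.drop {f : α → ℕ} {g : α → List β} (hf : PT f) (hg : PT g) :
    PT (fun a => (g a).drop (f a)) := by
  have : PT (fun x : ℕ × List β => (CVC.units x.1).foldl (fun acc _ => acc.tail) x.2) := by
    refine PT.foldl (by fun_prop) (by fun_prop) (by fun_prop) (fun a i s => sz s ≤ sz a.2)
      .X (fun _ => le_rfl) (fun a i s x _ h => le_trans ?_ h) ?_
    · cases s <;> simp [sz_list_cons]; omega
    · rintro ⟨a, b⟩ i s hi h
      simp only [sz_pair, Polynomial.eval_X] at h ⊢; omega
  have h2 : ∀ (a : ℕ) (b : List β), (CVC.units a).foldl (fun acc _ => acc.tail) b = b.drop a := by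
    intro a
    induction a with
    | zero => simp [CVC.units]
    | succ a ih =>
      intro b
      simp only [CVC.units, List.replicate_succ, List.foldl_cons] at *
      rw [ih]; simp
  simpa only [h2] using this.comp (hf.pair hg)

@[fun_prop] theorem PT.take {f : α → ℕ} {g : α → List β} (hf : PT f) (hg : PT g) :
    PT (fun a => (g a).take (f a)) := by
  have : PT (fun a => ((g a).reverse.drop (((units (g a).length)).drop (f a)).length).reverse) := by
    fun_prop
  convert this using 2 with a
  simp only [List.length_drop, CVC.units, List.length_replicate]
  rw [List.drop_reverse, List.reverse_reverse]
  rcases le_total (f a) (g a).length with h | h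
  · congr 1; omega
  · rw [List.take_of_length_le h, List.take_of_length_le]; omega

@[fun_prop] theorem PT.sub {f g : α → ℕ} (hf : PT f) (hg : PT g) : PT (fun a => f a - g a) := by
  have : PT (fun a => ((units (f a)).drop (g a)).length) := by fun_prop
  simpa [CVC.units] using this

@[fun_prop] theorem PT.le {f g : α → ℕ} (hf : PT f) (hg : PT g) :
    PT (fun a => decide (f a ≤ g a)) := by
  have : PT (fun a => ((units (f a)).drop (g a)).isEmpty) := by fun_prop
  convert this using 2 with a
  rw [Bool.eq_iff_iff]; simp [CVC.units, Nat.sub_eq_zero_iff_le]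

@[fun_prop] theorem PT.beq {f g : α → ℕ} (hf : PT f) (hg : PT g) :
    PT (fun a => f a == g a) := by
  have : PT (fun a => decide (f a ≤ g a) && decide (g a ≤ f a)) := by fun_prop
  convert this using 2 with a
  rw [Bool.eq_iff_iff]; simp; omega

@[fun_prop] theorem PT.getD {f : α → List β} {g : α → ℕ} {d : α → β} (hf : PT f) (hg : PT g)
    (hd : PT d) : PT (fun a => (f a).getD (g a) (d a)) := by
  have : PT (fun a => ((f a).drop (g a)).headD (d a)) := by fun_prop
  convert this using 2 with a
  simp [List.headD_eq_head?_getD, List.head?_drop]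

@[fun_prop] theorem PT.range {f : α → ℕ} (hf : PT f) : PT (fun a => List.range (f a)) := by
  have : PT (fun n : ℕ => (CVC.units n).foldl (fun (s : List ℕ) _ => s.length :: s) []) := by
    refine PT.foldl (by fun_prop) (by fun_prop) (by fun_prop)
      (fun n i s => s.length = i ∧ ∀ x ∈ s, x < i) (.X * (.X + 1) + 1) (by simp) ?_ ?_
    · rintro a i s x - ⟨rfl, h⟩
      refine ⟨rfl, ?_⟩
      simp only [List.mem_cons, forall_eq_or_imp, Nat.lt_succ_self, true_and]
      intro y hy; have := h y hy; omega
    · rintro n i s hi ⟨rfl, h⟩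
      simp only [CVC.units, List.length_replicate] at hi
      have := sz_list_le (l := s) (Q := n + 1) (m := n + 1) (by
        intro x hx; have := h x hx; simp only [sz_nat]; omega) (by omega)
      simpa [sz_nat] using this
  have h2 : ∀ n : ℕ, (CVC.units n).foldl (fun (s : List ℕ) _ => s.length :: s) []
      = (List.range n).reverse := by
    intro n
    induction n with
    | zero => rfl
    | succ n ih =>
      simp only [CVC.units] at *
      rw [List.replicate_succ', List.foldl_append, ih, List.range_succ]
      simp
  simp only [h2] at this
  simpa using (this.reverse).comp hf

@[fun_prop] theorem PT.flatten {f : α → List (List β)} (hf : PT f) : PT (fun a => (f a).flatten) := by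
  have : PT (fun l : List (List β) => l.foldl (fun acc x => acc ++ x) []) := by
    refine PT.foldl (by fun_prop) (by fun_prop) (by fun_prop)
      (fun a i s => sz s ≤ sz (a.take i)) .X (by intro a; simp [sz]) ?_ ?_
    · intro a i s x hx hs
      rw [List.take_add_one, hx]
      have h1 := sz_append s x
      have h2 := sz_append (a.take i) [x]
      simp only [Option.toList_some, sz_list_cons, sz_list_nil] at *
      omega
    · intro a i s _ hs
      simpa using hs.trans (sz_take_le a i)
  have h2 : ∀ l : List (List β), l.foldl (fun acc x => acc ++ x) [] = l.flatten := by
    intro l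
    have : ∀ (l : List (List β)) acc, l.foldl (fun acc x => acc ++ x) acc = acc ++ l.flatten := by
      intro l
      induction l with
      | nil => simp
      | cons x l ih => intro acc; simp [ih]
    simpa using this l []
  simpa only [h2] using this.comp hf

end nat
end CVC
namespace CVC
open Enc

/-! ### Bit vectors -/

/-- A set of vertices, or a polynomial over the field with two elements, as a bit vector. -/
abbrev BV := List Bool

/-- A graph as its adjacency matrix. -/
abbrev Gr := List BV

/-- Membership in a set of vertices, or the coefficient of a polynomial; positions beyond the end
count as absent. -/
def mem (S : BV) (i : ℕ) : Bool := S.getD i false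

/-- The bit vector of length `n` with the entries given by `p`. -/
def mkV (n : ℕ) (p : ℕ → Bool) : BV := (List.range n).map p

/-- Whether `p` holds for some number below `n`. -/
def anyR (n : ℕ) (p : ℕ → Bool) : Bool := (List.range n).any p

/-- Whether `p` holds for all numbers below `n`. -/
def allR (n : ℕ) (p : ℕ → Bool) : Bool := (List.range n).all p

/-- Adjacency in a graph given by its adjacency matrix. -/
def adj (G : Gr) (i j : ℕ) : Bool := mem (G.getD i []) j

/-- The elements of a set of vertices in increasing order. -/
def elems (n : ℕ) (S : BV) : List ℕ := (List.range n).filter (mem S)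

/-- The least element of a nonempty set of vertices. -/
def firstV (n : ℕ) (S : BV) : ℕ := (elems n S).headD 0

/-- The number of elements of a set of vertices. -/
def cardV (n : ℕ) (S : BV) : ℕ := (elems n S).length

/-- Equality of two sets of vertices, regardless of trailing zeros of the bit vectors. -/
def eqV (n : ℕ) (A B : BV) : Bool := allR n (fun i => mem A i == mem B i)

/-- The difference of two sets of vertices. -/
def diffV (n : ℕ) (A B : BV) : BV := mkV n (fun i => mem A i && !mem B i)

/-- The minimum, written by means of `cond` in order to be computed by a program. -/
def minN (a b : ℕ) : ℕ := cond (decide (a ≤ b)) a b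

theorem minN_eq (a b : ℕ) : minN a b = min a b := by
  unfold minN; by_cases h : a ≤ b <;> simp [h]; omega

section
variable {α : Type} [Enc α]

theorem sz_mkV (n : ℕ) (p : ℕ → Bool) : sz (mkV n p) = 2 * n + 1 := by
  unfold mkV
  generalize hl : List.range n = l
  have : l.length = n := by simp [← hl]
  rw [← this]
  clear hl this
  induction l with
  | nil => rfl
  | cons x l ih =>
    rw [List.map_cons, sz_list_cons, ih, List.length_cons]
    change 1 + _ + 1 = _
    omega

@[fun_prop] theorem pt_mem {S : α → BV} {i : α → ℕ} (hS : PT S) (hi : PT i) :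
    PT (fun a => mem (S a) (i a)) := by unfold mem; fun_prop

@[fun_prop] theorem pt_mkV {n : α → ℕ} {p : α → ℕ → Bool} (hn : PT n)
    (hp : PT (fun x : α × ℕ => p x.1 x.2)) : PT (fun a => mkV (n a) (p a)) := by
  unfold mkV; fun_prop

@[fun_prop] theorem pt_anyR {n : α → ℕ} {p : α → ℕ → Bool} (hn : PT n)
    (hp : PT (fun x : α × ℕ => p x.1 x.2)) : PT (fun a => anyR (n a) (p a)) := by
  unfold anyR; fun_prop

@[fun_prop] theorem pt_allR {n : α → ℕ} {p : α → ℕ → Bool} (hn : PT n)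
    (hp : PT (fun x : α × ℕ => p x.1 x.2)) : PT (fun a => allR (n a) (p a)) := by
  unfold allR; fun_prop

@[fun_prop] theorem pt_adj {G : α → Gr} {i j : α → ℕ} (hG : PT G) (hi : PT i) (hj : PT j) :
    PT (fun a => adj (G a) (i a) (j a)) := by unfold adj; fun_prop

@[fun_prop] theorem pt_elems {n : α → ℕ} {S : α → BV} (hn : PT n) (hS : PT S) :
    PT (fun a => elems (n a) (S a)) := by unfold elems; fun_prop

@[fun_prop] theorem pt_firstV {n : α → ℕ} {S : α → BV} (hn : PT n) (hS : PT S) :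
    PT (fun a => firstV (n a) (S a)) := by unfold firstV; fun_prop

@[fun_prop] theorem pt_cardV {n : α → ℕ} {S : α → BV} (hn : PT n) (hS : PT S) :
    PT (fun a => cardV (n a) (S a)) := by unfold cardV; fun_prop

@[fun_prop] theorem pt_eqV {n : α → ℕ} {S T : α → BV} (hn : PT n) (hS : PT S) (hT : PT T) :
    PT (fun a => eqV (n a) (S a) (T a)) := by unfold eqV; fun_prop

@[fun_prop] theorem pt_diffV {n : α → ℕ} {S T : α → BV} (hn : PT n) (hS : PT S) (hT : PT T) :
    PT (fun a => diffV (n a) (S a) (T a)) := by unfold diffV; fun_prop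

@[fun_prop] theorem pt_minN {f g : α → ℕ} (hf : PT f) (hg : PT g) :
    PT (fun a => minN (f a) (g a)) := by unfold minN; fun_prop

end

/-! ### Truncated polynomials over the field with two elements -/

/-- The sum of two polynomials, truncated at degree `D`. -/
def addP (D : ℕ) (p q : BV) : BV := mkV D fun i => xor (mem p i) (mem q i)

/-- The product of two polynomials, truncated at degree `D`. -/
def mulP (D : ℕ) (p q : BV) : BV :=
  mkV D fun i => (List.range (i + 1)).foldl (fun acc j => xor acc (mem p j && mem q (i - j))) false

/-- The monomial of degree `w`, which is zero if `w` is at least the truncation degree `D`. -/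
def monoP (D w : ℕ) : BV := mkV D fun i => i == w

/-- The sum of a list of truncated polynomials. -/
def sumP (D : ℕ) (l : List BV) : BV := l.foldl (addP D) []

/-- The product of a list of truncated polynomials. -/
def prodP (D : ℕ) (l : List BV) : BV := l.foldl (mulP D) (monoP D 0)

section
variable {α : Type} [Enc α]

@[fun_prop] theorem pt_addP {D : α → ℕ} {p q : α → BV} (hD : PT D) (hp : PT p) (hq : PT q) :
    PT (fun a => addP (D a) (p a) (q a)) := by unfold addP; fun_prop

@[fun_prop] theorem pt_mulP {D : α → ℕ} {p q : α → BV} (hD : PT D) (hp : PT p) (hq : PT q) :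
    PT (fun a => mulP (D a) (p a) (q a)) := by unfold mulP; fun_prop

@[fun_prop] theorem pt_monoP {D w : α → ℕ} (hD : PT D) (hw : PT w) :
    PT (fun a => monoP (D a) (w a)) := by unfold monoP; fun_prop

@[fun_prop] theorem pt_sumP {D : α → ℕ} {l : α → List BV} (hD : PT D) (hl : PT l) :
    PT (fun a => sumP (D a) (l a)) := by
  obtain ⟨P, hP⟩ := hD.exists_sz
  refine PT.foldl_const hl (by fun_prop) (by fun_prop) (2 * P + 1) ?_
  intro a s x
  have := hP a
  rw [addP, sz_mkV]
  simp [sz_nat] at this ⊢; omega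

@[fun_prop] theorem pt_prodP {D : α → ℕ} {l : α → List BV} (hD : PT D) (hl : PT l) :
    PT (fun a => prodP (D a) (l a)) := by
  obtain ⟨P, hP⟩ := hD.exists_sz
  refine PT.foldl_const hl (by fun_prop) (by fun_prop) (2 * P + 1) ?_
  intro a s x
  have := hP a
  rw [mulP, sz_mkV]
  simp [sz_nat] at this ⊢; omega

end

/-! ### Binary numbers -/

/-- The smaller of `cap` and the number with the given bits, least significant bit first. -/
def hornerCap (cap : ℕ) (l : List Bool) : ℕ :=
  l.reverse.foldl (fun acc b => minN (acc + acc + cond b 1 0) cap) 0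

/-- The value of a list of bits, least significant bit first. -/
def bval (l : List Bool) : ℕ := l.reverse.foldl (fun acc b => acc + acc + cond b 1 0) 0

theorem bval_nil : bval [] = 0 := rfl

theorem bval_cons (b : Bool) (l : List Bool) : bval (b :: l) = cond b 1 0 + 2 * bval l := by
  simp [bval]; omega

theorem hornerCap_eq (cap : ℕ) (l : List Bool) : hornerCap cap l = min (bval l) cap := by
  induction l with
  | nil => simp [hornerCap, bval]
  | cons b l ih =>
    simp only [hornerCap, bval, List.reverse_cons, List.foldl_append, List.foldl_cons,
      List.foldl_nil] at *
    rw [ih, minN_eq]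
    omega

theorem bval_bits (n : ℕ) : bval n.bits = n := by
  induction n using Nat.binaryRec' with
  | zero => simp [bval]
  | bit b n h ih =>
    rw [Nat.bits_append_bit _ _ h, bval_cons, ih]
    cases b <;> simp [Nat.bit]; omega

theorem bits_length_le (n : ℕ) : n.bits.length ≤ n := by
  rw [Nat.size_eq_bits_len]
  exact Nat.size_le.2 Nat.lt_two_pow_self

/-- The binary digits, least significant digit first. -/
def bitsOf (n : BinNat) : List Bool := n.val.bits

/-- The conversion from binary to unary. It takes polynomial time because the size of a `BinNat` is
its value. -/
def binVal (n : BinNat) : ℕ := n.val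

section
variable {α : Type} [Enc α]

@[fun_prop] theorem pt_hornerCap {cap : α → ℕ} {l : α → List Bool} (hc : PT cap) (hl : PT l) :
    PT (fun a => hornerCap (cap a) (l a)) := by
  obtain ⟨P, hP⟩ := hc.exists_sz
  refine PT.foldl_const (by fun_prop) (by fun_prop) (by fun_prop) P ?_
  intro a s x
  have := hP a
  rw [minN_eq]
  simp only [sz_nat] at *
  omega

@[fun_prop] theorem pt_bitsOf {f : α → BinNat} (hf : PT f) : PT (fun a => bitsOf (f a)) := by
  have : PT bitsOf := .of_prog .id 1 (fun _ => ⟨1, .id _, le_rfl⟩) (2 * .X + 1) (by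
    intro a
    have h1 := sz_list_le (l := bitsOf a) (Q := 1) (m := a.val) (fun x _ => le_rfl)
      (bits_length_le a.val)
    have : sz a = a.val + 1 := rfl
    simp [this]; omega)
  exact this.comp hf

/-- The accumulator of Horner's rule never exceeds the final value, which is the size of the
argument. -/
@[fun_prop] theorem pt_binVal {f : α → BinNat} (hf : PT f) : PT (fun a => binVal (f a)) := by
  have : PT (fun a : BinNat => (bitsOf a).reverse.foldl (fun acc b => acc + acc + cond b 1 0) 0) := by
    refine PT.foldl (by fun_prop) (by fun_prop) (by fun_prop)
      (fun a i s => ((bitsOf a).reverse.drop i).foldl (fun acc b => acc + acc + cond b 1 0) s = a.val)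
      .X ?_ ?_ ?_
    · intro a; exact bval_bits a.val
    · intro a i s x hx hs
      rw [List.drop_eq_getElem?_toList_append, hx] at hs
      simpa using hs
    · intro a i s hi h
      -- continuing Horner's rule does not decrease the accumulator
      have key : ∀ (l : List Bool) (s : ℕ), s ≤ l.foldl (fun acc b => acc + acc + cond b 1 0) s := by
        intro l
        induction l with
        | nil => simp
        | cons x l ih =>
          intro s
          have : s ≤ s + s + cond x 1 0 := by omega
          exact this.trans (ih _)
      have h2 := key _ _ |>.trans_eq h
      have : sz a = a.val + 1 := rfl
      simp [this, sz_nat]; omega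
  have h2 : ∀ a : BinNat, (bitsOf a).reverse.foldl (fun acc b => acc + acc + cond b 1 0) 0 = binVal a :=
    fun a => bval_bits a.val
  simp only [h2] at this
  exact this.comp hf

end

/-! ### Splitting a module -/

/-- One round of closing `S` inside `M`. A vertex of `M` is added if it has a neighbour in `S`
(or `c1` holds) and a non-neighbour in `S` (or `c0` holds). -/
def closeStep (G : Gr) (M : BV) (c1 c0 : Bool) (S : BV) : BV :=
  mkV G.length fun w => mem S w || (mem M w && (c1 || anyR G.length fun a => mem S a && adj G a w) &&
    (c0 || anyR G.length fun a => mem S a && !adj G a w))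

/-- With `c0` this is the connected component of `S` in `G[M]`, with `c1` the component in the
complement, and without both the smallest module containing `S`. As many rounds as there are vertices
reach a fixed point. -/
def closure (G : Gr) (M : BV) (c1 c0 : Bool) (S : BV) : BV :=
  (List.range G.length).foldl (fun S _ => closeStep G M c1 c0 S) S

/-- The component, or with `c1` instead of `c0` the component in the complement, of the first
vertex of `M`. -/
def firstComp (G : Gr) (M : BV) (c1 c0 : Bool) : BV :=
  closure G M c1 c0 (mkV G.length fun i => i == firstV G.length M)

/-- The side of `u` in the partition of `M` into `C` and its complement. -/
def biPart (G : Gr) (M C : BV) (u : ℕ) : BV := cond (mem C u) C (diffV G.length M C)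

/-- The part of `u` in the partition of `M` used by the algorithm: a component and the rest if `M` is
disconnected or co-disconnected, and otherwise the canonical partition, in which `v` lies in the part
of `u` if the smallest module containing both is a proper subset of `M`. -/
def part (G : Gr) (M : BV) (u : ℕ) : BV :=
  cond (!eqV G.length (firstComp G M false true) M) (biPart G M (firstComp G M false true) u)
    (cond (!eqV G.length (firstComp G M true false) M) (biPart G M (firstComp G M true false) u)
      (mkV G.length fun v => mem M v &&
        !eqV G.length (closure G M false false (mkV G.length fun i => i == u || i == v)) M))

/-- The tree decompositions in the input: module, tree and bags. -/
abbrev Dec := List (BV × (Gr × List BV))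

/-- The bags used at the module `M`: the single bag `M` if `M` is split into two parts, and
otherwise the bags of the given tree decomposition of its quotient. A bag is a union of parts, so
that it contains the representative of a part if and only if it contains the part. -/
def bags (G : Gr) (dec : Dec) (M : BV) : List BV :=
  cond (!eqV G.length (firstComp G M false true) M || !eqV G.length (firstComp G M true false) M) [M]
    ((dec.filter fun d => eqV G.length d.1 M).headD ([], ([], []))).2.2

/-- The least elements of the parts of `M`. -/
def reps (G : Gr) (M : BV) : BV :=
  mkV G.length fun u => mem M u && firstV G.length (part G M u) == u

/-- The parts of `M`, one for each representative. -/
def parts (G : Gr) (M : BV) : List BV := (elems G.length (reps G M)).map (part G M)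

/-- The modules to be processed below `M`: none for a single vertex, otherwise the parts of `M`. -/
def children (G : Gr) (M : BV) : List BV := cond (decide (cardV G.length M ≤ 1)) [] (parts G M)

/-- Move the first module of the queue to the list of finished modules and its parts to the
queue. -/
def expandStep (G : Gr) (s : List BV × List BV) : List BV × List BV :=
  cond s.1.isEmpty s (children G (s.1.headD []) ++ s.1.tail, s.1.headD [] :: s.2)

/-- The set of all vertices. -/
def allV (G : Gr) : BV := mkV G.length fun _ => true

/-- The modules obtained from the set of all vertices by repeated splitting. There are less than twice
as many as vertices, so the queue is empty at the end. -/
def nodes (G : Gr) : List BV :=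
  ((List.range (2 * G.length)).foldl (fun s _ => expandStep G s) ([allV G], [])).2

section
variable {α : Type} [Enc α]

@[fun_prop] theorem pt_closeStep {G : α → Gr} {M S : α → BV} {c1 c0 : α → Bool} (hG : PT G)
    (hM : PT M) (h1 : PT c1) (h0 : PT c0) (hS : PT S) :
    PT (fun a => closeStep (G a) (M a) (c1 a) (c0 a) (S a)) := by
  unfold closeStep; fun_prop

@[fun_prop] theorem pt_closure {G : α → Gr} {M S : α → BV} {c1 c0 : α → Bool} (hG : PT G)
    (hM : PT M) (h1 : PT c1) (h0 : PT c0) (hS : PT S) :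
    PT (fun a => closure (G a) (M a) (c1 a) (c0 a) (S a)) := by
  obtain ⟨P, hP⟩ := hG.exists_sz
  refine PT.foldl_const (by fun_prop) hS (by fun_prop) (2 * P + 1) ?_
  intro a s x
  have h1 := hP a
  have h2 := length_lt_sz (G a)
  rw [closeStep, sz_mkV]
  simp; omega

@[fun_prop] theorem pt_firstComp {G : α → Gr} {M : α → BV} {c1 c0 : α → Bool} (hG : PT G)
    (hM : PT M) (h1 : PT c1) (h0 : PT c0) :
    PT (fun a => firstComp (G a) (M a) (c1 a) (c0 a)) := by
  unfold firstComp; fun_prop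

@[fun_prop] theorem pt_biPart {G : α → Gr} {M C : α → BV} {u : α → ℕ} (hG : PT G)
    (hM : PT M) (hC : PT C) (hu : PT u) :
    PT (fun a => biPart (G a) (M a) (C a) (u a)) := by
  unfold biPart; fun_prop

@[fun_prop] theorem pt_part {G : α → Gr} {M : α → BV} {u : α → ℕ} (hG : PT G)
    (hM : PT M) (hu : PT u) : PT (fun a => part (G a) (M a) (u a)) := by
  unfold part; fun_prop

@[fun_prop] theorem pt_bags {G : α → Gr} {M : α → BV} {dec : α → Dec} (hG : PT G)
    (hd : PT dec) (hM : PT M) : PT (fun a => bags (G a) (dec a) (M a)) := by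
  unfold bags; fun_prop

@[fun_prop] theorem pt_reps {G : α → Gr} {M : α → BV} (hG : PT G)
    (hM : PT M) : PT (fun a => reps (G a) (M a)) := by
  unfold reps; fun_prop

@[fun_prop] theorem pt_parts {G : α → Gr} {M : α → BV} (hG : PT G)
    (hM : PT M) : PT (fun a => parts (G a) (M a)) := by
  unfold parts; fun_prop

@[fun_prop] theorem pt_children {G : α → Gr} {M : α → BV} (hG : PT G)
    (hM : PT M) : PT (fun a => children (G a) (M a)) := by
  unfold children; fun_prop

@[fun_prop] theorem pt_expandStep {G : α → Gr} {s : α → List BV × List BV} (hG : PT G)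
    (hs : PT s) : PT (fun a => expandStep (G a) (s a)) := by
  unfold expandStep; fun_prop

@[fun_prop] theorem pt_allV {G : α → Gr} (hG : PT G) : PT (fun a => allV (G a)) := by
  unfold allV; fun_prop

theorem sz_bv (S : BV) : sz S = 2 * S.length + 1 := by
  induction S with
  | nil => rfl
  | cons x l ih => rw [sz_list_cons, ih, List.length_cons]; change 1 + _ + 1 = _; omega

@[simp] theorem length_mkV (n : ℕ) (p : ℕ → Bool) : (mkV n p).length = n := by simp [mkV]

theorem length_closure (G : Gr) (M : BV) (c1 c0 : Bool) (S : BV) (h : S.length = G.length) :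
    (closure G M c1 c0 S).length = G.length := by
  unfold closure
  generalize List.range G.length = l
  induction l generalizing S with
  | nil => exact h
  | cons x l ih => exact ih _ (by simp [closeStep])

theorem length_part (G : Gr) (M : BV) (u : ℕ) : (part G M u).length = G.length := by
  have : ∀ c1 c0, (firstComp G M c1 c0).length = G.length := fun c1 c0 =>
    length_closure _ _ _ _ _ (by simp)
  unfold part biPart diffV
  cases (!eqV G.length (firstComp G M false true) M) <;> cases mem (firstComp G M false true) u <;>
  cases (!eqV G.length (firstComp G M true false) M) <;> cases mem (firstComp G M true false) u <;>
  simp [this]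

theorem length_children (G : Gr) (M : BV) : (children G M).length ≤ G.length := by
  unfold children
  cases decide (cardV G.length M ≤ 1)
  · simp only [cond_false, parts, List.length_map, elems]
    exact (List.length_filter_le _ _).trans (by simp)
  · simp

theorem length_of_mem_children {G : Gr} {M x : BV} (h : x ∈ children G M) : x.length = G.length := by
  unfold children at h
  cases hc : decide (cardV G.length M ≤ 1) <;> rw [hc] at h
  · simp only [cond_false, parts, List.mem_map] at h
    obtain ⟨u, -, rfl⟩ := h
    exact length_part _ _ _
  · simp at h

/-- Every step adds at most one part for each vertex to the queue and one finished module. -/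
@[fun_prop] theorem pt_nodes {G : α → Gr} (hG : PT G) : PT (fun a => nodes (G a)) := by
  have : PT (fun G : Gr => nodes G) := by
    refine PT.fst (β := List BV) (γ := List BV) (f := fun G : Gr =>
      Prod.swap ((List.range (2 * G.length)).foldl (fun s _ => expandStep G s) ([allV G], []))) ?_
    have hsw : PT (fun s : List BV × List BV => s.swap) := by
      change PT (fun s : List BV × List BV => (s.2, s.1)); fun_prop
    refine hsw.comp (PT.foldl (by fun_prop) (by fun_prop) (by fun_prop)
      (fun G i s => (s.1.length ≤ 1 + i * G.length ∧ ∀ x ∈ s.1, x.length = G.length) ∧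
        s.2.length ≤ i ∧ ∀ x ∈ s.2, x.length = G.length)
      ((1 + 2 * .X * .X) * (2 * .X + 2) + 1 + (2 * .X * (2 * .X + 2) + 1) + 1) ?_ ?_ ?_)
    · intro G; simp [allV]
    · rintro G i ⟨q, d⟩ x - ⟨⟨h1, h2⟩, h3, h4⟩
      unfold expandStep
      cases q with
      | nil =>
        simp only [List.isEmpty_nil, cond_true]
        exact ⟨⟨by simp, h2⟩, h3.trans (Nat.le_succ _), h4⟩
      | cons M q =>
        simp only [List.isEmpty_cons, cond_false, List.headD_cons, List.tail_cons]
        simp only [List.mem_cons, forall_eq_or_imp, List.length_cons] at h1 h2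
        refine ⟨⟨?_, ?_⟩, by simpa using h3, by simpa using ⟨h2.1, h4⟩⟩
        · have := length_children G M
          rw [List.length_append, add_mul, one_mul]; omega
        · intro x hx
          rw [List.mem_append] at hx
          rcases hx with hx | hx
          · exact length_of_mem_children hx
          · exact h2.2 x hx
    · rintro G i ⟨q, d⟩ hi ⟨⟨h1, h2⟩, h3, h4⟩
      simp only [List.length_range] at hi
      have hG := length_lt_sz G
      have e1 := sz_list_le (l := q) (Q := 2 * sz G + 1) (m := 1 + 2 * sz G * sz G) (by
        intro x hx; rw [sz_bv, h2 x hx]; omega) (by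
        refine h1.trans (Nat.add_le_add_left ?_ _)
        exact Nat.mul_le_mul (by omega) (by omega))
      have e2 := sz_list_le (l := d) (Q := 2 * sz G + 1) (m := 2 * sz G) (by
        intro x hx; rw [sz_bv, h4 x hx]; omega) (h3.trans (by omega))
      simp only [sz_pair, Polynomial.eval_add, Polynomial.eval_mul, Polynomial.eval_X,
        Polynomial.eval_one, Polynomial.eval_ofNat, add_assoc, Nat.reduceAdd] at *
      omega
  exact this.comp hG

end
end CVC
namespace CVC
open Enc

/-! ### Tables -/

/-- The state of a part: whether the solution meets it, whether the solution contains it, and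
whether it lies on the right side of the cut. -/
abbrev St := Bool × Bool × Bool

/-- The state of a part that the solution does not meet. In sums without a cut, it stands for all
parts that are not contained in the solution. -/
def stE : St := (false, false, false)

/-- The five states: not met, met but not contained on either side of the cut, and contained on
either side of the cut. -/
def states : List St := [stE, (true, false, false), (true, false, true), (true, true, false),
  (true, true, true)]

/-- States that are allowed at adjacent parts. -/
def compat (s t : St) : Bool := (s.2.1 || t.2.1) && (!(s.1 && t.1) || (s.2.2 == t.2.2))

/-- The states of all vertices. -/
abbrev Asg := List St

/-- The path in a table that belongs to an assignment, with three bits for every state. -/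
def key (g : Asg) : List Bool := (g.map fun s => [s.1, s.2.1, s.2.2]).flatten

/-- The assignment `g` with the vertices outside `U` reset. -/
def mask (n : ℕ) (U : BV) (g : Asg) : Asg :=
  (List.range n).map fun u => cond (mem U u) (g.getD u stE) stE

/-- The assignment `g` with the state of `v` replaced by `s`. -/
def updA (n : ℕ) (g : Asg) (v : ℕ) (s : St) : Asg :=
  (List.range n).map fun u => cond (u == v) s (g.getD u stE)

/-- The subtree on the given side; `nil` has the subtrees `nil`. -/
def vchild (b : Bool) : Val → Val
  | .nil => .nil
  | .pair x y => cond b x y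

/-- The subtree of a table on the given side. -/
def trieChild (b : Bool) (t : Trie) : Trie := ⟨vchild b t.val⟩

/-- The table with the given subtrees. -/
def triePair (s t : Trie) : Trie := ⟨.pair s.val t.val⟩

/-- A polynomial as the content of a table entry. -/
def trieOf (p : BV) : Trie := ⟨enc p⟩

/-- Whether a tree is different from `nil`, which is how Booleans are encoded. -/
def vIsPair : Val → Bool
  | .nil => false
  | .pair _ _ => true

/-- The entry of a table at the end of a path. -/
def trieFind (k : List Bool) (t : Trie) : Trie := k.foldl (fun t b => trieChild b t) t

/-- The polynomial stored at `t`, truncated. -/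
def trieBits (D : ℕ) (t : Trie) : BV :=
  ((List.range D).foldl (fun (s : BV × Trie) _ =>
    (vIsPair (vchild true s.2.val) :: s.1, trieChild false s.2)) ([], t)).1.reverse

/-- The entry at the end of a path, together with the siblings met on the way, the last one first.
-/
def trieDown (k : List Bool) (t : Trie) : Trie × List (Bool × Trie) :=
  k.foldl (fun (s : Trie × List (Bool × Trie)) b =>
    (trieChild b s.1, (b, trieChild (!b) s.1) :: s.2)) (t, [])

/-- The table with the entry `v` at the end of the path that was followed by `trieDown`. -/
def trieUp (path : List (Bool × Trie)) (v : Trie) : Trie :=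
  path.foldl (fun t x => cond x.1 (triePair t x.2) (triePair x.2 t)) v

/-- The table with the entry at the end of a path replaced by `v`. -/
def trieIns (k : List Bool) (t v : Trie) : Trie := trieUp (trieDown k t).2 v

/-- Prepending an element to a list whose size is not counted. -/
def consB {β : Type} (x : β) (l : Big (List β)) : Big (List β) := ⟨x :: l.val⟩

/-- The tail of a list whose size is not counted. -/
def tailB {β : Type} (l : Big (List β)) : Big (List β) := ⟨l.val.tail⟩

/-- The state of the first vertex, for an assignment whose size is not counted. -/
def headB (l : Big Asg) : St := l.val.headD stE

/-- The first `n` states of an assignment whose size is not counted, as an assignment of regular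
size. -/
def readA (n : ℕ) (g : Big Asg) : Asg :=
  ((List.range n).foldl (fun (s : Asg × Big Asg) _ => (headB s.2 :: s.1, tailB s.2)) ([], g)).1.reverse

section
variable {α β : Type} [Enc α] [Enc β]

@[fun_prop] theorem pt_compat {s t : α → St} (hs : PT s) (ht : PT t) :
    PT (fun a => compat (s a) (t a)) := by unfold compat; fun_prop

@[fun_prop] theorem pt_key {g : α → Asg} (hg : PT g) : PT (fun a => key (g a)) := by
  unfold key; fun_prop

@[fun_prop] theorem pt_mask {n : α → ℕ} {U : α → BV} {g : α → Asg} (hn : PT n) (hU : PT U)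
    (hg : PT g) : PT (fun a => mask (n a) (U a) (g a)) := by unfold mask; fun_prop

@[fun_prop] theorem pt_updA {n v : α → ℕ} {g : α → Asg} {s : α → St} (hn : PT n) (hv : PT v)
    (hg : PT g) (hs : PT s) : PT (fun a => updA (n a) (g a) (v a) (s a)) := by
  unfold updA; fun_prop

@[fun_prop] theorem pt_trieChild {b : α → Bool} {t : α → Trie} (hb : PT b) (ht : PT t) :
    PT (fun a => trieChild (b a) (t a)) := by
  have h1 : PT (fun t => trieChild true t) :=
    .of_prog .hd 1 (fun t => by
      rcases t with ⟨_ | _⟩ <;> exact ⟨1, by constructor, le_rfl⟩) 1 (by simp [sz])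
  have h0 : PT (fun t => trieChild false t) :=
    .of_prog .tl 1 (fun t => by
      rcases t with ⟨_ | _⟩ <;> exact ⟨1, by constructor, le_rfl⟩) 1 (by simp [sz])
  have : PT (fun a => cond (b a) (trieChild true (t a)) (trieChild false (t a))) := by fun_prop
  convert this using 2 with a
  cases b a <;> rfl

@[fun_prop] theorem pt_triePair {s t : α → Trie} (hs : PT s) (ht : PT t) :
    PT (fun a => triePair (s a) (t a)) := by
  have : PT (fun x : Trie × Trie => triePair x.1 x.2) :=
    .of_prog .id 1 (fun _ => ⟨1, .id _, le_rfl⟩) 1 (by simp [sz])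
  exact this.comp (hs.pair ht)

@[fun_prop] theorem pt_trieOf {p : α → BV} (hp : PT p) : PT (fun a => trieOf (p a)) := by
  have : PT trieOf := .of_prog .id 1 (fun _ => ⟨1, .id _, le_rfl⟩) 1 (by simp [sz])
  exact this.comp hp

@[fun_prop] theorem pt_bit {b : α → Bool} {t : α → Trie} (hb : PT b) (ht : PT t) :
    PT (fun a => vIsPair (vchild (b a) (t a).val)) := by
  have h : PT (fun t : Trie => vIsPair t.val) :=
    .of_prog (.ite .id (.cons .nil .nil) .nil) 5 (fun t => by
      rcases t with ⟨_ | _⟩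
      · exact ⟨_, .ite_false (.id _) (.nil _), by norm_num⟩
      · exact ⟨_, .ite_true (.id _) (.cons (.nil _) (.nil _)), by norm_num⟩) 1 (by simp [sz])
  exact h.comp (pt_trieChild hb ht)

theorem sz_trie (t : Trie) : sz t = 1 := rfl
theorem sz_big (t : Big α) : sz t = 1 := rfl
theorem sz_st (t : St) : sz t = 5 := rfl

@[fun_prop] theorem pt_trieFind {k : α → List Bool} {t : α → Trie} (hk : PT k) (ht : PT t) :
    PT (fun a => trieFind (k a) (t a)) :=
  PT.foldl_const hk ht (by fun_prop) 1 (by simp [sz])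

@[fun_prop] theorem pt_trieBits {D : α → ℕ} {t : α → Trie} (hD : PT D) (ht : PT t) :
    PT (fun a => trieBits (D a) (t a)) := by
  have : PT (fun x : ℕ × Trie => ((List.range x.1).foldl (fun (s : BV × Trie) _ =>
    (vIsPair (vchild true s.2.val) :: s.1, trieChild false s.2)) ([], x.2))) := by
    refine PT.foldl (by fun_prop) (by fun_prop) (by fun_prop) (fun _ i s => s.1.length = i)
      (2 * .X + 3) (by simp) (by rintro a i s x - rfl; simp) ?_
    rintro ⟨D, t⟩ i s hi rfl
    simp only [List.length_range] at hi
    simp [sz_pair, sz_bv, sz_trie, sz_nat]; omega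
  exact (PT.fst this).reverse.comp (hD.pair ht)

@[fun_prop] theorem pt_trieDown {k : α → List Bool} {t : α → Trie} (hk : PT k) (ht : PT t) :
    PT (fun a => trieDown (k a) (t a)) := by
  have : PT (fun x : List Bool × Trie => trieDown x.1 x.2) := by
    refine PT.foldl (by fun_prop) (by fun_prop) (by fun_prop) (fun _ i s => s.2.length = i)
      (4 * .X + 3) (by simp) (by rintro a i s x - rfl; simp) ?_
    rintro ⟨k, t⟩ i s hi rfl
    have := sz_list_le (l := s.2) (Q := 3) (m := s.2.length) (fun x _ => le_rfl) le_rfl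
    simp [sz_pair, sz_bv, sz_trie]
    simp at hi
    omega
  exact this.comp (hk.pair ht)

@[fun_prop] theorem pt_trieUp {p : α → List (Bool × Trie)} {t : α → Trie} (hp : PT p) (ht : PT t) :
    PT (fun a => trieUp (p a) (t a)) :=
  PT.foldl_const hp ht (by fun_prop) 1 (by simp [sz])

@[fun_prop] theorem pt_trieIns {k : α → List Bool} {t v : α → Trie} (hk : PT k) (ht : PT t)
    (hv : PT v) : PT (fun a => trieIns (k a) (t a) (v a)) := by
  unfold trieIns; fun_prop

@[fun_prop] theorem pt_consB {x : α → β} {l : α → Big (List β)} (hx : PT x) (hl : PT l) :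
    PT (fun a => consB (x a) (l a)) := by
  have : PT (fun x : β × Big (List β) => consB x.1 x.2) :=
    .of_prog .id 1 (fun _ => ⟨1, .id _, le_rfl⟩) 1 (by simp [sz])
  exact this.comp (hx.pair hl)

@[fun_prop] theorem pt_tailB {l : α → Big (List β)} (hl : PT l) : PT (fun a => tailB (l a)) := by
  have : PT (fun x : Big (List β) => tailB x) :=
    .of_prog .tl 1 (fun x => by
      rcases x with ⟨_ | _⟩ <;> exact ⟨1, by constructor, le_rfl⟩) 1 (by simp [sz])
  exact this.comp hl

@[fun_prop] theorem pt_headB {l : α → Big Asg} (hl : PT l) : PT (fun a => headB (l a)) := by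
  have : PT (fun x : Big Asg => headB x) :=
    .of_prog (.ite .id .hd (constProg (enc stE))) 10 (fun x => by
      rcases x with ⟨_ | ⟨a, l⟩⟩
      · obtain ⟨t, h1, h2⟩ := constProg_eval (enc stE) .nil
        exact ⟨_, .ite_false (.id _) h1, by
          have : (enc stE).size = 5 := rfl
          omega⟩
      · exact ⟨_, .ite_true (.id _) (.hd_pair _ _), by norm_num⟩) 5 (by intro a; rw [sz_st]; simp)
  exact this.comp hl

@[fun_prop] theorem pt_readA {n : α → ℕ} {g : α → Big Asg} (hn : PT n) (hg : PT g) :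
    PT (fun a => readA (n a) (g a)) := by
  have : PT (fun x : ℕ × Big Asg => ((List.range x.1).foldl (fun (s : Asg × Big Asg) _ =>
      (headB s.2 :: s.1, tailB s.2)) ([], x.2))) := by
    refine PT.foldl (by fun_prop) (by fun_prop) (by fun_prop) (fun _ i s => s.1.length = i)
      (6 * .X + 3) (by simp) (by rintro a i s x - rfl; simp) ?_
    rintro ⟨n, g⟩ i s hi rfl
    have := sz_list_le (l := s.1) (Q := 5) (m := s.1.length) (fun x _ => le_rfl) le_rfl
    simp [sz_pair, sz_big, sz_nat]
    simp at hi
    omega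
  exact (PT.fst this).reverse.comp (hn.pair hg)

end

/-- Prepend a state to all assignments in `L`: each of the five states if `b` holds, and otherwise
only `stE`. -/
def enumStep (b : Bool) (L : Big (List (Big Asg))) : Big (List (Big Asg)) :=
  L.val.foldl (fun acc g => cond b
    (consB (consB (true, true, true) g) (consB (consB (true, true, false) g)
      (consB (consB (true, false, true) g) (consB (consB (true, false, false) g)
        (consB (consB stE g) acc)))))
    (consB (consB stE g) acc)) ⟨[]⟩

/-- The list of all assignments with support in `U`. Its length is exponential, which is why its
size is not counted. -/
def enumA (U : BV) : Big (List (Big Asg)) := U.reverse.foldl (fun L b => enumStep b L) ⟨[⟨[]⟩]⟩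

theorem enumStep_length (b : Bool) (L : Big (List (Big Asg))) :
    (enumStep b L).val.length = L.val.length * cond b 5 1 := by
  obtain ⟨l⟩ := L
  unfold enumStep
  suffices h : ∀ acc : Big (List (Big Asg)), (l.foldl (fun acc g => cond b
      (consB (consB (true, true, true) g) (consB (consB (true, true, false) g)
        (consB (consB (true, false, true) g) (consB (consB (true, false, false) g)
          (consB (consB stE g) acc)))))
      (consB (consB stE g) acc)) acc).val.length = acc.val.length + l.length * cond b 5 1 by
    simpa using h ⟨[]⟩
  induction l with
  | nil => simp
  | cons g l ih =>
    intro acc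
    rw [List.foldl_cons, ih]
    cases b <;> simp [consB] <;> omega

theorem ptk_enumStep : PTK (fun x : Bool × Big (List (Big Asg)) => x.2.val.length)
    (fun x => enumStep x.1 x.2) := by
  have hid : PT (fun x : Bool × Big (List (Big Asg)) => Big.mk x.2.val) := by
    have : PT (fun x : Bool × Big (List (Big Asg)) => x.2) := by fun_prop
    exact this
  refine PTK.foldlBig (hid.toK _) (PT.toK (by fun_prop) _) (Kf := fun _ => 0) (by
    change PT _; fun_prop) (fun _ _ _ => True) 1 (fun _ => trivial) (fun _ _ _ _ _ _ => trivial)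
    (by simp [sz_big]) (by simp [sz_big]) ?_
  intro a
  simp [foldCost_zero]

/-- The number of assignments with support in `U`. -/
def tableSize (U : BV) : ℕ := 5 ^ U.count true

theorem enumA_foldl_length (l : List Bool) (L : Big (List (Big Asg))) :
    (l.foldl (fun L b => enumStep b L) L).val.length = L.val.length * tableSize l := by
  induction l generalizing L with
  | nil => simp [tableSize]
  | cons b l ih =>
    rw [List.foldl_cons, ih, enumStep_length, mul_assoc]
    congr 1
    cases b <;> simp [tableSize, pow_succ, mul_comm]

theorem enumA_length (U : BV) : (enumA U).val.length = tableSize U := by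
  rw [enumA, enumA_foldl_length]; simp [tableSize]

/-- The lengths of the intermediate lists are bounded by the length of the final one. -/
theorem ptk_enumA : PTK tableSize (fun U => enumA U) := by
  have : PTK (fun U : BV => U.length * tableSize U) (fun U => enumA U) := by
    refine PTK.foldl (l := fun U : BV => U.reverse)
      (Kf := fun x : (BV × Big (List (Big Asg))) × Bool => x.1.2.val.length)
      (by fun_prop) (PT.toK (by fun_prop) _)
      (PTK.comp (f := fun x : (BV × Big (List (Big Asg))) × Bool => (x.2, x.1.2)) ptk_enumStep
        (PT.toK (by fun_prop) _) (fun _ => le_rfl)) (fun _ _ _ => True) 1 (fun _ => trivial)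
      (fun _ _ _ _ _ _ => trivial) (by simp [sz_big]) ?_
    intro U
    have key : ∀ (l : List Bool) (L : Big (List (Big Asg))) (Q : ℕ), L.val.length * tableSize l ≤ Q →
        foldCost (fun s (_ : Bool) => s.val.length) (fun L b => enumStep b L) L l ≤ l.length * Q := by
      intro l
      induction l with
      | nil => simp [foldCost]
      | cons b l ih =>
        intro L Q hQ
        have h1 := ih (enumStep b L) Q (by
          refine le_trans (le_of_eq ?_) hQ
          rw [enumStep_length, mul_assoc]
          congr 1
          cases b <;> simp [tableSize, pow_succ, mul_comm])
        have h2 : L.val.length ≤ Q := le_trans (Nat.le_mul_of_pos_right _ (by simp [tableSize])) hQ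
        simp only [foldCost, List.length_cons, add_mul, one_mul]
        omega
    have := key U.reverse ⟨[⟨[]⟩]⟩ (tableSize U) (by simp [tableSize])
    simpa using this
  refine this.of_le .X fun U => ?_
  have h1 := length_lt_sz U
  rw [Polynomial.eval_X]
  calc U.length * tableSize U + 1 ≤ U.length * tableSize U + U.length + tableSize U + 1 := by omega
    _ = (tableSize U + 1) * (U.length + 1) := by ring
    _ ≤ _ := Nat.mul_le_mul_left _ h1

end CVC
namespace CVC
open Enc

/-! ### Variable elimination -/

/-- A function of the states of the vertices in a scope, given by its table. -/
abbrev Factor := BV × Trie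

/-- The value of a factor at an assignment, of which only the states in the scope matter. -/
def facVal (n D : ℕ) (φ : Factor) (g : Asg) : BV := trieBits D (trieFind (key (mask n φ.1 g)) φ.2)

/-- The position of a state in `states`. -/
def stIdx (s : St) : ℕ := cond s.1 (cond s.2.1 (cond s.2.2 4 3) (cond s.2.2 2 1)) 0

/-- The weights of the states of the vertices. -/
abbrev Wts := List (List BV)

/-- The weight of the state `s` of the vertex `v`. -/
def wt (W : Wts) (v : ℕ) (s : St) : BV := (W.getD v []).getD (stIdx s) []

/-- The contribution of the state `s` of `v` to the factor that arises from the elimination of `v`: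
the weight of the state times the values of the factors in `F`, provided that `s` is compatible with
the states of the neighbours of `v` in `R`. -/
def term (D : ℕ) (G : Gr) (W : Wts) (R : BV) (F : List Factor) (v : ℕ) (g : Asg) (s : St) : BV :=
  cond (allR G.length fun u => !(mem R u && adj G v u) || compat s (g.getD u stE))
    (prodP D (wt W v s :: F.map fun φ => facVal G.length D φ (updA G.length g v s))) []

/-- The value at `g` of the factor that arises from the elimination of `v`. -/
def valF (D : ℕ) (G : Gr) (W : Wts) (R : BV) (F : List Factor) (v : ℕ) (g : Asg) : BV :=
  sumP D (states.map fun s => term D G W R F v g s)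

/-- A single bag with `v` contains all vertices of `R` that share a bag with `v`. -/
def good (n : ℕ) (B : List BV) (R : BV) (v : ℕ) : Bool :=
  B.any fun t => mem t v && B.all fun t' => !mem t' v || allR n fun u => !(mem t' u && mem R u) || mem t u

/-- The vertex of `R` to be eliminated next: if possible, one for which a single bag contains all
remaining vertices that share a bag with it. -/
def pick (n : ℕ) (B : List BV) (R : BV) : ℕ :=
  ((elems n R).filter (good n B R) ++ elems n R).headD 0

/-- The scope of the factor that arises from the elimination of `v`. -/
def scope (G : Gr) (R : BV) (F : List Factor) (v : ℕ) : BV :=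
  mkV G.length fun u => !(u == v) && ((mem R u && adj G v u) || F.any fun φ => mem φ.1 u)

/-- The table of the factor that arises from the elimination of `v`. -/
def table (D : ℕ) (G : Gr) (W : Wts) (R : BV) (F : List Factor) (v : ℕ) : Trie :=
  (enumA (scope G R F v)).val.foldl (fun t g => trieIns (key (readA G.length g)) t
    (trieOf (valF D G W R F v (readA G.length g)))) ⟨.nil⟩

/-- The factors that depend on the state of `v`. -/
def facsAt (v : ℕ) (F : List Factor) : List Factor := F.filter fun φ => mem φ.1 v

/-- Eliminate `v`: the factors that depend on it are replaced by a single one. -/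
def elimAt (D : ℕ) (G : Gr) (W : Wts) (R : BV) (F : List Factor) (v : ℕ) : BV × List Factor :=
  (mkV G.length fun u => mem R u && !(u == v),
    (scope G R (facsAt v F) v, table D G W R (facsAt v F) v) :: F.filter fun φ => !mem φ.1 v)

/-- Eliminate the next vertex, if there is one. -/
def elimStep (D : ℕ) (G : Gr) (W : Wts) (B : List BV) (s : BV × List Factor) : BV × List Factor :=
  cond (elems G.length s.1).isEmpty s (elimAt D G W s.1 s.2 (pick G.length B s.1))

/-- The size of the table that is computed when the next vertex is eliminated. -/
def stepCost (G : Gr) (B : List BV) (s : BV × List Factor) : ℕ :=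
  tableSize (scope G s.1 (facsAt (pick G.length B s.1) s.2) (pick G.length B s.1))

/-- The sum over all assignments of states to the vertices in `R` of the products of the weights,
restricted to assignments that are compatible at all edges. -/
def zval (D : ℕ) (G : Gr) (W : Wts) (B : List BV) (R : BV) : BV :=
  prodP D (((List.range G.length).foldl (fun s _ => elimStep D G W B s) (R, [])).2.map
    fun φ => facVal G.length D φ [])

/-- The sum of the sizes of all tables computed by `zval`. -/
def elimCost (D : ℕ) (G : Gr) (W : Wts) (B : List BV) (R : BV) : ℕ :=
  foldCost (fun s (_ : ℕ) => cond (elems G.length s.1).isEmpty 0 (stepCost G B s))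
    (fun s _ => elimStep D G W B s) (R, []) (List.range G.length)

section
variable {α : Type} [Enc α]

@[fun_prop] theorem pt_facVal {n D : α → ℕ} {φ : α → Factor} {g : α → Asg} (hn : PT n) (hD : PT D)
    (hφ : PT φ) (hg : PT g) : PT (fun a => facVal (n a) (D a) (φ a) (g a)) := by
  unfold facVal; fun_prop

@[fun_prop] theorem pt_wt {W : α → Wts} {v : α → ℕ} {s : α → St} (hW : PT W) (hv : PT v)
    (hs : PT s) : PT (fun a => wt (W a) (v a) (s a)) := by
  unfold wt stIdx; fun_prop

@[fun_prop] theorem pt_term {D v : α → ℕ} {G : α → Gr} {W : α → Wts} {R : α → BV}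
    {F : α → List Factor} {g : α → Asg} {s : α → St} (hD : PT D) (hG : PT G) (hW : PT W)
    (hR : PT R) (hF : PT F) (hv : PT v) (hg : PT g) (hs : PT s) :
    PT (fun a => term (D a) (G a) (W a) (R a) (F a) (v a) (g a) (s a)) := by
  unfold term; fun_prop

@[fun_prop] theorem pt_valF {D v : α → ℕ} {G : α → Gr} {W : α → Wts} {R : α → BV}
    {F : α → List Factor} {g : α → Asg} (hD : PT D) (hG : PT G) (hW : PT W)
    (hR : PT R) (hF : PT F) (hv : PT v) (hg : PT g) :
    PT (fun a => valF (D a) (G a) (W a) (R a) (F a) (v a) (g a)) := by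
  unfold valF; fun_prop

@[fun_prop] theorem pt_good {n v : α → ℕ} {B : α → List BV} {R : α → BV} (hn : PT n) (hB : PT B)
    (hR : PT R) (hv : PT v) : PT (fun a => good (n a) (B a) (R a) (v a)) := by
  unfold good; fun_prop

@[fun_prop] theorem pt_pick {n : α → ℕ} {B : α → List BV} {R : α → BV} (hn : PT n) (hB : PT B)
    (hR : PT R) : PT (fun a => pick (n a) (B a) (R a)) := by
  unfold pick; fun_prop

@[fun_prop] theorem pt_scope {v : α → ℕ} {G : α → Gr} {R : α → BV}
    {F : α → List Factor} (hG : PT G) (hR : PT R) (hF : PT F) (hv : PT v) :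
    PT (fun a => scope (G a) (R a) (F a) (v a)) := by
  unfold scope; fun_prop

@[fun_prop] theorem pt_facsAt {v : α → ℕ} {F : α → List Factor} (hv : PT v) (hF : PT F) :
    PT (fun a => facsAt (v a) (F a)) := by
  unfold facsAt; fun_prop

/-- The arguments of `table`. -/
abbrev TableArg := ℕ × Gr × Wts × BV × List Factor × ℕ

theorem ptk_table : PTK (fun x : TableArg => tableSize (scope x.2.1 x.2.2.2.1 x.2.2.2.2.1 x.2.2.2.2.2))
    (fun x : TableArg => table x.1 x.2.1 x.2.2.1 x.2.2.2.1 x.2.2.2.2.1 x.2.2.2.2.2) := by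
  refine PTK.foldlBig (Kf := fun _ => 0) ?_ (PT.toK (by fun_prop) _) (by change PT _; fun_prop)
    (fun _ _ _ => True) 1 (fun _ => trivial) (fun _ _ _ _ _ _ => trivial)
    (by simp [sz_trie]) (by simp [sz_big]) ?_
  · exact PTK.comp (f := fun x : TableArg => scope x.2.1 x.2.2.2.1 x.2.2.2.2.1 x.2.2.2.2.2) ptk_enumA
      (PT.toK (by fun_prop) _) (fun _ => le_rfl)
  · intro a
    simp [foldCost_zero, enumA_length]

/-- Branching, where the cost of each branch counts only if the branch is taken. -/
theorem ptk_cond {β : Type} [Enc β] {K Kf Kg : α → ℕ} {c : α → Bool} {f g : α → β} (hc : PT c)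
    (hf : PTK Kf f) (hg : PTK Kg g) (h1 : ∀ a, c a = true → Kf a ≤ K a)
    (h0 : ∀ a, c a = false → Kg a ≤ K a) : PTK K (fun a => cond (c a) (f a) (g a)) := by
  obtain ⟨A, p, hA⟩ := hf
  obtain ⟨B, q, hB⟩ := hg
  obtain ⟨C, r, hC⟩ := hc.toK K
  refine ⟨.ite C A B, p + q + r + 1, fun a => ?_⟩
  obtain ⟨⟨t, e1, e2⟩, e3⟩ := hA a
  obtain ⟨⟨u, e4, e5⟩, e6⟩ := hB a
  obtain ⟨⟨v, e7, e8⟩, e9⟩ := hC a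
  simp only [Polynomial.eval_add, Polynomial.eval_one, mul_add]
  cases hca : c a with
  | true =>
    rw [hca] at e7
    have := e2.trans (Nat.mul_le_mul_right _ (Nat.add_le_add_right (h1 a hca) 1))
    refine ⟨⟨_, .ite_true e7 e1, ?_⟩, ?_⟩ <;> (try simp only [cond_true]) <;> omega
  | false =>
    rw [hca] at e7
    have := e5.trans (Nat.mul_le_mul_right _ (Nat.add_le_add_right (h0 a hca) 1))
    refine ⟨⟨_, .ite_false e7 e4, ?_⟩, ?_⟩ <;> (try simp only [cond_false]) <;> omega

theorem PTK.cons {β : Type} [Enc β] {K : α → ℕ} {f : α → β} {g : α → List β} (hf : PTK K f)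
    (hg : PTK K g) : PTK K (fun a => f a :: g a) :=
  PTK.comp (g := fun x : β × List β => x.1 :: x.2) (Kg := fun _ => 0)
    (by change PT _; fun_prop) (hf.pair hg) (fun _ => Nat.zero_le _)

/-- The arguments of `elimStep`. -/
abbrev StepArg := (ℕ × Gr × Wts × List BV) × BV × List Factor

theorem ptk_elimStep : PTK (fun x : StepArg => cond (elems x.1.2.1.length x.2.1).isEmpty 0
      (stepCost x.1.2.1 x.1.2.2.2 x.2))
    (fun x : StepArg => elimStep x.1.1 x.1.2.1 x.1.2.2.1 x.1.2.2.2 x.2) := by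
  refine ptk_cond (Kf := fun _ => 0) (Kg := fun x : StepArg => stepCost x.1.2.1 x.1.2.2.2 x.2)
    (by fun_prop) (by change PT _; fun_prop) ?_ (by simp) (by
    intro a h; rw [h]; simp)
  unfold elimAt
  refine PTK.pair (PT.toK (by fun_prop) _) (PTK.cons (PTK.pair (PT.toK (by fun_prop) _) ?_)
    (PT.toK (by fun_prop) _))
  exact PTK.comp (f := fun x : StepArg => ((x.1.1, x.1.2.1, x.1.2.2.1, x.2.1,
    facsAt (pick x.1.2.1.length x.1.2.2.2 x.2.1) x.2.2,
    pick x.1.2.1.length x.1.2.2.2 x.2.1) : TableArg)) ptk_table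
    (PT.toK (by fun_prop) _) (fun _ => le_rfl)

/-- The arguments of `zval`. -/
abbrev ZArg := (ℕ × Gr × Wts × List BV) × BV

theorem ptk_zval : PTK (fun x : ZArg => elimCost x.1.1 x.1.2.1 x.1.2.2.1 x.1.2.2.2 x.2)
    (fun x : ZArg => zval x.1.1 x.1.2.1 x.1.2.2.1 x.1.2.2.2 x.2) := by
  have key : PTK (fun x : ZArg => elimCost x.1.1 x.1.2.1 x.1.2.2.1 x.1.2.2.2 x.2)
      (fun x : ZArg => (List.range x.1.2.1.length).foldl
        (fun s _ => elimStep x.1.1 x.1.2.1 x.1.2.2.1 x.1.2.2.2 s) (x.2, [])) := by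
    refine PTK.foldl (Kf := fun y : (ZArg × BV × List Factor) × ℕ =>
        cond (elems y.1.1.1.2.1.length y.1.2.1).isEmpty 0 (stepCost y.1.1.1.2.1 y.1.1.1.2.2.2 y.1.2))
      (by fun_prop) (PT.toK (by fun_prop) _)
      (PTK.comp (f := fun y : (ZArg × BV × List Factor) × ℕ => ((y.1.1.1, y.1.2) : StepArg))
        ptk_elimStep (PT.toK (by fun_prop) _) (fun _ => le_rfl))
      (fun x i s => sz s.1 ≤ sz x.2 + 2 * x.1.2.1.length + 1 ∧ s.2.length ≤ i ∧
        ∀ φ ∈ s.2, sz φ.1 = 2 * x.1.2.1.length + 1)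
      (.X * (2 * .X + 4) + 4 * .X + 10) ?_ ?_ ?_ (fun _ => le_rfl)
    · intro x; exact ⟨by simp; omega, by simp, by simp⟩
    · rintro x i s _ - ⟨h1, h2, h3⟩
      unfold elimStep
      cases (elems x.1.2.1.length s.1).isEmpty
      · simp only [cond_false, elimAt, sz_mkV, List.length_cons, List.mem_cons, forall_eq_or_imp,
          List.mem_filter]
        refine ⟨by omega, ?_, by simp [scope, sz_mkV], fun φ h => h3 φ h.1⟩
        have := List.length_filter_le (fun φ : Factor => !mem φ.1 (pick x.1.2.1.length x.1.2.2.2 s.1)) s.2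
        omega
      · exact ⟨h1, h2.trans (Nat.le_succ _), h3⟩
    · rintro x i s hi ⟨h1, h2, h3⟩
      simp only [List.length_range] at hi
      have hG := length_lt_sz x.1.2.1
      have e := sz_list_le (l := s.2) (Q := 2 * sz x + 3) (m := sz x) (by
        intro φ hφ
        rw [sz_pair, sz_trie, h3 φ hφ]
        simp only [sz_pair]; omega) (by simp only [sz_pair]; omega)
      rw [sz_pair s]
      simp only [Polynomial.eval_add, Polynomial.eval_mul, Polynomial.eval_X, Polynomial.eval_ofNat,
        add_assoc, Nat.reduceAdd] at *
      have : sz x.2 + 2 * sz x.1.2.1 ≤ 2 * sz x := by simp only [sz_pair]; omega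
      omega
  have h2 : PT (fun y : (ℕ × ℕ) × BV × List Factor =>
    prodP y.1.2 (y.2.2.map fun φ => facVal y.1.1 y.1.2 φ [])) := by fun_prop
  exact PTK.comp h2 (PTK.pair (PT.toK (f := fun x : ZArg => (x.1.2.1.length, x.1.1)) (by fun_prop) _) key)
    (fun _ => Nat.zero_le _)

end

/-! ### Summing over vertex covers of modules -/

/-- The monomial of the weight of `M`. -/
def fullP (D : ℕ) (G : Gr) (mo : List BV) (M : BV) : BV :=
  prodP D ((elems G.length M).map fun v => mo.getD v [])

/-- Pairs of a module and the sum of the monomials of its vertex covers. -/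
abbrev Memo := List (BV × BV)

/-- The polynomial stored for the module `M`. -/
def look (n : ℕ) (memo : Memo) (M : BV) : BV := ((memo.filter fun x => eqV n x.1 M).headD ([], [])).2

/-- The weights of the states of the parts of `M` for the sum over all vertex covers of `G[M]`.
Without a cut, only `stE` for the covers that are not the whole part and the state on the left for
the whole part are used. Over the field with two elements, adding the monomial of the whole part
removes it from the sum over all covers. -/
def innerW (D : ℕ) (G : Gr) (mo : List BV) (memo : Memo) (M : BV) : Wts :=
  (List.range G.length).map fun v =>
    [addP D (look G.length memo (part G M v)) (fullP D G mo (part G M v)), [], [],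
      fullP D G mo (part G M v), []]

/-- The sum of the monomials of the vertex covers of `G[M]`, provided that `memo` holds the
corresponding sums for the parts of `M`. -/
def compute (D : ℕ) (G : Gr) (mo : List BV) (dec : Dec) (memo : Memo) (M : BV) : BV :=
  cond (decide (cardV G.length M ≤ 1)) (addP D (monoP D 0) (fullP D G mo M))
    (zval D G (innerW D G mo memo M) (bags G dec M) (reps G M))

/-- One round of recomputing the polynomials of all modules from those of the previous round. -/
def memoStep (D : ℕ) (G : Gr) (mo : List BV) (dec : Dec) (memo : Memo) : Memo :=
  (nodes G).map fun M => (M, compute D G mo dec memo M)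

/-- As many rounds as there are vertices; every round settles the modules of one more size. -/
def memoRun (D : ℕ) (G : Gr) (mo : List BV) (dec : Dec) : Memo :=
  (List.range G.length).foldl (fun memo _ => memoStep D G mo dec memo) []

/-- Whether `G[P]` has no edges. -/
def edgeless (G : Gr) (P : BV) : Bool :=
  allR G.length fun i => allR G.length fun j => !(mem P i && mem P j && adj G i j)

/-- Whether `P` is a vertex cover of `G`. -/
def isVC (G : Gr) (P : BV) : Bool :=
  allR G.length fun i => allR G.length fun j => !adj G i j || mem P i || mem P j

/-- The monomial of the empty set, if it is a vertex cover of `G[P]`. -/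
def rootE (D : ℕ) (G : Gr) (P : BV) : BV := cond (edgeless G P) (monoP D 0) []

/-- The monomials of the vertex covers of `G[P]` that are neither empty nor the whole of `P`. -/
def rootP (D : ℕ) (G : Gr) (mo : List BV) (memo : Memo) (P : BV) : BV :=
  addP D (addP D (look G.length memo P) (rootE D G P)) (fullP D G mo P)

/-- Weights that force the first nonempty part to be the one of `j`, on the left side. -/
def rootW (D : ℕ) (G : Gr) (mo : List BV) (memo : Memo) (j : ℕ) : Wts :=
  (List.range G.length).map fun v =>
    cond (v == j)
      [[], rootP D G mo memo (part G (allV G) v), [], fullP D G mo (part G (allV G) v), []]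
      (cond (decide (v ≤ j)) [rootE D G (part G (allV G) v), [], [], [], []]
        [rootE D G (part G (allV G) v), rootP D G mo memo (part G (allV G) v),
          rootP D G mo memo (part G (allV G) v), fullP D G mo (part G (allV G) v),
          fullP D G mo (part G (allV G) v)])

/-- The monomial of the part of `u` if this part is a vertex cover that is not connected. -/
def corr (D : ℕ) (G : Gr) (mo : List BV) (u : ℕ) : BV :=
  cond (isVC G (part G (allV G) u) && !eqV G.length (firstComp G (part G (allV G) u) false true)
    (part G (allV G) u)) (fullP D G mo (part G (allV G) u)) []

/-- The parts of the root that can be the first part met by a solution. -/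
def anchors (G : Gr) : List ℕ := elems G.length (reps G (allV G))

/-- The sum over all connected vertex covers by means of consistent cuts, one sum for every anchor,
with a correction for the covers that are single parts. -/
def rootVal (D : ℕ) (G : Gr) (mo : List BV) (dec : Dec) (memo : Memo) : BV :=
  sumP D ((anchors G).map (fun j => zval D G (rootW D G mo memo j) (bags G dec (allV G))
    (reps G (allV G))) ++ (anchors G).map (corr D G mo))

/-- The sum of the monomials of all connected vertex covers of `G`, if `G` is connected and has at
least two vertices. For a single vertex, the empty set is the cheapest solution and the only one
that is considered. -/
def total (D : ℕ) (G : Gr) (mo : List BV) (dec : Dec) : BV :=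
  cond (decide (G.length ≤ 1)) (monoP D 0) (rootVal D G mo dec (memoRun D G mo dec))

/-- The sizes of the tables in the computation of `compute`. -/
def compCost (D : ℕ) (G : Gr) (mo : List BV) (dec : Dec) (memo : Memo) (M : BV) : ℕ :=
  cond (decide (cardV G.length M ≤ 1)) 0
    (elimCost D G (innerW D G mo memo M) (bags G dec M) (reps G M))

/-- The sizes of the tables in the computation of `rootVal`. -/
def rootCost (D : ℕ) (G : Gr) (mo : List BV) (dec : Dec) (memo : Memo) : ℕ :=
  ((anchors G).map fun j => elimCost D G (rootW D G mo memo j) (bags G dec (allV G))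
    (reps G (allV G))).sum

/-- The sizes of the tables in the computation of `total`. -/
def totalCost (D : ℕ) (G : Gr) (mo : List BV) (dec : Dec) : ℕ :=
  cond (decide (G.length ≤ 1)) 0
    (foldCost (fun memo (_ : ℕ) => ((nodes G).map fun M => compCost D G mo dec memo M).sum)
      (fun memo _ => memoStep D G mo dec memo) [] (List.range G.length) +
      rootCost D G mo dec (memoRun D G mo dec))

section
variable {α : Type} [Enc α]

@[fun_prop] theorem pt_fullP {D : α → ℕ} {G : α → Gr} {mo : α → List BV} {M : α → BV} (hD : PT D)
    (hG : PT G) (hm : PT mo) (hM : PT M) : PT (fun a => fullP (D a) (G a) (mo a) (M a)) := by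
  unfold fullP; fun_prop

@[fun_prop] theorem pt_look {n : α → ℕ} {memo : α → Memo} {M : α → BV} (hn : PT n)
    (hm : PT memo) (hM : PT M) : PT (fun a => look (n a) (memo a) (M a)) := by
  unfold look; fun_prop

@[fun_prop] theorem pt_innerW {D : α → ℕ} {G : α → Gr} {mo : α → List BV} {memo : α → Memo}
    {M : α → BV} (hD : PT D) (hG : PT G) (hm : PT mo) (hmm : PT memo) (hM : PT M) :
    PT (fun a => innerW (D a) (G a) (mo a) (memo a) (M a)) := by
  unfold innerW; fun_prop

@[fun_prop] theorem pt_edgeless {G : α → Gr} {P : α → BV} (hG : PT G) (hP : PT P) :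
    PT (fun a => edgeless (G a) (P a)) := by unfold edgeless; fun_prop

@[fun_prop] theorem pt_isVC {G : α → Gr} {P : α → BV} (hG : PT G) (hP : PT P) :
    PT (fun a => isVC (G a) (P a)) := by unfold isVC; fun_prop

@[fun_prop] theorem pt_rootE {D : α → ℕ} {G : α → Gr} {P : α → BV} (hD : PT D) (hG : PT G)
    (hP : PT P) : PT (fun a => rootE (D a) (G a) (P a)) := by unfold rootE; fun_prop

@[fun_prop] theorem pt_rootP {D : α → ℕ} {G : α → Gr} {mo : α → List BV} {memo : α → Memo}
    {P : α → BV} (hD : PT D) (hG : PT G) (hm : PT mo) (hmm : PT memo) (hP : PT P) :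
    PT (fun a => rootP (D a) (G a) (mo a) (memo a) (P a)) := by unfold rootP; fun_prop

@[fun_prop] theorem pt_rootW {D j : α → ℕ} {G : α → Gr} {mo : α → List BV} {memo : α → Memo}
    (hD : PT D) (hG : PT G) (hm : PT mo) (hmm : PT memo) (hj : PT j) :
    PT (fun a => rootW (D a) (G a) (mo a) (memo a) (j a)) := by unfold rootW; fun_prop

@[fun_prop] theorem pt_corr {D u : α → ℕ} {G : α → Gr} {mo : α → List BV}
    (hD : PT D) (hG : PT G) (hm : PT mo) (hu : PT u) :
    PT (fun a => corr (D a) (G a) (mo a) (u a)) := by unfold corr; fun_prop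

@[fun_prop] theorem pt_anchors {G : α → Gr} (hG : PT G) : PT (fun a => anchors (G a)) := by
  unfold anchors; fun_prop

/-- The arguments of `total`. -/
abbrev GArg := ℕ × Gr × List BV × Dec

theorem ptk_compute : PTK (fun x : (GArg × Memo) × BV =>
      compCost x.1.1.1 x.1.1.2.1 x.1.1.2.2.1 x.1.1.2.2.2 x.1.2 x.2)
    (fun x : (GArg × Memo) × BV => compute x.1.1.1 x.1.1.2.1 x.1.1.2.2.1 x.1.1.2.2.2 x.1.2 x.2) := by
  refine ptk_cond (Kf := fun _ => 0) (Kg := fun x : (GArg × Memo) × BV =>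
    elimCost x.1.1.1 x.1.1.2.1 (innerW x.1.1.1 x.1.1.2.1 x.1.1.2.2.1 x.1.2 x.2)
      (bags x.1.1.2.1 x.1.1.2.2.2 x.2) (reps x.1.1.2.1 x.2))
    (by fun_prop) (by change PT _; fun_prop) ?_ (by simp) (by
    intro a h; unfold compCost; rw [h]; simp)
  exact PTK.comp (f := fun x : (GArg × Memo) × BV => (((x.1.1.1, x.1.1.2.1,
      innerW x.1.1.1 x.1.1.2.1 x.1.1.2.2.1 x.1.2 x.2, bags x.1.1.2.1 x.1.1.2.2.2 x.2),
      reps x.1.1.2.1 x.2) : ZArg))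
    ptk_zval (PT.toK (by fun_prop) _) (fun _ => le_rfl)

theorem ptk_memoStep : PTK (fun x : GArg × Memo =>
      ((nodes x.1.2.1).map fun M => compCost x.1.1 x.1.2.1 x.1.2.2.1 x.1.2.2.2 x.2 M).sum)
    (fun x : GArg × Memo => memoStep x.1.1 x.1.2.1 x.1.2.2.1 x.1.2.2.2 x.2) :=
  PTK.map (Kf := fun x : (GArg × Memo) × BV =>
      compCost x.1.1.1 x.1.1.2.1 x.1.1.2.2.1 x.1.1.2.2.2 x.1.2 x.2)
    (l := fun x : GArg × Memo => nodes x.1.2.1) (by fun_prop)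
    (PTK.pair (PT.toK (by fun_prop) _) ptk_compute)

/-- A polynomial takes `D` bits, whatever the content of `memo` is. This bounds the size of the
memory over all rounds. -/
theorem sz_compute (D : ℕ) (G : Gr) (mo : List BV) (dec : Dec) (memo : Memo) (M : BV) :
    sz (compute D G mo dec memo M) = 2 * D + 1 := by
  have : ∀ l, (prodP D l).length = D := by
    intro l
    unfold prodP
    generalize h : monoP D 0 = p
    have : p.length = D := by simp [← h, monoP]
    clear h
    induction l generalizing p with
    | nil => simpa
    | cons x l ih => exact ih _ (by simp [mulP])
  rw [sz_bv]
  unfold compute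
  cases decide (cardV G.length M ≤ 1)
  · simp [zval, this]
  · simp [addP]

theorem ptk_memoRun : PTK (fun x : GArg =>
    foldCost (fun memo (_ : ℕ) => ((nodes x.2.1).map fun M => compCost x.1 x.2.1 x.2.2.1 x.2.2.2 memo M).sum)
      (fun memo _ => memoStep x.1 x.2.1 x.2.2.1 x.2.2.2 memo) [] (List.range x.2.1.length))
    (fun x : GArg => memoRun x.1 x.2.1 x.2.2.1 x.2.2.2) := by
  obtain ⟨p, hp⟩ := (show PT (fun x : GArg => nodes x.2.1) by fun_prop).exists_sz
  refine PTK.foldl (Kf := fun y : (GArg × Memo) × ℕ => ((nodes y.1.1.2.1).map fun M =>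
      compCost y.1.1.1 y.1.1.2.1 y.1.1.2.2.1 y.1.1.2.2.2 y.1.2 M).sum) (by fun_prop)
    (PT.toK (by fun_prop) _) (PTK.comp (f := fun y : (GArg × Memo) × ℕ => y.1) ptk_memoStep
      (PT.toK (by fun_prop) _) (fun _ => le_rfl))
    (fun x _ memo => memo.length ≤ (nodes x.2.1).length ∧
      ∀ e ∈ memo, sz e ≤ sz (nodes x.2.1) + (2 * x.1 + 1) + 1)
    (p * (p + 2 * .X + 3) + 1) (by simp) ?_ ?_ (fun _ => le_rfl)
  · rintro x i s y - -
    unfold memoStep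
    refine ⟨by simp, ?_⟩
    simp only [List.mem_map, forall_exists_index, and_imp, forall_apply_eq_imp_iff₂]
    intro M hM
    rw [sz_pair, sz_compute]
    have := sz_le_of_mem hM
    simp only; omega
  · rintro x i s - ⟨h1, h2⟩
    have h3 := hp x
    have h4 := length_lt_sz (nodes x.2.1)
    have h5 := sz_list_le (l := s) (Q := p.eval (sz x) + 2 * sz x + 2) (m := p.eval (sz x)) (by
      intro e he
      have := h2 e he
      have : x.1 + 1 ≤ sz x := by rw [sz_pair, sz_nat]; omega
      omega) (by omega)
    simp only [Polynomial.eval_add, Polynomial.eval_mul, Polynomial.eval_X, Polynomial.eval_one,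
      Polynomial.eval_ofNat, add_assoc, Nat.reduceAdd] at *
    omega

theorem ptk_rootVal : PTK (fun x : GArg × Memo => rootCost x.1.1 x.1.2.1 x.1.2.2.1 x.1.2.2.2 x.2)
    (fun x : GArg × Memo => rootVal x.1.1 x.1.2.1 x.1.2.2.1 x.1.2.2.2 x.2) := by
  unfold rootVal
  refine PTK.comp (g := fun y : (ℕ × List BV) × List BV => sumP y.1.1 (y.1.2 ++ y.2))
    (Kg := fun _ => 0) (by change PT _; fun_prop) (PTK.pair (PTK.pair (PT.toK (by fun_prop) _) ?_)
      (PT.toK (by fun_prop) _)) (fun _ => Nat.zero_le _)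
  exact PTK.map (l := fun x : GArg × Memo => anchors x.1.2.1)
    (f := fun (x : GArg × Memo) (j : ℕ) => zval x.1.1 x.1.2.1
      (rootW x.1.1 x.1.2.1 x.1.2.2.1 x.2 j) (bags x.1.2.1 x.1.2.2.2 (allV x.1.2.1))
      (reps x.1.2.1 (allV x.1.2.1)))
    (Kf := fun y : (GArg × Memo) × ℕ => elimCost y.1.1.1 y.1.1.2.1
      (rootW y.1.1.1 y.1.1.2.1 y.1.1.2.2.1 y.1.2 y.2) (bags y.1.1.2.1 y.1.1.2.2.2 (allV y.1.1.2.1))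
      (reps y.1.1.2.1 (allV y.1.1.2.1))) (by fun_prop)
    (PTK.comp (f := fun y : (GArg × Memo) × ℕ => (((y.1.1.1, y.1.1.2.1,
      rootW y.1.1.1 y.1.1.2.1 y.1.1.2.2.1 y.1.2 y.2, bags y.1.1.2.1 y.1.1.2.2.2 (allV y.1.1.2.1)),
      reps y.1.1.2.1 (allV y.1.1.2.1)) : ZArg)) ptk_zval (PT.toK (by fun_prop) _) (fun _ => le_rfl))

theorem ptk_total : PTK (fun x : GArg => totalCost x.1 x.2.1 x.2.2.1 x.2.2.2)
    (fun x : GArg => total x.1 x.2.1 x.2.2.1 x.2.2.2) := by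
  refine ptk_cond (Kf := fun _ => 0) (Kg := fun x : GArg => foldCost (fun memo (_ : ℕ) =>
      ((nodes x.2.1).map fun M => compCost x.1 x.2.1 x.2.2.1 x.2.2.2 memo M).sum)
      (fun memo _ => memoStep x.1 x.2.1 x.2.2.1 x.2.2.2 memo) [] (List.range x.2.1.length) +
      rootCost x.1 x.2.1 x.2.2.1 x.2.2.2 (memoRun x.1 x.2.1 x.2.2.1 x.2.2.2)) (by fun_prop)
    (by change PT _; fun_prop) ?_ (by simp) (by
    intro a h; unfold totalCost; rw [h]; simp)
  exact PTK.comp (f := fun x : GArg => (x, memoRun x.1 x.2.1 x.2.2.1 x.2.2.2)) ptk_rootVal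
    (PTK.pair (PT.toK (by fun_prop) _) (ptk_memoRun.mono fun _ => Nat.le_add_right _ _))
    (fun _ => Nat.le_add_left _ _)

end

/-! ### The algorithm -/

/-- An exponent `l` and its power of two `2 ^ l ≥ 2 * n`. -/
def logPow (n : ℕ) : ℕ × ℕ :=
  (List.range (2 * n)).foldl (fun s _ => cond (decide (2 * n ≤ s.2)) s (s.1 + 1, s.2 + s.2)) (0, 1)

/-- Graph, costs, budget, tree decompositions, random bits. -/
abbrev Inp := (Gr × (List BinNat × ((Bool × List Bool) × Dec))) × List Bool

/-- The cost of the vertex `v`. -/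
def costAt (x : Inp) (v : ℕ) : ℕ := (x.1.2.1.map binVal).getD v 0

/-- The sum of all costs, as a number of unary units. -/
def costSum (x : Inp) : ℕ := ((x.1.2.1.map binVal).map units).flatten.length

/-- The factor by which costs are scaled; it exceeds the sum of the random weights. -/
def scale (x : Inp) : ℕ := x.1.1.length * (logPow x.1.1.length).2

/-- The degree at which polynomials are truncated. -/
def degBound (x : Inp) : ℕ :=
  cond x.1.2.2.1.1 0 ((hornerCap (costSum x) x.1.2.2.1.2 + 1) * scale x)

/-- The random weight of the vertex `v`, read from its own block of random bits. -/
def rndAt (x : Inp) (v : ℕ) : ℕ :=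
  hornerCap (logPow x.1.1.length).2
    ((x.2.drop (v * (logPow x.1.1.length).1)).take (logPow x.1.1.length).1)

/-- The monomials of the vertices, with exponents in which the cost dominates the random weight. -/
def monos (x : Inp) : List BV :=
  (List.range x.1.1.length).map fun v => monoP (degBound x) (costAt x v * scale x + rndAt x v)

/-- The answer of the algorithm: whether the truncated sum over all connected vertex covers is
nonzero. -/
def solve (x : Inp) : Bool :=
  (total (degBound x) x.1.1 (monos x) x.1.2.2.2).any fun b => b

/-- The sizes of all tables computed by `solve`. -/
def solveCost (x : Inp) : ℕ := totalCost (degBound x) x.1.1 (monos x) x.1.2.2.2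

section
variable {α : Type} [Enc α]

@[fun_prop] theorem pt_logPow {n : α → ℕ} (hn : PT n) : PT (fun a => logPow (n a)) := by
  have : PT (fun n => logPow n) := by
    refine PT.foldl (by fun_prop) (by fun_prop) (by fun_prop)
      (fun n i s => s.1 ≤ i ∧ s.2 ≤ 4 * n + 1) (6 * .X + 10) (by simp) ?_ ?_
    · rintro n i s _ - ⟨h1, h2⟩
      by_cases h : 2 * n ≤ s.2 <;> simp [h] <;> omega
    · rintro n i s hi ⟨h1, h2⟩
      simp at hi
      simp [sz_pair, sz_nat]; omega
  exact this.comp hn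

@[fun_prop] theorem pt_costAt {x : α → Inp} {v : α → ℕ} (hx : PT x) (hv : PT v) :
    PT (fun a => costAt (x a) (v a)) := by unfold costAt; fun_prop

@[fun_prop] theorem pt_costSum {x : α → Inp} (hx : PT x) :
    PT (fun a => costSum (x a)) := by unfold costSum; fun_prop

@[fun_prop] theorem pt_scale {x : α → Inp} (hx : PT x) :
    PT (fun a => scale (x a)) := by unfold scale; fun_prop

@[fun_prop] theorem pt_degBound {x : α → Inp} (hx : PT x) :
    PT (fun a => degBound (x a)) := by unfold degBound; fun_prop

@[fun_prop] theorem pt_rndAt {x : α → Inp} {v : α → ℕ} (hx : PT x) (hv : PT v) :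
    PT (fun a => rndAt (x a) (v a)) := by unfold rndAt; fun_prop

@[fun_prop] theorem pt_monos {x : α → Inp} (hx : PT x) :
    PT (fun a => monos (x a)) := by unfold monos; fun_prop

/-- The algorithm is carried out by a program whose running time is, up to a polynomial factor, the
total size of the tables. -/
theorem ptk_solve : PTK solveCost solve := by
  unfold solve
  refine PTK.comp (g := fun l : BV => l.any fun b => b) (Kg := fun _ => 0)
    (by change PT _; fun_prop) ?_ (fun _ => Nat.zero_le _)
  exact PTK.comp (f := fun x : Inp => ((degBound x, x.1.1, monos x, x.1.2.2.2) : GArg)) ptk_total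
    (PT.toK (by fun_prop) _) (fun _ => le_rfl)

end
end CVC
namespace CVC
open Enc Polynomial

/-! ### Semantics of bit vectors and polynomials -/

theorem mem_mkV (n : ℕ) (p : ℕ → Bool) (i : ℕ) : mem (mkV n p) i = (decide (i < n) && p i) := by
  unfold mem mkV
  by_cases h : i < n <;> simp [h]

theorem mem_nil (i : ℕ) : mem [] i = false := by simp [mem]

theorem anyR_eq_true {n : ℕ} {p : ℕ → Bool} : anyR n p = true ↔ ∃ i < n, p i = true := by
  simp [anyR]

theorem allR_eq_true {n : ℕ} {p : ℕ → Bool} : allR n p = true ↔ ∀ i < n, p i = true := by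
  simp [allR]

theorem mem_elems {n : ℕ} {S : BV} {i : ℕ} : i ∈ elems n S ↔ i < n ∧ mem S i = true := by
  simp [elems]

theorem nodup_elems (n : ℕ) (S : BV) : (elems n S).Nodup := List.nodup_range.filter _

theorem eqV_eq_true {n : ℕ} {A B : BV} : eqV n A B = true ↔ ∀ i < n, mem A i = mem B i := by
  simp [eqV, allR_eq_true]

/-- The ring of polynomials over the field with two elements, truncated at degree `D`. -/
abbrev TP (D : ℕ) := (ZMod 2)[X] ⧸ Ideal.span {(X : (ZMod 2)[X]) ^ D}

/-- The polynomial with the coefficients given by the first `D` bits. -/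
noncomputable def polyOf (D : ℕ) (p : BV) : (ZMod 2)[X] :=
  ∑ i ∈ Finset.range D, if mem p i then X ^ i else 0

/-- The truncated polynomial with the coefficients given by a bit vector. -/
noncomputable def ev (D : ℕ) (p : BV) : TP D := Ideal.Quotient.mk _ (polyOf D p)

/-- The variable of the ring of truncated polynomials. -/
noncomputable def zz (D : ℕ) : TP D := Ideal.Quotient.mk _ X

theorem mk_eq_iff {D : ℕ} {p q : (ZMod 2)[X]} :
    (Ideal.Quotient.mk (Ideal.span {(X : (ZMod 2)[X]) ^ D}) p = Ideal.Quotient.mk _ q) ↔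
      ∀ i < D, p.coeff i = q.coeff i := by
  rw [Ideal.Quotient.eq, Ideal.mem_span_singleton, X_pow_dvd_iff]
  simp [sub_eq_zero]

theorem coeff_polyOf (D : ℕ) (p : BV) (i : ℕ) (h : i < D) :
    (polyOf D p).coeff i = if mem p i then 1 else 0 := by
  unfold polyOf
  rw [finsetSum_coeff, Finset.sum_eq_single i]
  · split_ifs <;> simp
  · intro j _ hj
    split_ifs <;> simp [coeff_X_pow, hj.symm]
  · intro hi; simp at hi; omega

theorem ev_congr {D : ℕ} {p q : BV} (h : ∀ i < D, mem p i = mem q i) : ev D p = ev D q := by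
  unfold ev
  rw [mk_eq_iff]
  intro i hi
  rw [coeff_polyOf _ _ _ hi, coeff_polyOf _ _ _ hi, h i hi]

theorem ev_addP (D : ℕ) (p q : BV) : ev D (addP D p q) = ev D p + ev D q := by
  unfold ev
  rw [← map_add, mk_eq_iff]
  intro i hi
  rw [coeff_add, coeff_polyOf _ _ _ hi, coeff_polyOf _ _ _ hi, coeff_polyOf _ _ _ hi, addP, mem_mkV]
  simp only [hi, decide_true, Bool.true_and]
  cases mem p i <;> cases mem q i <;> decide

theorem foldl_xor (l : List ℕ) (f : ℕ → Bool) (b : Bool) :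
    (if l.foldl (fun acc j => xor acc (f j)) b then (1 : ZMod 2) else 0) =
      (if b then 1 else 0) + (l.map fun j => if f j then (1 : ZMod 2) else 0).sum := by
  induction l generalizing b with
  | nil => cases b <;> simp
  | cons x l ih =>
    rw [List.foldl_cons, ih, List.map_cons, List.sum_cons, ← add_assoc]
    congr 1
    cases b <;> cases f x <;> decide

theorem ev_mulP (D : ℕ) (p q : BV) : ev D (mulP D p q) = ev D p * ev D q := by
  unfold ev
  rw [← map_mul, mk_eq_iff]
  intro i hi
  rw [coeff_mul, coeff_polyOf _ _ _ hi, mulP, mem_mkV]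
  simp only [hi, decide_true, Bool.true_and]
  rw [foldl_xor, Finset.Nat.sum_antidiagonal_eq_sum_range_succ
    (fun a b => (polyOf D p).coeff a * (polyOf D q).coeff b)]
  simp only [Bool.false_eq_true, if_false, zero_add]
  rw [Finset.sum_range]
  rw [← List.sum_ofFn, List.ofFn_eq_map]
  rw [← List.map_coe_finRange_eq_range, List.map_map]
  congr 1
  apply List.map_congr_left
  intro j _
  have h1 : (j : ℕ) < D := by omega
  have h2 : i - j < D := by omega
  simp only [Function.comp_apply]
  rw [coeff_polyOf _ _ _ h1, coeff_polyOf _ _ _ h2]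
  cases mem p j <;> cases mem q (i - j) <;> simp

theorem ev_nil (D : ℕ) : ev D [] = 0 := by
  unfold ev polyOf; simp [mem_nil]

theorem ev_monoP (D w : ℕ) : ev D (monoP D w) = zz D ^ w := by
  unfold ev zz
  rw [← map_pow, mk_eq_iff]
  intro i hi
  rw [coeff_polyOf _ _ _ hi, monoP, mem_mkV, coeff_X_pow]
  simp [hi]

theorem ev_sumP (D : ℕ) (l : List BV) : ev D (sumP D l) = (l.map (ev D)).sum := by
  have : ∀ b, ev D (l.foldl (addP D) b) = ev D b + (l.map (ev D)).sum := by
    induction l with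
    | nil => simp
    | cons x l ih => intro b; rw [List.foldl_cons, ih, ev_addP]; simp [add_assoc]
  rw [sumP, this, ev_nil, zero_add]

theorem ev_prodP (D : ℕ) (l : List BV) : ev D (prodP D l) = (l.map (ev D)).prod := by
  have : ∀ b, ev D (l.foldl (mulP D) b) = ev D b * (l.map (ev D)).prod := by
    induction l with
    | nil => simp
    | cons x l ih => intro b; rw [List.foldl_cons, ih, ev_mulP]; simp [mul_assoc]
  rw [prodP, this, ev_monoP, pow_zero, one_mul]

/-- The ring of truncated polynomials has characteristic two. -/
theorem two_TP {D : ℕ} (x : TP D) : x + x = 0 := by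
  obtain ⟨p, rfl⟩ := Ideal.Quotient.mk_surjective x
  rw [← map_add, ← map_zero (Ideal.Quotient.mk _)]
  congr 1
  ext i
  simp only [coeff_add, coeff_zero]
  exact CharTwo.add_self_eq_zero _

/-! ### Correctness of the tables -/

theorem trieFind_cons (b : Bool) (k : List Bool) (t : Trie) :
    trieFind (b :: k) t = trieFind k (trieChild b t) := rfl

theorem trieDown_snd (k : List Bool) (t : Trie) (p : List (Bool × Trie)) :
    (k.foldl (fun (s : Trie × List (Bool × Trie)) b =>
      (trieChild b s.1, (b, trieChild (!b) s.1) :: s.2)) (t, p)).2 = (trieDown k t).2 ++ p := by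
  unfold trieDown
  induction k generalizing t p with
  | nil => rfl
  | cons b k ih =>
    rw [List.foldl_cons, List.foldl_cons, ih, ih _ [_]]
    simp

theorem trieIns_cons (b : Bool) (k : List Bool) (t v : Trie) : trieIns (b :: k) t v =
    cond b (triePair (trieIns k (trieChild b t) v) (trieChild (!b) t))
      (triePair (trieChild (!b) t) (trieIns k (trieChild b t) v)) := by
  unfold trieIns
  have : (trieDown (b :: k) t).2 = (trieDown k (trieChild b t)).2 ++ [(b, trieChild (!b) t)] :=
    trieDown_snd k (trieChild b t) [(b, trieChild (!b) t)]
  rw [this, trieUp, List.foldl_append]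
  rfl

/-- Paths of equal length do not interfere. -/
theorem trieFind_trieIns (k k' : List Bool) (h : k.length = k'.length) (t v : Trie) :
    trieFind k (trieIns k' t v) = if k = k' then v else trieFind k t := by
  induction k generalizing k' t with
  | nil =>
    obtain rfl : k' = [] := by simpa using h.symm
    rfl
  | cons b k ih =>
    obtain ⟨b', k', rfl⟩ : ∃ b' l, k' = b' :: l := by
      cases k' with
      | nil => simp at h
      | cons b' l => exact ⟨_, _, rfl⟩
    rw [trieFind_cons, trieIns_cons, trieFind_cons]
    have hc : ∀ (c : Bool) (x y : Trie), trieChild c (triePair x y) = cond c x y := by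
      intro c x y; cases c <;> rfl
    have := ih k' (by simpa using h) (trieChild b' t)
    cases b <;> cases b' <;> simp only [cond_true, cond_false, hc, Bool.not_true, Bool.not_false] <;>
      simp [this]

/-- In a table filled entry by entry, every entry has the value inserted for its path. -/
theorem trieFind_foldl {β : Type} (k : β → List Bool) (h : β → Trie) (m : ℕ) (L : List β)
    (hk : ∀ x ∈ L, (k x).length = m) (hh : ∀ x ∈ L, ∀ y ∈ L, k x = k y → h x = h y) (t : Trie)
    (x : β) (hx : x ∈ L) : trieFind (k x) (L.foldl (fun t x => trieIns (k x) t (h x)) t) = h x := by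
  suffices key : ∀ (L' : List β) (t : Trie), (∀ y ∈ L', y ∈ L) → (x ∈ L' ∨ trieFind (k x) t = h x) →
      trieFind (k x) (L'.foldl (fun t x => trieIns (k x) t (h x)) t) = h x from
    key L t (fun _ h => h) (Or.inl hx)
  intro L'
  induction L' with
  | nil => simp
  | cons y L' ih =>
    intro t hL hor
    rw [List.foldl_cons]
    apply ih _ fun z hz => hL z (List.mem_cons_of_mem _ hz)
    have hy := hL y (by simp)
    rw [trieFind_trieIns _ _ ((hk x hx).trans (hk y hy).symm)]
    by_cases hxy : k x = k y
    · right; rw [if_pos hxy]; exact (hh x hx y hy hxy).symm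
    · rw [if_neg hxy]
      rcases hor with hor | hor
      · rcases List.mem_cons.1 hor with rfl | hor
        · exact absurd rfl hxy
        · exact Or.inl hor
      · exact Or.inr hor

theorem trieBits_trieOf (D : ℕ) (p : BV) (i : ℕ) (hi : i < D) :
    mem (trieBits D (trieOf p)) i = mem p i := by
  have key : ∀ (m : ℕ) (l : List ℕ) (acc : BV) (q : BV), l.length = m →
      (l.foldl (fun (s : BV × Trie) _ =>
        (vIsPair (vchild true s.2.val) :: s.1, trieChild false s.2)) (acc, trieOf q)).1.reverse =
        acc.reverse ++ (List.range m).map (mem q) := by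
    intro m
    induction m with
    | zero => intro l acc q hl; simp [List.length_eq_zero_iff.1 hl]
    | succ m ih =>
      intro l acc q hl
      obtain ⟨x, l, rfl⟩ : ∃ x l', l = x :: l' := by
        cases l with
        | nil => simp at hl
        | cons x l => exact ⟨_, _, rfl⟩
      rw [List.foldl_cons]
      have h1 : vIsPair (vchild true (trieOf q).val) = mem q 0 := by
        rcases q with _ | ⟨b, q⟩
        · rfl
        · cases b <;> rfl
      have h2 : trieChild false (trieOf q) = trieOf q.tail := by
        rcases q with _ | ⟨b, q⟩ <;> rfl
      have h3 : mem q.tail = fun i => mem q (i + 1) := by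
        funext i; cases q <;> simp [mem]
      simp only [h1, h2]
      rw [ih _ _ _ (by simpa using hl), List.range_succ_eq_map]
      simp [h3, Function.comp_def]
  have := key D (List.range D) [] p (by simp)
  unfold trieBits
  rw [this]
  simp [mem, hi]

theorem mem_enumStep {b : Bool} {L : Big (List (Big Asg))} {g : Asg} :
    ⟨g⟩ ∈ (enumStep b L).val ↔ ∃ s g', g = s :: g' ∧ ⟨g'⟩ ∈ L.val ∧
      s ∈ cond b states [stE] := by
  obtain ⟨l⟩ := L
  unfold enumStep
  suffices h : ∀ acc : Big (List (Big Asg)), (⟨g⟩ ∈ (l.foldl (fun acc g => cond b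
      (consB (consB (true, true, true) g) (consB (consB (true, true, false) g)
        (consB (consB (true, false, true) g) (consB (consB (true, false, false) g)
          (consB (consB stE g) acc)))))
      (consB (consB stE g) acc)) acc).val ↔ ⟨g⟩ ∈ acc.val ∨ ∃ s g', g = s :: g' ∧ ⟨g'⟩ ∈ l ∧
      s ∈ cond b states [stE]) by
    simpa using h ⟨[]⟩
  induction l with
  | nil => simp
  | cons x l ih =>
    intro acc
    rw [List.foldl_cons, ih]
    obtain ⟨x⟩ := x
    cases b
    · simp only [cond_false, consB, List.mem_cons, Big.mk.injEq, List.not_mem_nil, or_false]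
      constructor
      · rintro ((rfl | h) | ⟨s, g', rfl, h, rfl⟩)
        · exact Or.inr ⟨stE, x, rfl, Or.inl rfl, rfl⟩
        · exact Or.inl h
        · exact Or.inr ⟨_, _, rfl, Or.inr h, rfl⟩
      · rintro (h | ⟨s, g', rfl, rfl | h, rfl⟩)
        · exact Or.inl (Or.inr h)
        · exact Or.inl (Or.inl rfl)
        · exact Or.inr ⟨_, _, rfl, h, rfl⟩
    · simp only [cond_true, consB, List.mem_cons, Big.mk.injEq, states, List.not_mem_nil, or_false]
      constructor
      · rintro ((rfl | rfl | rfl | rfl | rfl | h) | ⟨s, g', rfl, h, hs⟩)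
        · exact Or.inr ⟨_, x, rfl, Or.inl rfl, by simp⟩
        · exact Or.inr ⟨_, x, rfl, Or.inl rfl, by simp⟩
        · exact Or.inr ⟨_, x, rfl, Or.inl rfl, by simp⟩
        · exact Or.inr ⟨_, x, rfl, Or.inl rfl, by simp⟩
        · exact Or.inr ⟨_, x, rfl, Or.inl rfl, by simp⟩
        · exact Or.inl h
        · exact Or.inr ⟨_, _, rfl, Or.inr h, hs⟩
      · rintro (h | ⟨s, g', rfl, rfl | h, hs⟩)
        · exact Or.inl (by simp [h])
        · exact Or.inl (by rcases hs with rfl | rfl | rfl | rfl | rfl <;> simp)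
        · exact Or.inr ⟨_, _, rfl, h, hs⟩

theorem enumA_cons (b : Bool) (U : BV) : enumA (b :: U) = enumStep b (enumA U) := by
  simp [enumA]

theorem length_of_mem_enumA {U : BV} {g : Asg} (h : ⟨g⟩ ∈ (enumA U).val) : g.length = U.length := by
  induction U generalizing g with
  | nil => simp [enumA] at h; simp [h]
  | cons b U ih =>
    rw [enumA_cons, mem_enumStep] at h
    obtain ⟨s, g', rfl, h, -⟩ := h
    simp [ih h]

theorem mem_enumA {U : BV} {g : Asg} (hl : g.length = U.length)
    (h : ∀ i < U.length, g.getD i stE ∈ cond (mem U i) states [stE]) : ⟨g⟩ ∈ (enumA U).val := by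
  induction U generalizing g with
  | nil => simp [enumA]; simpa using hl
  | cons b U ih =>
    rw [enumA_cons, mem_enumStep]
    obtain ⟨s, g', rfl⟩ : ∃ s g', g = s :: g' := by
      cases g with
      | nil => simp at hl
      | cons s g' => exact ⟨_, _, rfl⟩
    refine ⟨s, g', rfl, ih (by simpa using hl) fun i hi => ?_, ?_⟩
    · have := h (i + 1) (by simpa using hi)
      simpa [mem] using this
    · simpa [mem] using h 0 (by simp)

theorem readA_eq (n : ℕ) (g : Asg) (h : g.length = n) : readA n ⟨g⟩ = g := by
  have key : ∀ (m : ℕ) (l : List ℕ) (acc g : Asg), l.length = m → g.length = m →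
      (l.foldl (fun (s : Asg × Big Asg) _ => (headB s.2 :: s.1, tailB s.2)) (acc, ⟨g⟩)).1.reverse =
        acc.reverse ++ g := by
    intro m
    induction m with
    | zero =>
      intro l acc g hl hg
      simp [List.length_eq_zero_iff.1 hl, List.length_eq_zero_iff.1 hg]
    | succ m ih =>
      intro l acc g hl hg
      obtain ⟨x, l, rfl⟩ : ∃ x l', l = x :: l' := by
        cases l with
        | nil => simp at hl
        | cons x l => exact ⟨_, _, rfl⟩
      obtain ⟨y, g, rfl⟩ : ∃ x l', g = x :: l' := by
        cases g with
        | nil => simp at hg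
        | cons x l => exact ⟨_, _, rfl⟩
      rw [List.foldl_cons]
      have := ih l (y :: acc) g (by simpa using hl) (by simpa using hg)
      simpa [headB, tailB] using this
  exact key n _ [] g (by simp) h

theorem key_length (g : Asg) : (key g).length = 3 * g.length := by
  induction g with
  | nil => rfl
  | cons s g ih => simp [key] at *; omega

theorem key_injective : ∀ {g h : Asg}, key g = key h → g = h := by
  intro g
  induction g with
  | nil => intro h hk; cases h <;> simp [key] at *
  | cons s g ih =>
    intro h hk
    cases h with
    | nil => simp [key] at hk
    | cons s' h =>
      simp only [key, List.map_cons, List.flatten_cons, List.cons_append, List.nil_append,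
        List.cons.injEq] at hk
      obtain ⟨h1, h2, h3, h4⟩ := hk
      rw [ih h4]
      congr 1
      exact Prod.ext h1 (Prod.ext h2 h3)

/-- Looking up an assignment in the table of `v` gives the value of the assignment. -/
theorem facVal_table {D : ℕ} {G : Gr} {W : Wts} {R : BV} {F : List Factor} {v : ℕ} {g : Asg}
    (hg : ∀ i < G.length, g.getD i stE ∈ states) :
    ev D (facVal G.length D (scope G R F v, table D G W R F v) g) =
      ev D (valF D G W R F v (mask G.length (scope G R F v) g)) := by
  apply ev_congr
  intro i hi
  have hlen : (scope G R F v).length = G.length := by simp [scope]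
  have hmem : (⟨mask G.length (scope G R F v) g⟩ : Big Asg) ∈ (enumA (scope G R F v)).val := by
    apply mem_enumA
    · simp [mask, hlen]
    · intro i hi
      rw [hlen] at hi
      have := hg i hi
      cases hm : mem (scope G R F v) i <;> simp_all [mask]
  unfold facVal table
  dsimp only
  have hfind := trieFind_foldl (fun g => key (readA G.length g))
    (fun g => trieOf (valF D G W R F v (readA G.length g))) (3 * G.length) _ ?_ ?_ ⟨.nil⟩ _ hmem
  · rw [readA_eq _ _ (by simp [mask])] at hfind
    rw [hfind, trieBits_trieOf _ _ _ hi]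
  · rintro ⟨x⟩ hx
    have := length_of_mem_enumA hx
    rw [hlen] at this
    rw [readA_eq _ _ this, key_length, this]
  · intro x _ y _ h
    rw [key_injective h]

end CVC
namespace CVC
open Enc Polynomial

/-! ### Correctness of variable elimination -/

/-- The set of vertices represented by a bit vector. -/
def fs (n : ℕ) (S : BV) : Finset (Fin n) := Finset.univ.filter fun i => mem S i = true

theorem mem_fs {n : ℕ} {S : BV} {i : Fin n} : i ∈ fs n S ↔ mem S i = true := by simp [fs]

/-- The set of the five states. -/
def statesF : Finset St := states.toFinset

/-- The assignments with support in `R`. -/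
def adm {n : ℕ} (R : Finset (Fin n)) : Finset (Fin n → St) :=
  Fintype.piFinset fun v => if v ∈ R then statesF else {stE}

/-- The assignment `f` is compatible at all edges in `R`. -/
def okA {n : ℕ} (G : Gr) (R : Finset (Fin n)) (f : Fin n → St) : Prop :=
  ∀ u ∈ R, ∀ w ∈ R, adj G u w = true → compat (f u) (f w) = true

theorem compat_symm (s t : St) : compat s t = compat t s := by
  obtain ⟨a, b, c⟩ := s
  obtain ⟨a', b', c'⟩ := t
  revert a b c a' b' c'; decide

theorem getD_ofFn {n : ℕ} (f : Fin n → St) (u : Fin n) : (List.ofFn f).getD u stE = f u := by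
  simp

theorem mask_ofFn {n : ℕ} (U : BV) (f : Fin n → St) :
    mask n U (List.ofFn f) = List.ofFn fun u => cond (mem U u) (f u) stE := by
  apply List.ext_getElem (by simp [mask])
  intro i h1 h2
  have hi : i < n := by simpa using h2
  simp [mask, hi]

theorem updA_ofFn {n : ℕ} (f : Fin n → St) (v : Fin n) (s : St) :
    updA n (List.ofFn f) v s = List.ofFn (Function.update f v s) := by
  apply List.ext_getElem (by simp [updA])
  intro i h1 h2
  have hi : i < n := by simpa using h2
  by_cases h : i = v
  · subst h; simp [updA]
  · have : (⟨i, hi⟩ : Fin n) ≠ v := fun h' => h (congrArg Fin.val h')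
    have hb : (i == (v : ℕ)) = false := by simpa using h
    simp [updA, hi, hb, this]

theorem mask_nil {n : ℕ} (U : BV) : mask n U [] = mask n U (List.ofFn fun _ : Fin n => stE) := by
  rw [mask_ofFn]
  unfold mask
  rw [List.ofFn_eq_map, ← List.map_coe_finRange_eq_range, List.map_map]
  apply List.map_congr_left
  intro u _
  simp

/-- A sum over the assignments with support in `R` as an iterated sum. -/
theorem sum_adm {n : ℕ} {A : Type*} [AddCommMonoid A] (R : Finset (Fin n)) (v : Fin n) (hv : v ∈ R)
    (h : (Fin n → St) → A) :
    ∑ f ∈ adm R, h f = ∑ g ∈ adm (R.erase v), ∑ s ∈ statesF, h (Function.update g v s) := by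
  rw [← Finset.sum_product' (adm (R.erase v)) statesF fun g s => h (Function.update g v s)]
  symm
  refine Finset.sum_bij' (fun x _ => Function.update x.1 v x.2)
    (fun f _ => (Function.update f v stE, f v)) ?_ ?_ ?_ ?_ ?_
  · rintro ⟨g, s⟩ hx
    simp only [Finset.mem_product, adm, Fintype.mem_piFinset, Finset.mem_erase] at hx ⊢
    intro u
    by_cases h : u = v
    · subst h; simpa [hv] using hx.2
    · have := hx.1 u; simpa [h] using this
  · intro f hf
    simp only [Finset.mem_product, adm, Fintype.mem_piFinset, Finset.mem_erase] at hf ⊢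
    refine ⟨fun u => ?_, by simpa [hv] using hf v⟩
    by_cases h : u = v
    · subst h; simp
    · have := hf u; simpa [h] using this
  · rintro ⟨g, s⟩ hx
    simp only [Finset.mem_product, adm, Fintype.mem_piFinset, Finset.mem_erase] at hx
    have : g v = stE := by simpa using hx.1 v
    simp [← this]
  · intro f _; simp
  · intro x _; rfl

open Classical in
/-- The sum that remains to be computed when the vertices in `R` have not been eliminated. -/
noncomputable def zsum {n : ℕ} (D : ℕ) (G : Gr) (a : Fin n → St → TP D) (R : Finset (Fin n))
    (F : List Factor) : TP D :=
  ∑ f ∈ adm R, if okA G R f then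
    (∏ v ∈ R, a v (f v)) * (F.map fun φ => ev D (facVal n D φ (List.ofFn f))).prod else 0

theorem prod_filter_list {A β : Type*} [CommMonoid A] (F : List β) (p : β → Bool) (h : β → A) :
    (F.map h).prod = ((F.filter fun x => !p x).map h).prod * ((F.filter p).map h).prod := by
  induction F with
  | nil => simp
  | cons x F ih =>
    rw [List.map_cons, List.prod_cons, ih]
    cases hp : p x
    · simp [hp, mul_assoc]
    · simp [hp, mul_left_comm]

theorem okA_update {n : ℕ} {G : Gr} (hs : ∀ i j, adj G i j = adj G j i) (hl : ∀ i, adj G i i = false)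
    {R : Finset (Fin n)} {v : Fin n} (hv : v ∈ R) {g : Fin n → St} {s : St} :
    okA G R (Function.update g v s) ↔ okA G (R.erase v) g ∧
      ∀ u ∈ R, adj G v u = true → compat s (g u) = true := by
  constructor
  · intro h
    refine ⟨fun u hu w hw huw => ?_, fun u hu huv => ?_⟩
    · rw [Finset.mem_erase] at hu hw
      simpa [hu.1, hw.1] using h u hu.2 w hw.2 huw
    · have hne : u ≠ v := by rintro rfl; simp [hl] at huv
      simpa [hne] using h v hv u hu huv
  · rintro ⟨h1, h2⟩ u hu w hw huw
    by_cases hu' : u = v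
    · subst hu'
      have hne : w ≠ u := by rintro rfl; simp [hl] at huw
      simpa [hne] using h2 w hw huw
    · by_cases hw' : w = v
      · subst hw'
        rw [compat_symm]
        simpa [hu'] using h2 u hu (by rw [hs]; exact huw)
      · simpa [hu', hw'] using h1 u (by simp [hu, hu']) w (by simp [hw, hw']) huw

open Classical in
theorem ev_valF {n D : ℕ} {G : Gr} (hn : G.length = n) {W : Wts} {R : BV} {F : List Factor} {v : Fin n}
    {g : Fin n → St} :
    ev D (valF D G W R F v (List.ofFn g)) = ∑ s ∈ statesF,
      if ∀ u ∈ fs n R, adj G v u = true → compat s (g u) = true then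
        ev D (wt W v s) * (F.map fun φ => ev D (facVal n D φ (List.ofFn (Function.update g v s)))).prod
      else 0 := by
  subst hn
  unfold valF statesF
  rw [ev_sumP, List.map_map, List.sum_toFinset _ (by decide)]
  congr 1
  apply List.map_congr_left
  intro s _
  simp only [Function.comp_apply, term]
  have : (allR G.length fun u => !(mem R u && adj G v u) || compat s ((List.ofFn g).getD u stE)) = true ↔
      ∀ u ∈ fs G.length R, adj G v u = true → compat s (g u) = true := by
    rw [allR_eq_true]
    constructor
    · intro h u hu huv
      have := h u u.2
      rw [getD_ofFn] at this
      rw [mem_fs] at hu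
      simpa [hu, huv] using this
    · intro h u hu
      have := h ⟨u, hu⟩
      rw [mem_fs] at this
      have e := getD_ofFn g ⟨u, hu⟩
      simp only at e this
      rw [e]
      cases h1 : mem R u <;> cases h2 : adj G v u <;> simp_all
  by_cases hc : ∀ u ∈ fs G.length R, adj G v u = true → compat s (g u) = true
  · rw [if_pos hc, this.2 hc, cond_true, ev_prodP, List.map_cons, List.prod_cons, List.map_map]
    congr 3
    funext φ
    simp [updA_ofFn]
  · rw [if_neg hc, Bool.eq_false_iff.2 (fun h => hc (this.1 h)), cond_false, ev_nil]

theorem facVal_update {n D : ℕ} {φ : Factor} {v : Fin n} (h : mem φ.1 v = false) (g : Fin n → St) (s : St) :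
    facVal n D φ (List.ofFn (Function.update g v s)) = facVal n D φ (List.ofFn g) := by
  unfold facVal
  rw [mask_ofFn, mask_ofFn]
  congr 4
  funext u
  by_cases hu : u = v
  · subst hu; simp [h]
  · simp [hu]

theorem mem_scope {G : Gr} {R : BV} {F : List Factor} {v u : ℕ} : mem (scope G R F v) u = true ↔
    u < G.length ∧ u ≠ v ∧ ((mem R u = true ∧ adj G v u = true) ∨ ∃ φ ∈ F, mem φ.1 u = true) := by
  rw [scope, mem_mkV]
  simp

/-- The factor that arises from the elimination of `v` depends only on the states in its scope. -/
theorem valF_mask {n D : ℕ} {G : Gr} (hn : G.length = n) (hl : ∀ i, adj G i i = false) {W : Wts} {R : BV}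
    {F : List Factor} {v : Fin n} {g : Fin n → St} :
    valF D G W R F v (mask n (scope G R F v) (List.ofFn g)) = valF D G W R F v (List.ofFn g) := by
  subst hn
  have hget : ∀ u : Fin G.length, u ≠ v → (mem R u = true ∧ adj G v u = true) ∨
      (∃ φ ∈ F, mem φ.1 u = true) → mem (scope G R F v) u = true := fun u hu h =>
    mem_scope.2 ⟨u.2, fun h' => hu (Fin.ext h'), h⟩
  rw [mask_ofFn]
  unfold valF
  congr 1
  apply List.map_congr_left
  intro s _
  unfold term
  congr 1
  · rw [Bool.eq_iff_iff, allR_eq_true, allR_eq_true]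
    refine forall₂_congr fun u hu => ?_
    have e1 := getD_ofFn g ⟨u, hu⟩
    have e2 := getD_ofFn (fun u : Fin G.length => cond (mem (scope G R F v) u) (g u) stE) ⟨u, hu⟩
    simp only at e1 e2
    rw [e1, e2]
    cases h1 : mem R u
    · simp
    cases h2 : adj G v u
    · simp
    have : mem (scope G R F v) u = true := hget ⟨u, hu⟩ (by
      rintro h; rw [← h] at h2; simp [hl] at h2) (Or.inl ⟨h1, h2⟩)
    rw [this, cond_true]
  · congr 2
    apply List.map_congr_left
    intro φ hφ
    unfold facVal
    rw [updA_ofFn, updA_ofFn, mask_ofFn, mask_ofFn]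
    congr 4
    funext u
    by_cases hu : u = v
    · subst hu; simp
    · cases hm : mem φ.1 u
      · simp
      · simp [hu, hget u hu (Or.inr ⟨φ, hφ, hm⟩)]

/-- Eliminating a vertex does not change the sum: the sum over the states of `v` is carried out
first, with everything that does not depend on `v` factored out. -/
theorem zsum_elimAt {n D : ℕ} {G : Gr} (hn : G.length = n) (hs : ∀ i j, adj G i j = adj G j i)
    (hl : ∀ i, adj G i i = false) (W : Wts) (R : BV) (F : List Factor) (v : Fin n)
    (hv : mem R v = true) :
    zsum D G (fun v : Fin n => fun s => ev D (wt W v s)) (fs n R) F =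
      zsum D G (fun v : Fin n => fun s => ev D (wt W v s)) (fs n (elimAt D G W R F v).1)
        (elimAt D G W R F v).2 := by
  classical
  subst hn
  have hR : fs G.length (elimAt D G W R F v).1 = (fs G.length R).erase v := by
    ext u
    rw [mem_fs, elimAt, mem_mkV, Finset.mem_erase, mem_fs]
    simp only [u.2, decide_true, Bool.true_and, Bool.and_eq_true, Bool.not_eq_true', beq_eq_false_iff_ne,
      ne_eq, Fin.val_inj]
    tauto
  unfold zsum
  rw [hR, sum_adm _ v (mem_fs.2 hv)]
  apply Finset.sum_congr rfl
  intro g hg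
  have hgs : ∀ i < G.length, (List.ofFn g).getD i stE ∈ states := by
    intro i hi
    have := getD_ofFn g ⟨i, hi⟩
    simp only at this
    rw [this]
    rw [adm, Fintype.mem_piFinset] at hg
    have := hg ⟨i, hi⟩
    split_ifs at this
    · simpa [statesF] using this
    · rw [Finset.mem_singleton] at this; rw [this]; decide
  by_cases hok : okA G ((fs G.length R).erase v) g
  · rw [if_pos hok, elimAt]
    simp only [List.map_cons, List.prod_cons]
    rw [facVal_table hgs, valF_mask rfl hl, ev_valF rfl, mul_left_comm, Finset.sum_mul]
    apply Finset.sum_congr rfl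
    intro s _
    rw [okA_update hs hl (mem_fs.2 hv)]
    by_cases hc : ∀ u ∈ fs G.length R, adj G v u = true → compat s (g u) = true
    · rw [if_pos ⟨hok, hc⟩, if_pos hc, ← Finset.mul_prod_erase _ _ (mem_fs.2 hv),
        prod_filter_list F (fun φ => mem φ.1 v)]
      have e1 : ∏ x ∈ (fs G.length R).erase v, ev D (wt W x (Function.update g v s x)) =
          ∏ x ∈ (fs G.length R).erase v, ev D (wt W x (g x)) := by
        apply Finset.prod_congr rfl
        intro x hx
        rw [Function.update_of_ne (Finset.ne_of_mem_erase hx)]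
      have e2 : (F.filter fun φ => !mem φ.1 v).map (fun φ => ev D (facVal G.length D φ
          (List.ofFn (Function.update g v s)))) = (F.filter fun φ => !mem φ.1 v).map (fun φ =>
            ev D (facVal G.length D φ (List.ofFn g))) := by
        apply List.map_congr_left
        intro φ hφ
        rw [facVal_update]
        simpa using (List.mem_filter.1 hφ).2
      rw [e1, e2, Function.update_self, facsAt]
      ring
    · rw [if_neg (fun h => hc h.2), if_neg hc, zero_mul]
  · rw [if_neg hok]
    apply Finset.sum_eq_zero
    intro s _
    rw [if_neg (fun h => hok ((okA_update hs hl (mem_fs.2 hv)).1 h).1)]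

theorem pick_mem {n : ℕ} {B : List BV} {R : BV} (h : elems n R ≠ []) : pick n B R ∈ elems n R := by
  unfold pick
  obtain ⟨x, l, hl⟩ : ∃ x l, (elems n R).filter (good n B R) ++ elems n R = x :: l := by
    cases hc : (elems n R).filter (good n B R) ++ elems n R with
    | nil => simp [h] at hc
    | cons x l => exact ⟨_, _, rfl⟩
  rw [hl]
  have : x ∈ (elems n R).filter (good n B R) ++ elems n R := by rw [hl]; simp
  rw [List.mem_append, List.mem_filter] at this
  exact this.elim (fun h => h.1) id

theorem fs_eq_empty {n : ℕ} {R : BV} : fs n R = ∅ ↔ elems n R = [] := by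
  constructor
  · intro h
    rw [List.eq_nil_iff_forall_not_mem]
    intro i hi
    rw [mem_elems] at hi
    have : (⟨i, hi.1⟩ : Fin n) ∈ fs n R := mem_fs.2 hi.2
    simp [h] at this
  · intro h
    rw [Finset.eq_empty_iff_forall_notMem]
    intro i hi
    have : (i : ℕ) ∈ elems n R := mem_elems.2 ⟨i.2, mem_fs.1 hi⟩
    simp [h] at this

theorem zsum_empty {n D : ℕ} (G : Gr) (a : Fin n → St → TP D) (F : List Factor) :
    zsum D G a ∅ F = ev D (prodP D (F.map fun φ => facVal n D φ [])) := by
  have : adm (∅ : Finset (Fin n)) = {fun _ => stE} := by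
    ext f
    simp [adm, funext_iff]
  rw [zsum, this, Finset.sum_singleton, if_pos (by intro u hu; simp at hu), ev_prodP, List.map_map]
  simp only [Finset.prod_empty, one_mul, Function.comp_def]
  congr 2
  funext φ
  rw [facVal, facVal, mask_nil]

theorem zsum_foldl {n D : ℕ} {G : Gr} (hn : G.length = n) (hs : ∀ i j, adj G i j = adj G j i)
    (hl : ∀ i, adj G i i = false) (W : Wts) (B : List BV) (l : List ℕ) (s : BV × List Factor)
    (hc : (fs n s.1).card ≤ l.length) :
    ev D (prodP D ((l.foldl (fun s _ => elimStep D G W B s) s).2.map fun φ => facVal n D φ [])) =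
      zsum D G (fun v : Fin n => fun s => ev D (wt W v s)) (fs n s.1) s.2 := by
  subst hn
  induction l generalizing s with
  | nil =>
    have : fs G.length s.1 = ∅ := by simpa using hc
    rw [this, zsum_empty]; rfl
  | cons x l ih =>
    rw [List.foldl_cons]
    by_cases h : elems G.length s.1 = []
    · have e : elimStep D G W B s = s := by simp [elimStep, h]
      rw [e]
      apply ih
      rw [fs_eq_empty.2 h]; simp
    · have e : elimStep D G W B s = elimAt D G W s.1 s.2 (pick G.length B s.1) := by
        rw [elimStep, List.isEmpty_eq_false_iff.2 h, cond_false]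
      obtain ⟨hp1, hp2⟩ := mem_elems.1 (pick_mem (B := B) h)
      rw [e, zsum_elimAt rfl hs hl W s.1 s.2 ⟨pick G.length B s.1, hp1⟩ hp2]
      apply ih
      have : fs G.length (elimAt D G W s.1 s.2 (pick G.length B s.1)).1 ⊂ fs G.length s.1 := by
        rw [Finset.ssubset_iff_of_subset]
        · refine ⟨⟨pick G.length B s.1, hp1⟩, mem_fs.2 hp2, ?_⟩
          rw [mem_fs, elimAt, mem_mkV]; simp
        · intro u hu
          rw [mem_fs, elimAt, mem_mkV] at hu
          rw [mem_fs]
          simp at hu; exact hu.1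
      have := Finset.card_lt_card this
      simp only [List.length_cons] at hc
      omega

open Classical in
/-- Variable elimination computes the sum over all compatible assignments. -/
theorem ev_zval {n D : ℕ} {G : Gr} (hn : G.length = n) (hs : ∀ i j, adj G i j = adj G j i)
    (hl : ∀ i, adj G i i = false) (W : Wts) (B : List BV) (R : BV) :
    ev D (zval D G W B R) = ∑ f ∈ adm (fs n R), if okA G (fs n R) f then
      ∏ v ∈ fs n R, ev D (wt W v (f v)) else 0 := by
  have := zsum_foldl (D := D) hn hs hl W B (List.range n) (R, []) (by
    simpa using (fs n R).card_le_univ)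
  unfold zval
  rw [hn, this, zsum]
  simp

end CVC
namespace CVC
open Enc

/-! ### Elimination orders from tree decompositions -/

section tree
variable {τ : Type*} {T : SimpleGraph τ}

/-- A neighbour towards the root is unique. -/
theorem tree_parent_unique (hT : T.IsTree) (r : τ) {t a b : τ} (ha : T.Adj t a) (hb : T.Adj t b)
    (hda : T.dist r a ≤ T.dist r t) (hdb : T.dist r b ≤ T.dist r t) : a = b := by
  have key : ∀ c, T.Adj t c → T.dist r c ≤ T.dist r t →
      ∃ p : T.Walk r t, p.IsPath ∧ p.penultimate = c := by
    intro c hc hd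
    obtain ⟨p, hp⟩ := (hT.connected r c).exists_walk_length_eq_dist
    refine ⟨p.concat hc.symm, SimpleGraph.Walk.isPath_of_length_eq_dist _ ?_, by simp⟩
    rcases hT.dist_eq_dist_add_one_of_adj r hc with h | h <;> simp <;> omega
  obtain ⟨p, hp, rfl⟩ := key a ha hda
  obtain ⟨q, hq, rfl⟩ := key b hb hdb
  rw [(hT.existsUnique_path r t).unique hp hq]

/-- Every nonempty finite set of nodes of a tree contains a node with at most one neighbour in the
set. -/
theorem tree_exists_leaf (hT : T.IsTree) (X : Finset τ) (hX : X.Nonempty) :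
    ∃ t ∈ X, ∀ a ∈ X, ∀ b ∈ X, T.Adj t a → T.Adj t b → a = b := by
  obtain ⟨r⟩ := hT.connected.nonempty
  obtain ⟨t, ht, hmax⟩ := X.exists_max_image (T.dist r) hX
  exact ⟨t, ht, fun a ha b hb hta htb => tree_parent_unique hT r hta htb (hmax a ha) (hmax b hb)⟩

/-- The graph induced on `A` is connected: a property that holds somewhere in `A` and is passed on
to neighbours in `A` holds everywhere in `A`. -/
def ConnIn (T : SimpleGraph τ) (A : Set τ) : Prop :=
  ∀ P : τ → Prop, (∃ a ∈ A, P a) → (∀ a ∈ A, ∀ b ∈ A, T.Adj a b → P a → P b) → ∀ a ∈ A, P a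

theorem connIn_of_preconnected {A : Set τ} (h : (T.induce A).Preconnected) : ConnIn T A := by
  rintro P ⟨a, ha, hPa⟩ hstep b hb
  obtain ⟨w⟩ := h ⟨a, ha⟩ ⟨b, hb⟩
  have : ∀ {x y : A} (_ : (T.induce A).Walk x y), P x → P y := by
    intro x y w
    induction w with
    | nil => exact fun h => h
    | cons hadj _ ih => exact fun h => ih (hstep _ (Subtype.coe_prop _) _ (Subtype.coe_prop _) hadj h)
  exact this w hPa

/-- If every vertex of `S` is in the bags of a connected set of tree nodes, then the bags that
contain some vertex `v` are all contained in one of them, as far as `S` is concerned. -/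
theorem exists_pick {V : Type*} (hT : T.IsTree) (bag : τ → V → Prop) (S : Set V) (hS : S.Nonempty)
    (X : Finset τ) (hcov : ∀ v ∈ S, ∃ t ∈ X, bag t v)
    (hconn : ∀ v ∈ S, ConnIn T {t | t ∈ X ∧ bag t v}) :
    ∃ v ∈ S, ∃ t ∈ X, bag t v ∧ ∀ t' ∈ X, bag t' v → ∀ u ∈ S, bag t' u → bag t u := by
  classical
  induction hc : X.card generalizing X with
  | zero =>
    obtain ⟨v, hv⟩ := hS
    obtain ⟨t, ht, -⟩ := hcov v hv
    rw [Finset.card_eq_zero] at hc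
    simp [hc] at ht
  | succ m ih =>
    obtain ⟨t₀, ht₀, hleaf⟩ := tree_exists_leaf hT X (Finset.card_pos.1 (by omega))
    by_cases h : ∃ v ∈ S, bag t₀ v ∧ ∀ t ∈ X, T.Adj t₀ t → ¬ bag t v
    · obtain ⟨v, hv, hb, hno⟩ := h
      -- the bag of `t₀` is the only one that contains `v`
      have : ∀ t ∈ X, bag t v → t = t₀ := fun t ht hbt =>
        hconn v hv (fun t => t = t₀) ⟨t₀, ⟨ht₀, hb⟩, rfl⟩ (by
          rintro a ⟨ha, hba⟩ b ⟨hb', hbb⟩ hab rfl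
          exact absurd hbb (hno b hb' hab)) t ⟨ht, hbt⟩
      exact ⟨v, hv, t₀, ht₀, hb, fun t' ht' hb' u _ hu => this t' ht' hb' ▸ hu⟩
    · push Not at h
      obtain ⟨v, hv, t, ht, hbt, hall⟩ := ih (X.erase t₀) (by
          intro v hv
          obtain ⟨t, ht, hbt⟩ := hcov v hv
          by_cases htt : t = t₀
          · subst htt
            obtain ⟨t', ht', hadj, hb'⟩ := h v hv hbt
            exact ⟨t', by simp [ht', hadj.ne'], hb'⟩
          · exact ⟨t, by simp [ht, htt], hbt⟩) (by
          rintro v hv P ⟨a, ⟨ha, hba⟩, hPa⟩ hstep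
          have ha' := Finset.mem_erase.1 ha
          -- extend `P` to `t₀` by the value at its neighbour
          have key := hconn v hv (fun t => if t = t₀ then ∃ t' ∈ X, T.Adj t₀ t' ∧ bag t' v ∧ P t'
            else P t) ⟨a, ⟨ha'.2, hba⟩, by simp [ha'.1, hPa]⟩ (by
            rintro x ⟨hx, hbx⟩ y ⟨hy, hby⟩ hxy hPx
            by_cases hx0 : x = t₀
            · subst hx0
              rw [if_pos rfl] at hPx
              obtain ⟨t', ht', hadj, hb', hPt'⟩ := hPx
              rw [if_neg hxy.ne', hleaf y hy t' ht' hxy hadj]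
              exact hPt'
            · rw [if_neg hx0] at hPx
              by_cases hy0 : y = t₀
              · subst hy0
                rw [if_pos rfl]
                exact ⟨x, hx, hxy.symm, hbx, hPx⟩
              · rw [if_neg hy0]
                exact hstep x ⟨by simp [hx, hx0], hbx⟩ y ⟨by simp [hy, hy0], hby⟩ hxy hPx)
          rintro b ⟨hb, hbb⟩
          have hb' := Finset.mem_erase.1 hb
          simpa [hb'.1] using key b ⟨hb'.2, hbb⟩) (by
          rw [Finset.card_erase_of_mem ht₀, hc]; rfl)
      refine ⟨v, hv, t, Finset.mem_of_mem_erase ht, hbt, fun t' ht' hb' u hu hbu => ?_⟩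
      by_cases htt : t' = t₀
      · subst htt
        -- all vertices of the leaf bag that lie in `S` are in the bag of its neighbour
        obtain ⟨t₁, ht₁, hadj, hb₁⟩ := h v hv hb'
        obtain ⟨t₂, ht₂, hadj₂, hb₂⟩ := h u hu hbu
        obtain rfl := hleaf t₁ ht₁ t₂ ht₂ hadj hadj₂
        exact hall t₁ (by simp [ht₁, hadj.ne']) hb₁ u hu hb₂
      · exact hall t' (by simp [ht', htt]) hb' u hu hbu

end tree

/-! ### The cost of variable elimination -/

/-- The properties of a list of bags for the graph induced on `R` that make elimination cheap. -/
structure BagOK (n : ℕ) (G : Gr) (B : List BV) (R : Finset (Fin n)) (k : ℕ) : Prop where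
  edge : ∀ u ∈ R, ∀ w ∈ R, adj G u w = true → ∃ t ∈ B, mem t u = true ∧ mem t w = true
  pick : ∀ S : Finset (Fin n), S ⊆ R → S.Nonempty → ∃ v ∈ S, ∃ t ∈ B, mem t v = true ∧
    ∀ t' ∈ B, mem t' v = true → ∀ u ∈ S, mem t' u = true → mem t u = true
  card : ∀ t ∈ B, (R ∩ fs n t).card ≤ k + 1

theorem elems_length (n : ℕ) (S : BV) : (elems n S).length = (fs n S).card := by
  rw [← List.toFinset_card_of_nodup (nodup_elems n S), ← Finset.card_map Fin.valEmbedding]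
  congr 1
  ext i
  simp only [List.mem_toFinset, mem_elems, Finset.mem_map, mem_fs, Fin.valEmbedding_apply]
  constructor
  · rintro ⟨h1, h2⟩; exact ⟨⟨i, h1⟩, h2, rfl⟩
  · rintro ⟨a, h, rfl⟩; exact ⟨a.2, h⟩

theorem count_mkV (n : ℕ) (p : ℕ → Bool) : (mkV n p).count true = (fs n (mkV n p)).card := by
  rw [← elems_length, elems]
  have : (List.range n).filter (mem (mkV n p)) = (List.range n).filter p := by
    apply List.filter_congr
    intro i hi
    rw [mem_mkV]
    simp [List.mem_range.1 hi]
  rw [this, mkV, List.count, List.countP_map, List.countP_eq_length_filter]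
  congr 2
  funext i; simp

theorem good_eq_true {n : ℕ} {B : List BV} {R : BV} {v : ℕ} : good n B R v = true ↔
    ∃ t ∈ B, mem t v = true ∧ ∀ t' ∈ B, mem t' v = true → ∀ u < n, mem t' u = true →
      mem R u = true → mem t u = true := by
  simp only [good, List.any_eq_true, Bool.and_eq_true, List.all_eq_true, Bool.or_eq_true,
    allR_eq_true, Bool.not_eq_true', Bool.and_eq_false_iff]
  refine exists_congr fun t => and_congr Iff.rfl (and_congr Iff.rfl ?_)
  refine forall₂_congr fun t' _ => ?_
  cases mem t' v <;> simp
  refine forall₂_congr fun u _ => ?_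
  cases mem t' u <;> cases mem R u <;> simp

/-- The vertex that is eliminated next has all its remaining bag mates in one bag. -/
theorem pick_good {n : ℕ} {G : Gr} {B : List BV} {R : Finset (Fin n)} {k : ℕ}
    (hB : BagOK n G B R k) {S : BV} (hS : fs n S ⊆ R) (hne : elems n S ≠ []) :
    good n B S (pick n B S) = true := by
  obtain ⟨v, hv, t, ht, htv, hall⟩ := hB.pick (fs n S) hS
    (Finset.nonempty_iff_ne_empty.2 fun h => hne (fs_eq_empty.1 h))
  have hg : good n B S v = true := good_eq_true.2 ⟨t, ht, htv, fun t' ht' h1 u hu h2 h3 =>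
    hall t' ht' h1 ⟨u, hu⟩ (mem_fs.2 h3) h2⟩
  have hmem : (v : ℕ) ∈ (elems n S).filter (good n B S) :=
    List.mem_filter.2 ⟨mem_elems.2 ⟨v.2, mem_fs.1 hv⟩, hg⟩
  unfold pick
  obtain ⟨x, l, hl⟩ : ∃ x l, (elems n S).filter (good n B S) = x :: l := by
    cases hc : (elems n S).filter (good n B S) with
    | nil => rw [hc] at hmem; simp at hmem
    | cons x l => exact ⟨_, _, rfl⟩
  rw [hl]
  have : x ∈ (elems n S).filter (good n B S) := by rw [hl]; simp
  exact (List.mem_filter.1 this).2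

/-- The scopes are contained in the bags. -/
def ScopeOK (n : ℕ) (B : List BV) (s : BV × List Factor) : Prop :=
  ∀ φ ∈ s.2, (∃ t ∈ B, ∀ u < n, mem φ.1 u = true → mem t u = true) ∧
    ∀ u < n, mem φ.1 u = true → mem s.1 u = true

/-- The table of an eliminated vertex has at most `5 ^ k` entries, because the vertex and the scope
of the new factor lie in one bag with at most `k + 1` remaining vertices. -/
theorem elim_step_ok {n : ℕ} {G : Gr} (hn : G.length = n) (D : ℕ) (W : Wts) {B : List BV}
    {R : Finset (Fin n)} {k : ℕ} (hB : BagOK n G B R k) {s : BV × List Factor} (hS : fs n s.1 ⊆ R)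
    (hs : ScopeOK n B s) :
    (cond (elems G.length s.1).isEmpty 0 (stepCost G B s) ≤ 5 ^ k) ∧
      fs n (elimStep D G W B s).1 ⊆ R ∧ ScopeOK n B (elimStep D G W B s) := by
  subst hn
  by_cases h : elems G.length s.1 = []
  · rw [elimStep, h]
    simp only [List.isEmpty_nil, cond_true]
    exact ⟨Nat.zero_le _, hS, hs⟩
  rw [elimStep, List.isEmpty_eq_false_iff.2 h, cond_false, cond_false]
  obtain ⟨hv1, hv2⟩ := mem_elems.1 (pick_mem (B := B) h)
  obtain ⟨t, ht, htv, hall⟩ := good_eq_true.1 (pick_good hB hS h)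
  set v := pick G.length B s.1 with hvdef
  -- the new scope and the eliminated vertex lie in the bag `t`
  have hsc : ∀ u, mem (scope G s.1 (facsAt v s.2) v) u = true →
      u ≠ v ∧ mem t u = true ∧ mem s.1 u = true := by
    intro u hu
    obtain ⟨h1, h2, h3⟩ := mem_scope.1 hu
    refine ⟨h2, ?_⟩
    rcases h3 with ⟨h3, h4⟩ | ⟨φ, hφ, h3⟩
    · obtain ⟨t', ht', h5, h6⟩ := hB.edge ⟨v, hv1⟩ (hS (mem_fs.2 hv2)) ⟨u, h1⟩ (hS (mem_fs.2 h3)) h4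
      exact ⟨hall t' ht' h5 u h1 h6 h3, h3⟩
    · obtain ⟨hφ1, hφ2⟩ := List.mem_filter.1 hφ
      obtain ⟨⟨t', ht', h5⟩, h6⟩ := hs φ hφ1
      have h7 := h6 u h1 h3
      exact ⟨hall t' ht' (h5 v hv1 hφ2) u h1 (h5 u h1 h3) h7, h7⟩
  refine ⟨?_, ?_, ?_⟩
  · rw [stepCost, ← hvdef, tableSize]
    apply Nat.pow_le_pow_right (by norm_num)
    rw [scope, count_mkV, ← scope]
    have hsub : insert ⟨v, hv1⟩ (fs G.length (scope G s.1 (facsAt v s.2) v)) ⊆ R ∩ fs G.length t := by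
      intro u hu
      rw [Finset.mem_insert, mem_fs] at hu
      rw [Finset.mem_inter, mem_fs]
      rcases hu with rfl | hu
      · exact ⟨hS (mem_fs.2 hv2), htv⟩
      · obtain ⟨-, h1, h2⟩ := hsc u hu
        exact ⟨hS (mem_fs.2 h2), h1⟩
    have := (Finset.card_le_card hsub).trans (hB.card t ht)
    rw [Finset.card_insert_of_notMem (by
      rw [mem_fs]; intro h'; exact (hsc _ h').1 rfl)] at this
    omega
  · intro u hu
    rw [mem_fs, elimAt, mem_mkV] at hu
    simp at hu
    exact hS (mem_fs.2 hu.1)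
  · rintro φ hφ
    rw [elimAt] at hφ ⊢
    rcases List.mem_cons.1 hφ with rfl | hφ
    · refine ⟨⟨t, ht, fun u _ hu => (hsc u hu).2.1⟩, fun u hu hm => ?_⟩
      obtain ⟨h1, -, h2⟩ := hsc u hm
      rw [mem_mkV]; simp [hu, h1, h2]
    · obtain ⟨hφ1, hφ2⟩ := List.mem_filter.1 hφ
      refine ⟨(hs φ hφ1).1, fun u hu hm => ?_⟩
      rw [mem_mkV]
      have hne : u ≠ v := by rintro rfl; simp [hm] at hφ2
      simp [hu, hne, (hs φ hφ1).2 u hu hm]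

/-- Variable elimination takes at most `n * 5 ^ k` table entries. -/
theorem elimCost_le {n : ℕ} {G : Gr} (hn : G.length = n) (D : ℕ) (W : Wts) {B : List BV}
    {R : BV} {k : ℕ} (hB : BagOK n G B (fs n R) k) : elimCost D G W B R ≤ n * 5 ^ k := by
  unfold elimCost
  suffices h : ∀ (l : List ℕ) (s : BV × List Factor), fs n s.1 ⊆ fs n R → ScopeOK n B s →
      foldCost (fun s (_ : ℕ) => cond (elems G.length s.1).isEmpty 0 (stepCost G B s))
        (fun s _ => elimStep D G W B s) s l ≤ l.length * 5 ^ k by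
    simpa [hn] using h (List.range G.length) (R, []) subset_rfl (by intro φ hφ; simp at hφ)
  intro l
  induction l with
  | nil => simp [foldCost]
  | cons x l ih =>
    intro s h1 h2
    obtain ⟨h3, h4, h5⟩ := elim_step_ok hn D W hB h1 h2
    have := ih _ h4 h5
    simp only [foldCost, List.length_cons, add_mul, one_mul]
    omega

end CVC
namespace CVC

/-! ### Modules -/

section modules
variable {W : Type} {H : SimpleGraph W}

theorem isModule_iff {M : Set W} : IsModule H M ↔
    ∀ v ∈ M, ∀ w ∈ M, ∀ x ∉ M, (H.Adj v x ↔ H.Adj w x) := by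
  unfold IsModule
  refine forall₂_congr fun v _ => forall₂_congr fun w _ => ?_
  rw [Set.ext_iff]
  refine forall_congr' fun x => ?_
  simp only [Set.mem_sdiff, SimpleGraph.mem_neighborSet]
  tauto

/-- The edges between a module and the part of an overlapping module outside are all present or all
absent. -/
theorem adj_of_overlap {A B : Set W} (hA : IsModule H A) (hB : IsModule H B) {x z : W} (hx : x ∈ A \ B)
    (hz : z ∈ B \ A) {a b : W} (ha : a ∈ A \ B) (hb : b ∈ B) : H.Adj a b ↔ H.Adj x z := by
  rw [isModule_iff] at hA hB
  rw [H.adj_comm, hB b hb z hz.1 a ha.2, H.adj_comm]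
  exact hA a ha.1 x hx.1 z hz.2

theorem isModule_union {A B : Set W} (hA : IsModule H A) (hB : IsModule H B) (h : (A ∩ B).Nonempty) :
    IsModule H (A ∪ B) := by
  rw [isModule_iff] at *
  obtain ⟨y, hyA, hyB⟩ := h
  have : ∀ v ∈ A ∪ B, ∀ x ∉ A ∪ B, (H.Adj v x ↔ H.Adj y x) := by
    rintro v (hv | hv) x hx
    · exact hA v hv y hyA x fun h => hx (Or.inl h)
    · exact hB v hv y hyB x fun h => hx (Or.inr h)
  intro v hv w hw x hx
  rw [this v hv x hx, this w hw x hx]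

/-- The set `M` has no partition into two nonempty sets with all or no edges between them: neither
the graph induced on `M` nor its complement is disconnected. -/
def Indec (H : SimpleGraph W) (M : Set W) : Prop :=
  ∀ A ⊆ M, A.Nonempty → (M \ A).Nonempty → ∀ c : Prop, ¬ ∀ a ∈ A, ∀ b ∈ M \ A, (H.Adj a b ↔ c)

/-- A module overlapped by another module has a homogeneous partition. -/
theorem strong_of_indec {M : Set W} (hM : IsModule H M) (hi : Indec H M) : IsStrongModule H M := by
  refine ⟨hM, fun N hN => ?_⟩
  by_contra hcon
  push Not at hcon
  obtain ⟨h1, h2, h3⟩ := hcon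
  rw [Set.not_disjoint_iff] at h1
  obtain ⟨y, hyM, hyN⟩ := h1
  obtain ⟨x, hxM, hxN⟩ := Set.not_subset.1 h2
  obtain ⟨z, hzN, hzM⟩ := Set.not_subset.1 h3
  exact hi (M \ N) Set.sdiff_subset ⟨x, hxM, hxN⟩ ⟨y, hyM, fun h => h.2 hyN⟩ (H.Adj x z)
    fun a ha b hb => adj_of_overlap hM hN ⟨hxM, hxN⟩ ⟨hzN, hzM⟩ ha
      (by by_contra h; exact hb.2 ⟨hb.1, h⟩)

/-- If another module overlaps a maximal proper module, then their union is everything, which gives a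
homogeneous partition. -/
theorem maximal_module_strong (hi : Indec H Set.univ) {A : Set W}
    (hA : Maximal (fun N => IsModule H N ∧ N ≠ Set.univ) A) : IsStrongModule H A := by
  refine ⟨hA.prop.1, fun N hN => ?_⟩
  by_contra hcon
  push Not at hcon
  obtain ⟨h1, h2, h3⟩ := hcon
  rw [Set.not_disjoint_iff] at h1
  obtain ⟨y, hyM, hyN⟩ := h1
  obtain ⟨x, hxM, hxN⟩ := Set.not_subset.1 h2
  obtain ⟨z, hzN, hzM⟩ := Set.not_subset.1 h3
  have hU := isModule_union hA.prop.1 hN ⟨y, hyM, hyN⟩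
  have huniv : A ∪ N = Set.univ := by
    by_contra hne
    exact hzM (hA.le_of_ge ⟨hU, hne⟩ Set.subset_union_left (Or.inr hzN))
  refine hi (A \ N) (Set.subset_univ _) ⟨x, hxM, hxN⟩ ⟨y, trivial, fun h => h.2 hyN⟩ (H.Adj x z)
    fun a ha b hb => adj_of_overlap hA.prop.1 hN ⟨hxM, hxN⟩ ⟨hzN, hzM⟩ ha ?_
  have : b ∈ A ∪ N := huniv ▸ trivial
  rcases this with h | h
  · by_contra h'; exact hb.2 ⟨h, h'⟩
  · exact h

theorem strong_singleton (v : W) : IsStrongModule H {v} := by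
  refine ⟨fun a ha b hb => ?_, fun N _ => ?_⟩
  · rw [Set.mem_singleton_iff] at ha hb
    rw [ha, hb]
  · by_cases h : v ∈ N
    · exact Or.inr (Or.inl (by simpa using h))
    · exact Or.inl (by simpa using h)

theorem part_max {B : Set W} (hB : B ∈ canonicalPartition H) :
    Maximal (fun N => IsStrongModule H N ∧ N.Nonempty ∧ N ≠ Set.univ) B := hB

theorem part_eq_of_mem {B C : Set W} (hB : B ∈ canonicalPartition H) (hC : C ∈ canonicalPartition H)
    {v : W} (h1 : v ∈ B) (h2 : v ∈ C) : B = C := by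
  rcases (part_max hB).prop.1.2 C (part_max hC).prop.1.1 with h | h | h
  · exact absurd h2 (Set.disjoint_left.1 h h1)
  · exact subset_antisymm h ((part_max hB).le_of_ge (part_max hC).prop h)
  · exact subset_antisymm ((part_max hC).le_of_ge (part_max hB).prop h) h

theorem quotient_adj_iff {B C : canonicalPartition H} {u v : W} (hu : u ∈ B.1) (hv : v ∈ C.1)
    (hne : B ≠ C) : (quotientGraph H (canonicalPartition H)).Adj B C ↔ H.Adj u v := by
  constructor
  · rintro ⟨-, u', hu', v', hv', h⟩
    have hdisj : ∀ x ∈ B.1, x ∉ C.1 := fun x hx hx' =>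
      hne (Subtype.ext (part_eq_of_mem B.2 C.2 hx hx'))
    have h1 := (isModule_iff.1 (part_max B.2).prop.1.1 u hu u' hu' v' fun h => hdisj _ h hv').2 h
    have h2 := (isModule_iff.1 (part_max C.2).prop.1.1 v hv v' hv' u (hdisj u hu)).2 h1.symm
    exact h2.symm
  · exact fun h => ⟨hne, u, hu, v, hv, h⟩

variable [Finite W]

theorem exists_maximal_of_finite (P : Set W → Prop) {A : Set W} (hA : P A) :
    ∃ B, A ⊆ B ∧ Maximal P B := by
  obtain ⟨B, h1, h2⟩ := (Set.toFinite {B | P B}).exists_le_maximal hA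
  exact ⟨B, h1, h2⟩

theorem exists_part [Nontrivial W] (v : W) : ∃ B ∈ canonicalPartition H, v ∈ B := by
  obtain ⟨B, h1, h2⟩ := exists_maximal_of_finite
    (fun N => IsStrongModule H N ∧ N.Nonempty ∧ N ≠ Set.univ) (A := {v})
    ⟨strong_singleton v, ⟨v, rfl⟩, by
      obtain ⟨w, hw⟩ := exists_ne v
      intro h
      exact hw (by have : w ∈ ({v} : Set W) := h ▸ trivial
                   simpa using this)⟩
  exact ⟨B, h2, h1 rfl⟩

/-- Without homogeneous partitions, every proper module lies in a part. -/
theorem subset_part (hi : Indec H Set.univ) {S B : Set W} (hS : IsModule H S) (hne : S ≠ Set.univ)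
    (hB : B ∈ canonicalPartition H) {v : W} (hvS : v ∈ S) (hvB : v ∈ B) : S ⊆ B := by
  obtain ⟨A, h1, h2⟩ := exists_maximal_of_finite (fun N => IsModule H N ∧ N ≠ Set.univ) ⟨hS, hne⟩
  have h3 := maximal_module_strong hi h2
  refine h1.trans ?_
  rcases (part_max hB).prop.1.2 A h3.1 with h | h | h
  · exact absurd (h1 hvS) (Set.disjoint_left.1 h hvB)
  · exact (part_max hB).le_of_ge ⟨h3, ⟨v, h1 hvS⟩, h2.prop.2⟩ h
  · exact h

/-- Without homogeneous partitions, the quotient by the canonical partition is prime. -/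
theorem isPrime_of_indec [Nontrivial W] (hi : Indec H Set.univ) :
    IsPrime (quotientGraph H (canonicalPartition H)) := by
  intro N hN
  by_contra hcon
  push Not at hcon
  obtain ⟨h1, h2, h3⟩ := hcon
  obtain ⟨B, hB⟩ := h1
  obtain ⟨C, hC, hBC⟩ : ∃ C ∈ N, C ≠ B := by
    by_contra h
    push Not at h
    exact h3 B (Set.eq_singleton_iff_unique_mem.2 ⟨hB, h⟩)
  obtain ⟨D, hD⟩ := (Set.ne_univ_iff_exists_notMem N).1 h2
  rw [isModule_iff] at hN
  let U : Set W := {v | ∃ B ∈ N, v ∈ B.1}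
  have hU : IsModule H U := by
    rw [isModule_iff]
    rintro v ⟨B, hB, hv⟩ w ⟨C, hC, hw⟩ x hx
    obtain ⟨E, hE, hxE⟩ := exists_part (H := H) x
    have hEN : (⟨E, hE⟩ : canonicalPartition H) ∉ N := fun h => hx ⟨_, h, hxE⟩
    have hne : ∀ F ∈ N, F ≠ ⟨E, hE⟩ := by rintro F hF rfl; exact hEN hF
    rw [← quotient_adj_iff hv hxE (hne B hB), ← quotient_adj_iff hw hxE (hne C hC)]
    exact hN B hB C hC _ hEN
  have hUne : U ≠ Set.univ := by
    intro h
    obtain ⟨d, hd⟩ := (part_max D.2).prop.2.1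
    obtain ⟨E, hE, hdE⟩ : d ∈ U := h ▸ trivial
    have : D = E := Subtype.ext (part_eq_of_mem D.2 E.2 hd hdE)
    exact hD (this ▸ hE)
  obtain ⟨b, hb⟩ := (part_max B.2).prop.2.1
  obtain ⟨c, hc⟩ := (part_max C.2).prop.2.1
  have hsub := subset_part hi hU hUne B.2 ⟨B, hB, hb⟩ hb
  exact hBC (Subtype.ext (part_eq_of_mem C.2 B.2 hc (hsub ⟨C, hC, hc⟩)))

end modules

section induced
variable {V : Type} {G : SimpleGraph V} {M : Set V}

theorem indec_induce (h : Indec G M) : Indec (G.induce M) Set.univ := by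
  intro A _ hA hAc c hcon
  refine h (Subtype.val '' A) (by simp) (hA.image _) ?_ c ?_
  · obtain ⟨x, -, hx⟩ := hAc
    exact ⟨x, x.2, by simpa using hx⟩
  · rintro _ ⟨a, ha, rfl⟩ b ⟨hb, hb'⟩
    exact hcon a ha ⟨b, hb⟩ ⟨trivial, fun h => hb' ⟨_, h, rfl⟩⟩

theorem isModule_image (hM : IsModule G M) {N : Set M} (hN : IsModule (G.induce M) N) :
    IsModule G (Subtype.val '' N) := by
  rw [isModule_iff] at *
  rintro _ ⟨v, hv, rfl⟩ _ ⟨w, hw, rfl⟩ x hx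
  by_cases hxM : x ∈ M
  · exact hN v hv w hw ⟨x, hxM⟩ fun h => hx ⟨_, h, rfl⟩
  · exact hM v v.2 w w.2 x hxM

theorem isModule_preimage {S : Set V} (hS : IsModule G S) :
    IsModule (G.induce M) (Subtype.val ⁻¹' S) := by
  rw [isModule_iff] at *
  exact fun v hv w hw x hx => hS v hv w hw x hx

variable [Finite V]

/-- A connected and co-connected module with at least two vertices is a prime node. -/
theorem isPrimeNode_of_indec (hM : IsModule G M) (hne : M.Nontrivial) (hi : Indec G M) :
    IsPrimeNode G M := by
  have : Nontrivial M := Set.nontrivial_coe_sort.2 hne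
  exact ⟨strong_of_indec hM hi, hne, isPrime_of_indec (indec_induce hi)⟩

/-- Two vertices lie in the same part if and only if some module smaller than `M` contains both. -/
theorem same_part_iff (hM : IsModule G M) (hi : Indec G M) {B : Set M}
    (hB : B ∈ canonicalPartition (G.induce M)) {u v : M} (hu : u ∈ B) :
    v ∈ B ↔ ∃ S, IsModule G S ∧ S ⊂ M ∧ (u : V) ∈ S ∧ (v : V) ∈ S := by
  constructor
  · intro hv
    refine ⟨_, isModule_image hM (part_max hB).prop.1.1, ?_, ⟨u, hu, rfl⟩, ⟨v, hv, rfl⟩⟩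
    rw [Set.ssubset_iff_subset_ne]
    refine ⟨by simp, fun h => (part_max hB).prop.2.2 ?_⟩
    ext x
    simp only [Set.mem_univ, iff_true]
    have : (x : V) ∈ Subtype.val '' B := by rw [h]; exact x.2
    simpa using this
  · rintro ⟨S, hS, hSM, huS, hvS⟩
    refine subset_part (indec_induce hi) (isModule_preimage hS) ?_ hB (v := u) huS hu hvS
    intro h
    obtain ⟨x, hx, hxS⟩ := Set.exists_of_ssubset hSM
    have : (⟨x, hx⟩ : M) ∈ (Subtype.val ⁻¹' S : Set M) := h ▸ trivial
    exact hxS this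

end induced

end CVC
namespace CVC

/-! ### Correctness of splitting -/

/-- The set of vertices represented by a bit vector. -/
def vs (n : ℕ) (S : BV) : Set (Fin n) := {i | mem S i = true}

theorem mem_vs {n : ℕ} {S : BV} {i : Fin n} : i ∈ vs n S ↔ mem S i = true := Iff.rfl

theorem coe_fs (n : ℕ) (S : BV) : (fs n S : Set (Fin n)) = vs n S := by ext; simp [mem_fs, mem_vs]

theorem mem_fs_vs {n : ℕ} {S : BV} {i : Fin n} : i ∈ fs n S ↔ i ∈ vs n S := mem_fs

theorem eqV_iff {n : ℕ} {A B : BV} : eqV n A B = true ↔ vs n A = vs n B := by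
  rw [eqV_eq_true, Set.ext_iff]
  constructor
  · intro h i; rw [mem_vs, mem_vs, h i i.2]
  · intro h i hi; have := h ⟨i, hi⟩
    rw [mem_vs, mem_vs] at this
    exact Bool.eq_iff_iff.2 this

theorem vs_mkV {n : ℕ} {p : ℕ → Bool} : vs n (mkV n p) = {i : Fin n | p i = true} := by
  ext i; rw [mem_vs, mem_mkV]; simp

theorem vs_diffV {n : ℕ} (A B : BV) : vs n (diffV n A B) = vs n A \ vs n B := by
  ext i; rw [diffV, vs_mkV]; simp [mem_vs]

/-- `G` is the adjacency matrix of `H`. -/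
structure Rep {n : ℕ} (G : Gr) (H : SimpleGraph (Fin n)) : Prop where
  len : G.length = n
  adj_iff : ∀ i j : Fin n, adj G i j = true ↔ H.Adj i j
  lt : ∀ i j : ℕ, adj G i j = true → i < n ∧ j < n

theorem Rep.symm {n : ℕ} {G : Gr} {H : SimpleGraph (Fin n)} (h : Rep G H) (i j : ℕ) :
    adj G i j = adj G j i := by
  suffices ∀ i j, adj G i j = true → adj G j i = true from Bool.eq_iff_iff.2 ⟨this i j, this j i⟩
  intro i j hij
  obtain ⟨hi, hj⟩ := h.lt i j hij
  exact (h.adj_iff ⟨j, hj⟩ ⟨i, hi⟩).2 ((h.adj_iff ⟨i, hi⟩ ⟨j, hj⟩).1 hij).symm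

theorem Rep.loopless {n : ℕ} {G : Gr} {H : SimpleGraph (Fin n)} (h : Rep G H) (i : ℕ) :
    adj G i i = false := by
  by_contra hc
  rw [Bool.not_eq_false] at hc
  exact ((h.adj_iff ⟨i, (h.lt i i hc).1⟩ ⟨i, (h.lt i i hc).1⟩).1 hc).ne rfl

section closure
variable {n : ℕ} {G : Gr} {H : SimpleGraph (Fin n)}

/-- `T` is closed under the rule of `closeStep`. -/
def ClosedIn (H : SimpleGraph (Fin n)) (M : Set (Fin n)) (c1 c0 : Bool) (T : Set (Fin n)) : Prop :=
  ∀ w ∈ M, (c1 = true ∨ ∃ a ∈ T, H.Adj a w) → (c0 = true ∨ ∃ a ∈ T, ¬ H.Adj a w) → w ∈ T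

theorem mem_closeStep (h : Rep G H) {M S : BV} {c1 c0 : Bool} {w : Fin n} :
    w ∈ vs n (closeStep G M c1 c0 S) ↔ w ∈ vs n S ∨ (w ∈ vs n M ∧
      (c1 = true ∨ ∃ a ∈ vs n S, H.Adj a w) ∧ (c0 = true ∨ ∃ a ∈ vs n S, ¬ H.Adj a w)) := by
  have h1 : anyR n (fun a => mem S a && adj G a w) = true ↔ ∃ a ∈ vs n S, H.Adj a w := by
    rw [anyR_eq_true]
    constructor
    · rintro ⟨a, ha, hb⟩
      rw [Bool.and_eq_true] at hb
      exact ⟨⟨a, ha⟩, hb.1, (h.adj_iff ⟨a, ha⟩ w).1 hb.2⟩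
    · rintro ⟨a, ha, hb⟩
      exact ⟨a, a.2, by rw [Bool.and_eq_true]; exact ⟨ha, (h.adj_iff a w).2 hb⟩⟩
  have h0 : anyR n (fun a => mem S a && !adj G a w) = true ↔ ∃ a ∈ vs n S, ¬ H.Adj a w := by
    rw [anyR_eq_true]
    constructor
    · rintro ⟨a, ha, hb⟩
      rw [Bool.and_eq_true] at hb
      exact ⟨⟨a, ha⟩, hb.1, fun hc => by rw [(h.adj_iff ⟨a, ha⟩ w).2 hc] at hb; simp at hb⟩
    · rintro ⟨a, ha, hb⟩
      refine ⟨a, a.2, ?_⟩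
      rw [Bool.and_eq_true]
      refine ⟨ha, ?_⟩
      rw [Bool.not_eq_true', ← Bool.not_eq_true]
      exact fun hc => hb ((h.adj_iff a w).1 hc)
  rw [closeStep, h.len, vs_mkV, Set.mem_ofPred_eq, Bool.or_eq_true, Bool.and_eq_true, Bool.and_eq_true,
    Bool.or_eq_true, Bool.or_eq_true, h1, h0, mem_vs, mem_vs]
  tauto

/-- Iterating an inflationary operation on subsets of `Fin n` reaches a fixed point after `n`
rounds. -/
theorem iterate_fixed (f : BV → BV) (hf : ∀ S, vs n S ⊆ vs n (f S))
    (hc : ∀ S T, vs n S = vs n T → vs n (f S) = vs n (f T)) (S : BV) :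
    vs n (f (f^[n] S)) = vs n (f^[n] S) := by
  have key : ∀ i, vs n (f (f^[i] S)) = vs n (f^[i] S) ∨ i ≤ (vs n (f^[i] S)).ncard := by
    intro i
    induction i with
    | zero => exact Or.inr (Nat.zero_le _)
    | succ i ih =>
      rw [Function.iterate_succ_apply']
      rcases ih with ih | ih
      · exact Or.inl (hc _ _ ih)
      · by_cases h : vs n (f (f^[i] S)) = vs n (f^[i] S)
        · exact Or.inl (hc _ _ h)
        · exact Or.inr (lt_of_le_of_lt ih (Set.ncard_lt_ncard
            (Set.ssubset_iff_subset_ne.2 ⟨hf _, fun h' => h h'.symm⟩)))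
  rcases key n with h | h
  · exact h
  · have : vs n (f^[n] S) = Set.univ := by
      refine Set.eq_of_subset_of_ncard_le (Set.subset_univ _) ?_
      simpa [Set.ncard_univ] using h
    exact subset_antisymm (by rw [this]; exact Set.subset_univ _) (hf _)

theorem closure_eq_iterate (G : Gr) (M : BV) (c1 c0 : Bool) (S : BV) :
    closure G M c1 c0 S = (closeStep G M c1 c0)^[G.length] S := by
  unfold closure
  have : ∀ (l : List ℕ) S, l.foldl (fun S _ => closeStep G M c1 c0 S) S =
      (closeStep G M c1 c0)^[l.length] S := by
    intro l
    induction l with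
    | nil => exact fun _ => rfl
    | cons x l ih => intro S; exact ih _
  rw [this, List.length_range]

theorem subset_closure (h : Rep G H) (M : BV) (c1 c0 : Bool) (S : BV) :
    vs n S ⊆ vs n (closure G M c1 c0 S) := by
  rw [closure_eq_iterate]
  generalize G.length = m
  induction m with
  | zero => exact subset_rfl
  | succ m ih =>
    rw [Function.iterate_succ_apply']
    exact ih.trans fun w hw => (mem_closeStep h).2 (Or.inl hw)

theorem closedIn_closure (h : Rep G H) (M : BV) (c1 c0 : Bool) (S : BV) :
    ClosedIn H (vs n M) c1 c0 (vs n (closure G M c1 c0 S)) := by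
  rw [closure_eq_iterate, h.len]
  have := iterate_fixed (n := n) (closeStep G M c1 c0) (fun S w hw => (mem_closeStep h).2 (Or.inl hw))
    (fun S T hST => by ext w; rw [mem_closeStep h, mem_closeStep h, hST]) S
  intro w hw h1 h0
  rw [← this]
  exact (mem_closeStep h).2 (Or.inr ⟨hw, h1, h0⟩)

theorem closure_subset (h : Rep G H) {M : BV} {c1 c0 : Bool} {S : BV} {T : Set (Fin n)}
    (hST : vs n S ⊆ T) (hT : ClosedIn H (vs n M) c1 c0 T) : vs n (closure G M c1 c0 S) ⊆ T := by
  rw [closure_eq_iterate]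
  generalize G.length = m
  induction m with
  | zero => exact hST
  | succ m ih =>
    rw [Function.iterate_succ_apply']
    intro w hw
    rcases (mem_closeStep h).1 hw with hw | ⟨hw, h1, h0⟩
    · exact ih hw
    · exact hT w hw (h1.imp_right fun ⟨a, ha, hb⟩ => ⟨a, ih ha, hb⟩)
        (h0.imp_right fun ⟨a, ha, hb⟩ => ⟨a, ih ha, hb⟩)

theorem firstV_mem {S : BV} (hS : (vs n S).Nonempty) :
    ∃ i : Fin n, (i : ℕ) = firstV n S ∧ i ∈ vs n S ∧ ∀ j ∈ vs n S, i ≤ j := by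
  obtain ⟨x, hx⟩ := hS
  have hx' : (x : ℕ) ∈ elems n S := mem_elems.2 ⟨x.2, hx⟩
  have hsorted : (elems n S).Pairwise (· < ·) := List.pairwise_lt_range.filter _
  unfold firstV
  cases hc : elems n S with
  | nil => rw [hc] at hx'; simp at hx'
  | cons a l =>
    rw [hc] at hsorted
    have ha : a ∈ elems n S := by rw [hc]; simp
    obtain ⟨h1, h2⟩ := mem_elems.1 ha
    refine ⟨⟨a, h1⟩, rfl, h2, fun j hj => ?_⟩
    have hj' : (j : ℕ) ∈ elems n S := mem_elems.2 ⟨j.2, hj⟩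
    rw [hc, List.mem_cons] at hj'
    rcases hj' with h | h
    · exact le_of_eq (Fin.ext h.symm)
    · exact le_of_lt ((List.pairwise_cons.1 hsorted).1 _ h)

theorem vs_first {M : BV} {i : Fin n} (hi : (i : ℕ) = firstV n M) :
    vs n (mkV n fun j => j == firstV n M) = {i} := by
  ext j; rw [vs_mkV, ← hi]; simp [Fin.ext_iff]

theorem firstComp_subset (h : Rep G H) {M : BV} (hne : (vs n M).Nonempty) (c1 c0 : Bool) :
    vs n (firstComp G M c1 c0) ⊆ vs n M := by
  obtain ⟨i, h1, h2, -⟩ := firstV_mem hne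
  rw [firstComp, h.len]
  exact closure_subset h (by rw [vs_first h1]; simpa using h2) (fun w hw _ _ => hw)

theorem firstComp_nonempty (h : Rep G H) {M : BV} (hne : (vs n M).Nonempty) (c1 c0 : Bool) :
    (vs n (firstComp G M c1 c0)).Nonempty := by
  obtain ⟨i, h1, h2, -⟩ := firstV_mem hne
  rw [firstComp, h.len]
  exact ⟨i, subset_closure h _ _ _ _ (by rw [vs_first h1]; rfl)⟩

theorem firstComp_homogeneous_false (h : Rep G H) {M : BV} {a b : Fin n}
    (ha : a ∈ vs n (firstComp G M false true)) (hb : b ∈ vs n M \ vs n (firstComp G M false true)) :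
    ¬ H.Adj a b := fun hab =>
  hb.2 (closedIn_closure h M false true _ b hb.1 (Or.inr ⟨a, ha, hab⟩) (Or.inl rfl))

theorem firstComp_homogeneous_true (h : Rep G H) {M : BV} {a b : Fin n}
    (ha : a ∈ vs n (firstComp G M true false)) (hb : b ∈ vs n M \ vs n (firstComp G M true false)) :
    H.Adj a b := by
  by_contra hab
  exact hb.2 (closedIn_closure h M true false _ b hb.1 (Or.inl rfl) (Or.inr ⟨a, ha, hab⟩))

/-- If the component of the first vertex is everything, then so is every nonempty
subset that is closed together with its complement. -/
theorem firstComp_eq_of_closed (h : Rep G H) {M : BV} {c1 c0 : Bool}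
    (he : vs n (firstComp G M c1 c0) = vs n M) {A : Set (Fin n)} (hA : A ⊆ vs n M) (hne : A.Nonempty)
    (hc : ClosedIn H (vs n M) c1 c0 A) (hd : ClosedIn H (vs n M) c1 c0 (vs n M \ A)) : A = vs n M := by
  obtain ⟨i, h1, h2, -⟩ := firstV_mem (hne.mono hA)
  rw [firstComp, h.len] at he
  by_cases hi : i ∈ A
  · exact subset_antisymm hA (he ▸ closure_subset h (by rw [vs_first h1]; simpa using hi) hc)
  · have := closure_subset h (by rw [vs_first h1]; simpa using ⟨h2, hi⟩) hd
    rw [he] at this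
    obtain ⟨x, hx⟩ := hne
    exact absurd hx (this (hA hx)).2

/-- If `M` is connected and co-connected, then it has no homogeneous partition. -/
theorem indec_of_firstComp (h : Rep G H) {M : BV} (h1 : vs n (firstComp G M false true) = vs n M)
    (h2 : vs n (firstComp G M true false) = vs n M) : Indec H (vs n M) := by
  intro A hA hne hne' c hhom
  have hAM : A ≠ vs n M := by rintro rfl; simp at hne'
  by_cases hc : c
  · refine hAM (firstComp_eq_of_closed h h2 hA hne (fun w hw _ h0 => ?_) (fun w hw _ h0 => ?_))
    · simp only [Bool.false_eq_true, false_or] at h0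
      obtain ⟨a, ha, hb⟩ := h0
      by_contra hwA
      exact hb ((hhom a ha w ⟨hw, hwA⟩).2 hc)
    · simp only [Bool.false_eq_true, false_or] at h0
      obtain ⟨a, ha, hb⟩ := h0
      exact ⟨hw, fun hwA => hb ((hhom w hwA a ha).2 hc).symm⟩
  · refine hAM (firstComp_eq_of_closed h h1 hA hne (fun w hw h0 _ => ?_) (fun w hw h0 _ => ?_))
    · simp only [Bool.false_eq_true, false_or] at h0
      obtain ⟨a, ha, hb⟩ := h0
      by_contra hwA
      exact hc ((hhom a ha w ⟨hw, hwA⟩).1 hb)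
    · simp only [Bool.false_eq_true, false_or] at h0
      obtain ⟨a, ha, hb⟩ := h0
      exact ⟨hw, fun hwA => hc ((hhom w hwA a ha).1 hb.symm)⟩

/-- The closure of two vertices of a module is the smallest module that contains them. -/
theorem closure_ne_iff (h : Rep G H) {M : BV} (hM : IsModule H (vs n M)) {u v : Fin n}
    (hu : u ∈ vs n M) (hv : v ∈ vs n M) :
    vs n (closure G M false false (mkV n fun i => i == u || i == v)) ≠ vs n M ↔
      ∃ S, IsModule H S ∧ S ⊂ vs n M ∧ u ∈ S ∧ v ∈ S := by
  have hpair : vs n (mkV n fun i => i == u || i == v) = {u, v} := by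
    ext j; rw [vs_mkV]; simp [Fin.ext_iff]
  have hcl : ∀ S, IsModule H S → ClosedIn H (vs n M) false false S := by
    intro S hS w hw h1 h0
    simp only [Bool.false_eq_true, false_or] at h1 h0
    obtain ⟨a, ha, ha'⟩ := h1
    obtain ⟨b, hb, hb'⟩ := h0
    by_contra hwS
    exact hb' ((isModule_iff.1 hS a ha b hb w hwS).1 ha')
  have hsub : vs n (closure G M false false (mkV n fun i => i == u || i == v)) ⊆ vs n M :=
    closure_subset h (by rw [hpair]; rintro x (rfl | rfl) <;> assumption) (hcl _ hM)
  constructor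
  · intro hne
    have hin := subset_closure h M false false (mkV n fun i => i == u || i == v)
    rw [hpair] at hin
    refine ⟨_, isModule_iff.2 fun a ha b hb x hx => ?_, Set.ssubset_iff_subset_ne.2 ⟨hsub, hne⟩,
      hin (by simp), hin (by simp)⟩
    by_cases hxM : x ∈ vs n M
    · by_contra hcon
      have := closedIn_closure h M false false (mkV n fun i => i == u || i == v) x hxM
      refine hx (this (Or.inr ?_) (Or.inr ?_))
      · by_cases h' : H.Adj a x
        · exact ⟨a, ha, h'⟩
        · exact ⟨b, hb, by tauto⟩
      · by_cases h' : H.Adj a x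
        · exact ⟨b, hb, by tauto⟩
        · exact ⟨a, ha, h'⟩
    · exact isModule_iff.1 hM a (hsub ha) b (hsub hb) x hxM
  · rintro ⟨S, hS, hSM, huS, hvS⟩ he
    have := closure_subset h (S := mkV n fun i => i == u || i == v)
      (by rw [hpair]; rintro x (rfl | rfl) <;> assumption) (hcl _ hS)
    rw [he] at this
    exact hSM.2 this

end closure

/-! ### The partition of a module -/

/-- The sets `P u` for `u` in `M` form a partition of `M` into proper submodules. -/
structure Split {n : ℕ} (H : SimpleGraph (Fin n)) (M : Set (Fin n)) (P : Fin n → Set (Fin n)) :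
    Prop where
  mem_self : ∀ u ∈ M, u ∈ P u
  sub : ∀ u ∈ M, P u ⊆ M
  eq_of_mem : ∀ u ∈ M, ∀ v ∈ P u, P v = P u
  isModule : ∀ u ∈ M, IsModule H (P u)
  ne : ∀ u ∈ M, P u ≠ M

section split
variable {n : ℕ} {G : Gr} {H : SimpleGraph (Fin n)}

theorem vs_biPart (h : Rep G H) (M C : BV) (u : Fin n) [Decidable (u ∈ vs n C)] :
    vs n (biPart G M C u) = if u ∈ vs n C then vs n C else vs n M \ vs n C := by
  unfold biPart
  by_cases hu : u ∈ vs n C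
  · rw [if_pos hu, mem_vs.1 hu]; rfl
  · rw [if_neg hu]
    rw [mem_vs, Bool.not_eq_true] at hu
    rw [hu, h.len]
    exact vs_diffV _ _

/-- A homogeneous partition into two sets. -/
theorem split_biPart (h : Rep G H) {M C : BV} (hM : IsModule H (vs n M)) (hC : vs n C ⊆ vs n M)
    (hne : (vs n C).Nonempty) (hCM : vs n C ≠ vs n M) (c : Prop)
    (hhom : ∀ a ∈ vs n C, ∀ b ∈ vs n M \ vs n C, (H.Adj a b ↔ c)) :
    Split H (vs n M) fun u => vs n (biPart G M C u) := by
  classical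
  rw [isModule_iff] at hM
  refine ⟨?_, ?_, ?_, ?_, ?_⟩ <;> intro u hu <;> simp only [vs_biPart h] <;>
    by_cases huC : u ∈ vs n C
  · simp [huC]
  · simp [huC, hu]
  · simpa only [huC, if_true] using hC
  · simp [huC]
  · simp +contextual [huC]
  · simp +contextual [huC]
  · simp only [huC, if_true]
    rw [isModule_iff]
    intro v hv w hw x hx
    by_cases hxM : x ∈ vs n M
    · rw [hhom v hv x ⟨hxM, hx⟩, hhom w hw x ⟨hxM, hx⟩]
    · exact hM v (hC hv) w (hC hw) x hxM
  · simp only [huC, if_false]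
    rw [isModule_iff]
    intro v hv w hw x hx
    by_cases hxM : x ∈ vs n M
    · have hxC : x ∈ vs n C := by by_contra h'; exact hx ⟨hxM, h'⟩
      rw [H.adj_comm v, H.adj_comm w, hhom x hxC v hv, hhom x hxC w hw]
    · exact hM v hv.1 w hw.1 x hxM
  · simpa [huC] using hCM
  · simp only [huC, if_false]
    obtain ⟨x, hx⟩ := hne
    intro he
    exact (he.symm ▸ hC hx : x ∈ vs n M \ vs n C).2 hx

/-- At a connected and co-connected module, `part` computes the canonical partition. -/
theorem vs_part_prime (h : Rep G H) {M : BV} (hM : IsModule H (vs n M))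
    (h1 : vs n (firstComp G M false true) = vs n M) (h2 : vs n (firstComp G M true false) = vs n M)
    {u : Fin n} (hu : u ∈ vs n M) {B : Set (vs n M)} (hB : B ∈ canonicalPartition (H.induce (vs n M)))
    (huB : ⟨u, hu⟩ ∈ B) : vs n (part G M u) = Subtype.val '' B := by
  unfold part
  rw [h.len, eqV_iff.2 h1, eqV_iff.2 h2]
  simp only [Bool.not_true, cond_false]
  rw [vs_mkV]
  ext v
  rw [Set.mem_ofPred_eq, Bool.and_eq_true, ← mem_vs, Bool.not_eq_true', ← Bool.not_eq_true, eqV_iff]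
  constructor
  · rintro ⟨hv, h3⟩
    have := (same_part_iff hM (indec_of_firstComp h h1 h2) hB (v := ⟨v, hv⟩) huB).2
      ((closure_ne_iff h hM hu hv).1 h3)
    exact ⟨_, this, rfl⟩
  · rintro ⟨⟨v, hv⟩, hvB, rfl⟩
    exact ⟨hv, (closure_ne_iff h hM hu hv).2
      ((same_part_iff hM (indec_of_firstComp h h1 h2) hB (v := ⟨v, hv⟩) huB).1 hvB)⟩

/-- The sets computed by `part` form a partition into proper submodules. -/
theorem split_part (h : Rep G H) {M : BV} (hM : IsModule H (vs n M)) (hnt : (vs n M).Nontrivial) :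
    Split H (vs n M) fun u => vs n (part G M u) := by
  have hne := hnt.nonempty
  by_cases h1 : vs n (firstComp G M false true) = vs n M
  · by_cases h2 : vs n (firstComp G M true false) = vs n M
    · have : Nontrivial (vs n M) := Set.nontrivial_coe_sort.2 hnt
      have key : ∀ u (hu : u ∈ vs n M), ∃ B ∈ canonicalPartition (H.induce (vs n M)), ⟨u, hu⟩ ∈ B ∧
          vs n (part G M u) = Subtype.val '' B := by
        intro u hu
        obtain ⟨B, hB, huB⟩ := exists_part (H := H.induce (vs n M)) ⟨u, hu⟩
        exact ⟨B, hB, huB, vs_part_prime h hM h1 h2 hu hB huB⟩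
      refine ⟨?_, ?_, ?_, ?_, ?_⟩ <;> intro u hu <;> obtain ⟨B, hB, huB, he⟩ := key u hu <;>
        simp only [he]
      · exact ⟨_, huB, rfl⟩
      · simp
      · rintro _ ⟨⟨v, hv⟩, hvB, rfl⟩
        exact vs_part_prime h hM h1 h2 hv hB hvB
      · exact isModule_image hM (part_max hB).prop.1.1
      · intro heq
        refine (part_max hB).prop.2.2 (Set.eq_univ_of_forall fun x => ?_)
        have : (x : Fin n) ∈ Subtype.val '' B := by rw [heq]; exact x.2
        simpa using this
    · have : ∀ u : ℕ, part G M u = biPart G M (firstComp G M true false) u := by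
        intro u
        unfold part
        rw [h.len, eqV_iff.2 h1, (Bool.eq_false_iff.2 fun h' => h2 (eqV_iff.1 h'))]
        rfl
      simp only [this]
      exact split_biPart h hM (firstComp_subset h hne _ _) (firstComp_nonempty h hne _ _) h2 True
        fun a ha b hb => iff_true_intro (firstComp_homogeneous_true h ha hb)
  · have : ∀ u : ℕ, part G M u = biPart G M (firstComp G M false true) u := by
      intro u
      unfold part
      rw [h.len, (Bool.eq_false_iff.2 fun h' => h1 (eqV_iff.1 h'))]
      rfl
    simp only [this]
    exact split_biPart h hM (firstComp_subset h hne _ _) (firstComp_nonempty h hne _ _) h1 False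
      fun a ha b hb => iff_false_intro (firstComp_homogeneous_false h ha hb)

/-- The representative of a part is its least element. -/
theorem mem_reps (h : Rep G H) {M : BV} {u : Fin n} (hP : Split H (vs n M) fun u => vs n (part G M u)) :
    u ∈ fs n (reps G M) ↔ u ∈ vs n M ∧ ∀ v ∈ vs n (part G M u), u ≤ v := by
  rw [mem_fs_vs, reps, h.len, vs_mkV, Set.mem_ofPred_eq, Bool.and_eq_true, ← mem_vs]
  refine and_congr_right fun hu => ?_
  obtain ⟨i, h1, h2, h3⟩ := firstV_mem ⟨u, hP.mem_self u hu⟩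
  rw [← h1, beq_iff_eq]
  constructor
  · intro he
    obtain rfl : i = u := Fin.ext he
    exact h3
  · intro hall
    exact congrArg Fin.val (le_antisymm (h3 u (hP.mem_self u hu)) (hall i h2))

theorem exists_rep (h : Rep G H) {M : BV} (hP : Split H (vs n M) fun u => vs n (part G M u))
    {u : Fin n} (hu : u ∈ vs n M) : ∃ r ∈ fs n (reps G M), u ∈ vs n (part G M r) := by
  obtain ⟨i, h1, h2, h3⟩ := firstV_mem ⟨u, hP.mem_self u hu⟩
  have he := hP.eq_of_mem u hu i h2
  have hi := hP.sub u hu h2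
  refine ⟨i, (mem_reps h hP).2 ⟨hi, by rw [he]; exact h3⟩, ?_⟩
  rw [he]; exact hP.mem_self u hu

theorem rep_unique (h : Rep G H) {M : BV} (hP : Split H (vs n M) fun u => vs n (part G M u))
    {r s u : Fin n} (hr : r ∈ fs n (reps G M)) (hs : s ∈ fs n (reps G M))
    (h1 : u ∈ vs n (part G M r)) (h2 : u ∈ vs n (part G M s)) : r = s := by
  rw [mem_reps h hP] at hr hs
  have e1 := hP.eq_of_mem r hr.1 u h1
  have e2 := hP.eq_of_mem s hs.1 u h2
  have e3 := e1.symm.trans e2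
  refine le_antisymm (hr.2 s ?_) (hs.2 r ?_)
  · rw [e3]; exact hP.mem_self s hs.1
  · rw [← e3]; exact hP.mem_self r hr.1

end split

/-! ### The bags -/

/-- `dec` lists tree decompositions of width at most `k` of the quotients at all prime nodes. -/
structure RepDec {n : ℕ} (H : SimpleGraph (Fin n)) (dec : Dec) (k : ℕ) : Prop where
  exists_mem : ∀ M, IsPrimeNode H M → ∃ d ∈ dec, vs n d.1 = M
  bags_eq : ∀ d ∈ dec, ∃ M, vs n d.1 = M ∧ ∃ D : TreeDecomposition (nodeQuotient H M), D.width ≤ k ∧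
    d.2.2.map (vs n) = List.ofFn fun t => {v | ∃ B ∈ D.bag t, ∃ h : v ∈ M, ⟨v, h⟩ ∈ B.1}

section bags
variable {n : ℕ} {G : Gr} {H : SimpleGraph (Fin n)}

theorem part_injOn (h : Rep G H) {M : BV} (hP : Split H (vs n M) fun u => vs n (part G M u)) :
    Set.InjOn (fun u : Fin n => vs n (part G M u)) (fs n (reps G M)) := by
  intro u hu v hv he
  have hu' := ((mem_reps h hP).1 hu).1
  exact rep_unique h hP hu hv (hP.mem_self u hu') (by
    simp only at he; rw [← he]; exact hP.mem_self u hu')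

/-- With two parts, a single bag does. -/
theorem bagOK_biPart (h : Rep G H) {M C : BV} {dec : Dec} (k : ℕ)
    (hP : Split H (vs n M) fun u => vs n (part G M u))
    (hpart : ∀ u : ℕ, part G M u = biPart G M C u) (hbags : bags G dec M = [M]) :
    BagOK n G (bags G dec M) (fs n (reps G M)) (k + 1) := by
  classical
  have hsub : ∀ u ∈ fs n (reps G M), mem M u = true := fun u hu => ((mem_reps h hP).1 hu).1
  rw [hbags]
  refine ⟨fun u hu w hw _ => ⟨M, by simp, hsub u hu, hsub w hw⟩, ?_, ?_⟩
  · rintro S hS ⟨v, hv⟩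
    refine ⟨v, hv, M, by simp, hsub v (hS hv), ?_⟩
    simp +contextual
  · intro t _
    refine (Finset.card_le_card Finset.inter_subset_left).trans ?_
    rw [← Finset.card_image_of_injOn (part_injOn h hP)]
    refine (Finset.card_le_card (t := {vs n C, vs n M \ vs n C}) ?_).trans
      (Finset.card_le_two.trans (by omega))
    intro X hX
    obtain ⟨u, -, rfl⟩ := Finset.mem_image.1 hX
    simp only [hpart, vs_biPart h]
    by_cases hu : u ∈ vs n C <;> simp [hu]

/-- The given tree decomposition of the quotient at a prime node, read as bags of representatives.
-/
theorem bagOK_prime (h : Rep G H) {M : BV} (hM : IsModule H (vs n M))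
    (h1 : vs n (firstComp G M false true) = vs n M) (h2 : vs n (firstComp G M true false) = vs n M)
    (hnt : (vs n M).Nontrivial) {B : List BV} {k : ℕ}
    (D : TreeDecomposition (nodeQuotient H (vs n M))) (hk : D.width ≤ k) (hB : B.map (vs n) =
      List.ofFn fun t => {v | ∃ A ∈ D.bag t, ∃ h : v ∈ vs n M, ⟨v, h⟩ ∈ A.1}) :
    BagOK n G B (fs n (reps G M)) (k + 1) := by
  classical
  have hP := split_part h hM hnt
  have : Nontrivial (vs n M) := Set.nontrivial_coe_sort.2 hnt
  have hsub : ∀ u ∈ fs n (reps G M), u ∈ vs n M := fun u hu => ((mem_reps h hP).1 hu).1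
  -- the part of a vertex as a vertex of the quotient
  have key : ∀ u, ∃ A : canonicalPartition (H.induce (vs n M)), ∀ hu : u ∈ vs n M, ⟨u, hu⟩ ∈ A.1 ∧
      vs n (part G M u) = Subtype.val '' A.1 := by
    intro u
    by_cases hu : u ∈ vs n M
    · obtain ⟨B, hB, huB⟩ := exists_part (H := H.induce (vs n M)) ⟨u, hu⟩
      exact ⟨⟨B, hB⟩, fun _ => ⟨huB, vs_part_prime h hM h1 h2 hu hB huB⟩⟩
    · obtain ⟨x, hx⟩ := hnt.nonempty
      obtain ⟨B, hB, -⟩ := exists_part (H := H.induce (vs n M)) ⟨x, hx⟩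
      exact ⟨⟨B, hB⟩, fun h => absurd h hu⟩
  choose pt hpt using key
  have hpt1 : ∀ u (hu : u ∈ vs n M), ⟨u, hu⟩ ∈ (pt u).1 := fun u hu => (hpt u hu).1
  have hpt2 : ∀ u (hu : u ∈ vs n M), vs n (part G M u) = Subtype.val '' (pt u).1 :=
    fun u hu => (hpt u hu).2
  have hbag : ∀ t ∈ B, ∃ i, ∀ u ∈ vs n M, mem t u = true ↔ pt u ∈ D.bag i := by
    intro t ht
    have : vs n t ∈ B.map (vs n) := List.mem_map_of_mem ht
    rw [hB, List.mem_ofFn] at this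
    obtain ⟨i, hi⟩ := this
    refine ⟨i, fun u hu => ?_⟩
    rw [← mem_vs, ← hi]
    constructor
    · rintro ⟨A, hA, hu', huA⟩
      rwa [Subtype.ext (part_eq_of_mem (pt u).2 A.2 (hpt1 u hu) huA)]
    · exact fun hA => ⟨_, hA, hu, hpt1 u hu⟩
  have hbag' : ∀ i, ∃ t ∈ B, ∀ u ∈ vs n M, mem t u = true ↔ pt u ∈ D.bag i := by
    intro i
    have : {v | ∃ A ∈ D.bag i, ∃ h : v ∈ vs n M, ⟨v, h⟩ ∈ A.1} ∈ B.map (vs n) := by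
      rw [hB, List.mem_ofFn]; exact ⟨i, rfl⟩
    obtain ⟨t, ht, hi⟩ := List.mem_map.1 this
    refine ⟨t, ht, fun u hu => ?_⟩
    rw [← mem_vs, hi]
    constructor
    · rintro ⟨A, hA, hu', huA⟩
      rwa [Subtype.ext (part_eq_of_mem (pt u).2 A.2 (hpt1 u hu) huA)]
    · exact fun hA => ⟨_, hA, hu, hpt1 u hu⟩
  refine ⟨?_, ?_, ?_⟩
  · -- adjacent representatives lie in different parts, which are adjacent in the quotient
    intro u hu w hw hadj
    have hadj' := (h.adj_iff u w).1 hadj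
    have hne : pt u ≠ pt w := by
      intro he
      refine hadj'.ne (part_injOn h hP hu hw ?_)
      simp only [hpt2 u (hsub u hu), hpt2 w (hsub w hw), he]
    obtain ⟨i, hi1, hi2⟩ := D.edge_mem (pt u) (pt w)
      ((quotient_adj_iff (hpt1 u (hsub u hu)) (hpt1 w (hsub w hw)) hne).2 hadj')
    obtain ⟨t, ht, hiff⟩ := hbag' i
    exact ⟨t, ht, (hiff u (hsub u hu)).2 hi1, (hiff w (hsub w hw)).2 hi2⟩
  · intro S hS hne
    obtain ⟨v, hv, i, -, h3, h4⟩ := exists_pick D.isTree (fun i u => pt u ∈ D.bag i) (S : Set (Fin n))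
      hne Finset.univ (fun v _ => by
        obtain ⟨i, hi⟩ := D.vertex_mem (pt v)
        exact ⟨i, Finset.mem_univ _, hi⟩) (fun v _ => by
        have := connIn_of_preconnected (D.connected (pt v)).preconnected
        simpa using this)
    obtain ⟨t, ht, hiff⟩ := hbag' i
    refine ⟨v, hv, t, ht, (hiff v (hsub v (hS hv))).2 h3, fun t' ht' h5 u hu h6 => ?_⟩
    obtain ⟨i', hi'⟩ := hbag t' ht'
    exact (hiff u (hsub u (hS hu))).2 (h4 i' (Finset.mem_univ _) ((hi' v (hsub v (hS hv))).1 h5) u hu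
      ((hi' u (hsub u (hS hu))).1 h6))
  · intro t ht
    obtain ⟨i, hi⟩ := hbag t ht
    have hcard : (D.bag i).card ≤ k + 1 := by
      have := Finset.le_sup (f := fun t => (D.bag t).card) (Finset.mem_univ i)
      unfold TreeDecomposition.width at hk
      omega
    refine le_trans (Finset.card_le_card_of_injOn pt (t := D.bag i) ?_ ?_) (hcard.trans (by omega))
    · intro u hu
      rw [Finset.mem_coe, Finset.mem_inter, mem_fs (S := t)] at hu
      exact (hi u (hsub u hu.1)).1 hu.2
    · intro u hu w hw he
      rw [Finset.mem_coe, Finset.mem_inter] at hu hw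
      refine part_injOn h hP hu.1 hw.1 ?_
      simp only [hpt2 u (hsub u hu.1), hpt2 w (hsub w hw.1), he]

/-- The bags used at a module make elimination cheap. Bags of a split into two parts have two
representatives even if `k` is zero, hence the bound `k + 1`. -/
theorem bagOK_bags (h : Rep G H) {M : BV} (hM : IsModule H (vs n M)) (hnt : (vs n M).Nontrivial)
    {dec : Dec} {k : ℕ} (hdec : RepDec H dec k) :
    BagOK n G (bags G dec M) (fs n (reps G M)) (k + 1) := by
  have hP := split_part h hM hnt
  by_cases h1 : vs n (firstComp G M false true) = vs n M
  · by_cases h2 : vs n (firstComp G M true false) = vs n M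
    · obtain ⟨d, hd, hdM⟩ := hdec.exists_mem _ (isPrimeNode_of_indec hM hnt (indec_of_firstComp h h1 h2))
      obtain ⟨d', hd', hdM', hb⟩ : ∃ d' ∈ dec, vs n d'.1 = vs n M ∧ bags G dec M = d'.2.2 := by
        unfold bags
        rw [h.len, eqV_iff.2 h1, eqV_iff.2 h2]
        simp only [Bool.not_true, Bool.or_false, cond_false]
        cases hc : dec.filter fun d => eqV n d.1 M with
        | nil =>
          have : d ∈ dec.filter fun d => eqV n d.1 M := List.mem_filter.2 ⟨hd, eqV_iff.2 hdM⟩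
          rw [hc] at this; simp at this
        | cons d' l =>
          have : d' ∈ dec.filter fun d => eqV n d.1 M := by rw [hc]; simp
          obtain ⟨h3, h4⟩ := List.mem_filter.1 this
          exact ⟨d', h3, eqV_iff.1 h4, rfl⟩
      obtain ⟨N, hN, D, hk, hB⟩ := hdec.bags_eq d' hd'
      obtain rfl : N = vs n M := hN.symm.trans hdM'
      rw [hb]
      exact bagOK_prime h hM h1 h2 hnt D hk hB
    · refine bagOK_biPart h k hP (C := firstComp G M true false) (fun u => ?_) ?_
      · unfold part
        rw [h.len, eqV_iff.2 h1, (Bool.eq_false_iff.2 fun h' => h2 (eqV_iff.1 h'))]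
        rfl
      · unfold bags
        rw [h.len, eqV_iff.2 h1, (Bool.eq_false_iff.2 fun h' => h2 (eqV_iff.1 h'))]
        rfl
  · refine bagOK_biPart h k hP (C := firstComp G M false true) (fun u => ?_) ?_
    · unfold part
      rw [h.len, (Bool.eq_false_iff.2 fun h' => h1 (eqV_iff.1 h'))]
      rfl
    · unfold bags
      rw [h.len, (Bool.eq_false_iff.2 fun h' => h1 (eqV_iff.1 h'))]
      rfl

end bags

end CVC
namespace CVC

/-! ### Sums over vertex covers -/

section combinatorics
open Classical

variable {n : ℕ} {H : SimpleGraph (Fin n)} {A : Type*} [CommRing A]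

/-- `Y` covers the edges of `H[M]`. -/
def Covers (H : SimpleGraph (Fin n)) (M Y : Finset (Fin n)) : Prop :=
  ∀ u ∈ M, ∀ v ∈ M, H.Adj u v → u ∈ Y ∨ v ∈ Y

/-- The sum of the weights of the vertex covers of `H[M]`. -/
noncomputable def coverSum (H : SimpleGraph (Fin n)) (x : Fin n → A) (M : Finset (Fin n)) : A :=
  ∑ Y ∈ M.powerset, if Covers H M Y then ∏ v ∈ Y, x v else 0

theorem covers_self (M : Finset (Fin n)) : Covers H M M := fun _ hu _ _ _ => Or.inl hu

/-- The sets `P r` for the representatives `r` in `R` form a partition of `M` into modules. -/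
structure Parts (H : SimpleGraph (Fin n)) (M R : Finset (Fin n)) (P : Fin n → Finset (Fin n)) :
    Prop where
  disj : ∀ r ∈ R, ∀ s ∈ R, ∀ u ∈ P r, u ∈ P s → r = s
  union : R.biUnion P = M
  self : ∀ r ∈ R, r ∈ P r
  isModule : ∀ r ∈ R, IsModule H (P r : Set (Fin n))

variable {M R : Finset (Fin n)} {P : Fin n → Finset (Fin n)}

theorem Parts.sub (hP : Parts H M R P) {r : Fin n} (hr : r ∈ R) : P r ⊆ M := by
  rw [← hP.union]; exact Finset.subset_biUnion_of_mem P hr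

theorem Parts.exists_mem (hP : Parts H M R P) {u : Fin n} (hu : u ∈ M) : ∃ r ∈ R, u ∈ P r := by
  rw [← hP.union] at hu; simpa using hu

/-- Edges between different parts are determined by the representatives. -/
theorem Parts.adj_iff (hP : Parts H M R P) {r s u v : Fin n} (hr : r ∈ R) (hs : s ∈ R) (hrs : r ≠ s)
    (hu : u ∈ P r) (hv : v ∈ P s) : H.Adj u v ↔ H.Adj r s := by
  have h1 := isModule_iff.1 (hP.isModule r hr) u hu r (hP.self r hr) v
    fun h => hrs (hP.disj r hr s hs v h hv)
  have h2 := isModule_iff.1 (hP.isModule s hs) v hv s (hP.self s hs) r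
    fun h => hrs (hP.disj r hr s hs r (hP.self r hr) h)
  rw [h1, H.adj_comm, h2, H.adj_comm]

/-- A set covers the edges of a module if and only if it covers the edges of all parts, and of two
adjacent parts, contains at least one. -/
theorem Parts.covers_iff (hP : Parts H M R P) {X : Finset (Fin n)} : Covers H M X ↔
    (∀ r ∈ R, Covers H (P r) (X ∩ P r)) ∧
      ∀ r ∈ R, ∀ s ∈ R, H.Adj r s → X ∩ P r = P r ∨ X ∩ P s = P s := by
  constructor
  · intro h
    refine ⟨fun r hr u hu v hv huv => ?_, fun r hr s hs hrs => ?_⟩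
    · simpa [hu, hv] using h u (hP.sub hr hu) v (hP.sub hr hv) huv
    · by_contra hcon
      push Not at hcon
      simp only [ne_eq, Finset.inter_eq_right] at hcon
      obtain ⟨h1, h2⟩ := hcon
      obtain ⟨u, hu, huX⟩ := Finset.not_subset.1 h1
      obtain ⟨v, hv, hvX⟩ := Finset.not_subset.1 h2
      rcases h u (hP.sub hr hu) v (hP.sub hs hv) ((hP.adj_iff hr hs hrs.ne hu hv).2 hrs) with h | h
      · exact huX h
      · exact hvX h
  · rintro ⟨h1, h2⟩ u hu v hv huv
    obtain ⟨r, hr, hur⟩ := hP.exists_mem hu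
    obtain ⟨s, hs, hvs⟩ := hP.exists_mem hv
    by_cases hrs : r = s
    · subst hrs
      exact (h1 r hr u hur v hvs huv).imp (fun h => (Finset.mem_inter.1 h).1)
        (fun h => (Finset.mem_inter.1 h).1)
    · rcases h2 r hr s hs ((hP.adj_iff hr hs hrs hur hvs).1 huv) with h | h
      · rw [← h] at hur; exact Or.inl (Finset.mem_inter.1 hur).1
      · rw [← h] at hvs; exact Or.inr (Finset.mem_inter.1 hvs).1

theorem sum_powerset_union {B : Type*} [AddCommMonoid B] {S T : Finset (Fin n)} (h : Disjoint S T)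
    (F : Finset (Fin n) → B) : ∑ X ∈ (S ∪ T).powerset, F X =
      ∑ Y ∈ S.powerset, ∑ Z ∈ T.powerset, F (Y ∪ Z) := by
  rw [← Finset.sum_product']
  refine Finset.sum_nbij' (fun X => (X ∩ S, X ∩ T)) (fun p => p.1 ∪ p.2) ?_ ?_ ?_ ?_ ?_
  · intro X _; simp
  · rintro ⟨Y, Z⟩ hYZ
    simp only [Finset.mem_product, Finset.mem_powerset] at hYZ ⊢
    exact Finset.union_subset_union hYZ.1 hYZ.2
  · intro X hX
    rw [Finset.mem_powerset] at hX
    rw [← Finset.inter_union_distrib_left, Finset.inter_eq_left.2 hX]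
  · rintro ⟨Y, Z⟩ hYZ
    simp only [Finset.mem_product, Finset.mem_powerset] at hYZ
    rw [Prod.mk.injEq, Finset.union_inter_distrib_right, Finset.union_inter_distrib_right,
      Finset.inter_eq_left.2 hYZ.1, Finset.inter_eq_left.2 hYZ.2,
      Finset.disjoint_iff_inter_eq_empty.1 (h.mono_left hYZ.1),
      Finset.disjoint_iff_inter_eq_empty.1 (h.symm.mono_left hYZ.2)]
    simp
  · intro X hX
    rw [Finset.mem_powerset] at hX
    rw [← Finset.inter_union_distrib_left, Finset.inter_eq_left.2 hX]

/-- A product of sums over the subsets of disjoint sets as a sum over the subsets of the union. -/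
theorem prod_sum_powerset (R : Finset (Fin n)) (P : Fin n → Finset (Fin n))
    (hd : ∀ r ∈ R, ∀ s ∈ R, ∀ u ∈ P r, u ∈ P s → r = s) (g : Fin n → Finset (Fin n) → A) :
    ∏ r ∈ R, ∑ Y ∈ (P r).powerset, g r Y = ∑ X ∈ (R.biUnion P).powerset, ∏ r ∈ R, g r (X ∩ P r) := by
  induction R using Finset.induction_on with
  | empty => simp
  | insert r R hr ih =>
    have hdisj : ∀ s ∈ R, Disjoint (P r) (P s) := fun s hs => Finset.disjoint_left.2 fun u h1 h2 =>
      hr ((hd r (by simp) s (by simp [hs]) u h1 h2) ▸ hs)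
    have hdU : Disjoint (P r) (R.biUnion P) := (Finset.disjoint_biUnion_right _ _ _).2 hdisj
    rw [Finset.prod_insert hr, ih fun s hs t ht => hd s (by simp [hs]) t (by simp [ht]),
      Finset.biUnion_insert, sum_powerset_union hdU, Finset.sum_mul_sum]
    refine Finset.sum_congr rfl fun Y hY => Finset.sum_congr rfl fun Z hZ => ?_
    rw [Finset.mem_powerset] at hY hZ
    rw [Finset.prod_insert hr, Finset.union_inter_distrib_right, Finset.inter_eq_left.2 hY,
      Finset.disjoint_iff_inter_eq_empty.1 (hdU.symm.mono_left hZ), Finset.union_empty]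
    congr 1
    refine Finset.prod_congr rfl fun s hs => ?_
    rw [Finset.union_inter_distrib_right,
      Finset.disjoint_iff_inter_eq_empty.1 ((hdisj s hs).mono_left hY), Finset.empty_union]

theorem Parts.prod_inter (hP : Parts H M R P) (x : Fin n → A) {X : Finset (Fin n)} (hX : X ⊆ M) :
    ∏ r ∈ R, ∏ v ∈ X ∩ P r, x v = ∏ v ∈ X, x v := by
  rw [← Finset.prod_biUnion, ← Finset.inter_biUnion, hP.union, Finset.inter_eq_left.2 hX]
  intro r hr s hs hrs
  refine Finset.disjoint_left.2 fun u h1 h2 => hrs ?_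
  exact hP.disj r hr s hs u (Finset.mem_inter.1 h1).2 (Finset.mem_inter.1 h2).2

/-- If the weight of every state of a part is the sum of the weights of the subsets that satisfy
`T`, then variable elimination sums over the subsets of the module. -/
theorem Parts.expand (hP : Parts H M R P) (G : Gr) (x : Fin n → A) (a : Fin n → St → A)
    (T : Fin n → St → Finset (Fin n) → Prop) (ha : ∀ r ∈ R, ∀ s ∈ statesF, a r s =
      ∑ Y ∈ (P r).powerset, if T r s Y then ∏ v ∈ Y, x v else 0) :
    (∑ f ∈ adm R, if okA G R f then ∏ r ∈ R, a r (f r) else 0) =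
      ∑ X ∈ M.powerset, ∑ f ∈ adm R,
        if okA G R f ∧ ∀ r ∈ R, T r (f r) (X ∩ P r) then ∏ v ∈ X, x v else 0 := by
  rw [Finset.sum_comm]
  refine Finset.sum_congr rfl fun f hf => ?_
  by_cases hok : okA G R f
  · simp only [hok, if_true, true_and]
    have hst : ∀ r ∈ R, f r ∈ statesF := by
      intro r hr
      have := Fintype.mem_piFinset.1 hf r
      rwa [if_pos hr] at this
    rw [Finset.prod_congr rfl fun r hr => ha r hr (f r) (hst r hr), prod_sum_powerset R P hP.disj,
      hP.union]
    refine Finset.sum_congr rfl fun X hX => ?_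
    rw [Finset.prod_ite_zero, hP.prod_inter x (Finset.mem_powerset.1 hX)]
    congr!
  · simp [hok]

/-- The states of the parts that occur below the root. -/
noncomputable def innerState (P : Fin n → Finset (Fin n)) (r : Fin n) (Y : Finset (Fin n)) : St :=
  if Y = P r then (true, true, false) else stE

theorem okA_iff {G : Gr} (h : Rep G H) {f : Fin n → St} :
    okA G R f ↔ ∀ u ∈ R, ∀ w ∈ R, H.Adj u w → compat (f u) (f w) = true := by
  unfold okA
  simp only [h.adj_iff]

theorem compat_innerState {r s : Fin n} {Y Z : Finset (Fin n)} :
    compat (innerState P r Y) (innerState P s Z) = true ↔ Y = P r ∨ Z = P s := by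
  unfold innerState
  by_cases h1 : Y = P r <;> by_cases h2 : Z = P s <;> simp [h1, h2, compat, stE]

theorem innerState_mem (r : Fin n) (Y : Finset (Fin n)) : innerState P r Y ∈ statesF := by
  unfold innerState
  split_ifs <;> decide

/-- Below the root, every vertex cover is counted by exactly one assignment of states. -/
theorem Parts.sum_inner (hP : Parts H M R P) {G : Gr} (h : Rep G H) (X : Finset (Fin n)) (c : A) :
    (∑ f ∈ adm R, if okA G R f ∧ ∀ r ∈ R, f r = innerState P r (X ∩ P r) ∧
      Covers H (P r) (X ∩ P r) then c else 0) = if Covers H M X then c else 0 := by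
  let f₀ : Fin n → St := fun r => if r ∈ R then innerState P r (X ∩ P r) else stE
  have hf₀ : f₀ ∈ adm R := by
    refine Fintype.mem_piFinset.2 fun r => ?_
    by_cases hr : r ∈ R
    · simp only [f₀, hr, if_true]; exact innerState_mem _ _
    · simp [f₀, hr]
  rw [Finset.sum_eq_single f₀]
  · congr 1
    rw [okA_iff h, hP.covers_iff, eq_iff_iff, and_comm]
    refine and_congr (forall₂_congr fun r hr => ?_) (forall₂_congr fun u hu => forall₂_congr
      fun w hw => forall_congr' fun _ => ?_)
    · simp [f₀, hr]
    · simp only [f₀, hu, hw, if_true]; exact compat_innerState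
  · intro f hf hne
    refine if_neg fun hcon => hne (funext fun r => ?_)
    by_cases hr : r ∈ R
    · simp only [f₀, hr, if_true]; exact (hcon.2 r hr).1
    · have := Fintype.mem_piFinset.1 hf r
      simpa [f₀, hr] using this
  · exact fun hcon => absurd hf₀ hcon

/-! ### Cuts of the quotient at the root -/

/-- The representatives of the parts that meet `X`. -/
noncomputable def touched (R : Finset (Fin n)) (P : Fin n → Finset (Fin n)) (X : Finset (Fin n)) :
    Finset (Fin n) := R.filter fun r => (X ∩ P r).Nonempty

/-- `X` meets the part of `r` in a set `Y` of the kind given by the state `s`; the part of `j` is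
the first one that `X` meets, and it lies on the left side. -/
def RootState (H : SimpleGraph (Fin n)) (P : Fin n → Finset (Fin n)) (j r : Fin n) (s : St)
    (Y : Finset (Fin n)) : Prop :=
  s.1 = decide Y.Nonempty ∧ s.2.1 = decide (Y = P r) ∧ Covers H (P r) Y ∧
    (r = j → Y.Nonempty ∧ s.2.2 = false) ∧ (r < j → Y = ∅)

theorem mem_statesF {s : St} : s ∈ statesF ↔ (s.2.1 = true → s.1 = true) ∧
    (s.1 = false → s.2.2 = false) := by
  obtain ⟨a, b, c⟩ := s
  revert a b c; decide

theorem mem_adm {f : Fin n → St} : f ∈ adm R ↔ (∀ r ∈ R, f r ∈ statesF) ∧ ∀ r ∉ R, f r = stE := by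
  unfold adm
  rw [Fintype.mem_piFinset]
  constructor
  · intro h
    exact ⟨fun r hr => by simpa [hr] using h r, fun r hr => by simpa [hr] using h r⟩
  · rintro ⟨h1, h2⟩ r
    by_cases hr : r ∈ R
    · simpa [hr] using h1 r hr
    · simpa [hr] using h2 r hr

/-- The number of consistent cuts of the touched parts with the first touched part on the left is
odd if and only if the touched parts are connected. -/
theorem Parts.sum_root (hP : Parts H M R P) {G : Gr} (h : Rep G H) (X : Finset (Fin n)) {c : A}
    (hc : c + c = 0) :
    (∑ j ∈ R, ∑ f ∈ adm R, if okA G R f ∧ ∀ r ∈ R, RootState H P j r (f r) (X ∩ P r) then c else 0) =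
      if Covers H M X ∧ (touched R P X).Nonempty ∧ ConnIn H (touched R P X) then c else 0 := by
  by_cases hne : (touched R P X).Nonempty
  swap
  · simp only [hne, false_and, and_false, if_false]
    refine Finset.sum_eq_zero fun j hj => Finset.sum_eq_zero fun f _ => if_neg fun hcon => hne ?_
    exact ⟨j, Finset.mem_filter.2 ⟨hj, ((hcon.2 j hj).2.2.2.1 rfl).1⟩⟩
  set j₀ := (touched R P X).min' hne with hj₀
  have hj₀m : j₀ ∈ touched R P X := Finset.min'_mem _ _
  obtain ⟨hj₀R, hj₀X⟩ := Finset.mem_filter.1 hj₀m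
  rw [Finset.sum_eq_single j₀]
  rotate_left
  · -- only the first touched part can be the anchor
    refine fun j hj hjne => Finset.sum_eq_zero fun f _ => if_neg fun hcon => hjne ?_
    have h1 := ((hcon.2 j hj).2.2.2.1 rfl).1
    have h2 : j₀ ≤ j := Finset.min'_le _ _ (Finset.mem_filter.2 ⟨hj, h1⟩)
    by_contra hjj
    have := (hcon.2 j₀ hj₀R).2.2.2.2 (lt_of_le_of_ne h2 (Ne.symm hjj))
    rw [this] at hj₀X
    exact Finset.not_nonempty_empty hj₀X
  · exact fun hcon => absurd hj₀R hcon
  by_cases hcov : Covers H M X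
  swap
  · rw [if_neg (by tauto)]
    refine Finset.sum_eq_zero fun f _ => if_neg fun hcon => hcov (hP.covers_iff.2 ⟨fun r hr =>
      (hcon.2 r hr).2.2.1, fun r hr s hs hrs => ?_⟩)
    have := (okA_iff h).1 hcon.1 r hr s hs hrs
    rw [compat, Bool.and_eq_true, Bool.or_eq_true, (hcon.2 r hr).2.1, (hcon.2 s hs).2.1] at this
    simpa using this.1
  obtain ⟨hcov1, hcov2⟩ := hP.covers_iff.1 hcov
  -- the condition in terms of the colouring of the touched parts
  have key : ∀ f ∈ adm R, (okA G R f ∧ ∀ r ∈ R, RootState H P j₀ r (f r) (X ∩ P r)) ↔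
      (∀ r ∈ R, (f r).1 = decide (X ∩ P r).Nonempty ∧ (f r).2.1 = decide (X ∩ P r = P r)) ∧
      (f j₀).2.2 = false ∧
      ∀ u ∈ touched R P X, ∀ w ∈ touched R P X, H.Adj u w → (f u).2.2 = (f w).2.2 := by
    intro f hf
    rw [okA_iff h]
    constructor
    · rintro ⟨h1, h2⟩
      refine ⟨fun r hr => ⟨(h2 r hr).1, (h2 r hr).2.1⟩, ((h2 j₀ hj₀R).2.2.2.1 rfl).2, ?_⟩
      intro u hu w hw huw
      obtain ⟨hu, hu'⟩ := Finset.mem_filter.1 hu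
      obtain ⟨hw, hw'⟩ := Finset.mem_filter.1 hw
      have := h1 u hu w hw huw
      rw [compat, (h2 u hu).1, (h2 w hw).1] at this
      rw [Bool.and_eq_true] at this
      simpa [hu', hw'] using this.2
    · rintro ⟨h1, h2, h3⟩
      refine ⟨fun u hu w hw huw => ?_, fun r hr => ⟨(h1 r hr).1, (h1 r hr).2, hcov1 r hr, ?_, ?_⟩⟩
      · rw [compat, Bool.and_eq_true, (h1 u hu).1, (h1 u hu).2, (h1 w hw).1, (h1 w hw).2]
        refine ⟨by simpa using hcov2 u hu w hw huw, ?_⟩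
        by_cases hu' : (X ∩ P u).Nonempty
        · by_cases hw' : (X ∩ P w).Nonempty
          · have := h3 u (Finset.mem_filter.2 ⟨hu, hu'⟩) w (Finset.mem_filter.2 ⟨hw, hw'⟩) huw
            simp [this]
          · simp [hw']
        · simp [hu']
      · rintro rfl
        exact ⟨hj₀X, h2⟩
      · intro hlt
        by_contra hcon
        exact absurd (Finset.min'_le _ _ (Finset.mem_filter.2 ⟨hr, Finset.nonempty_iff_ne_empty.2 hcon⟩))
          (not_le.2 hlt)
  rw [Finset.sum_congr rfl fun f hf => if_congr (key f hf) rfl rfl]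
  by_cases hconn : ConnIn H (touched R P X)
  · -- the colouring that is constantly `false` is the only one
    rw [if_pos ⟨hcov, hne, hconn⟩]
    let f₀ : Fin n → St := fun r => if r ∈ R then
      (decide (X ∩ P r).Nonempty, decide (X ∩ P r = P r), false) else stE
    have hf₀ : f₀ ∈ adm R := by
      refine mem_adm.2 ⟨fun r hr => ?_, fun r hr => by simp [f₀, hr]⟩
      simp only [f₀, hr, if_true]
      rw [mem_statesF]
      simp only [decide_eq_true_eq, implies_true, and_true]
      intro he
      rw [he]; exact ⟨r, hP.self r hr⟩
    rw [Finset.sum_eq_single f₀]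
    · refine if_pos ⟨fun r hr => ?_, ?_, ?_⟩
      · simp [f₀, hr]
      · simp [f₀, hj₀R]
      · intro u hu w hw _
        simp [f₀, (Finset.mem_filter.1 hu).1, (Finset.mem_filter.1 hw).1]
    · intro f hf hfne
      refine if_neg fun ⟨h1, h2, h3⟩ => hfne (funext fun r => ?_)
      obtain ⟨hf1, hf2⟩ := mem_adm.1 hf
      by_cases hr : r ∈ R
      · have hcol : (f r).2.2 = false := by
          by_cases hr' : (X ∩ P r).Nonempty
          · exact hconn (fun r => (f r).2.2 = false) ⟨j₀, hj₀m, h2⟩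
              (fun a ha b hb hab hfa => by rw [← h3 a ha b hb hab]; exact hfa) r
              (Finset.mem_filter.2 ⟨hr, hr'⟩)
          · refine (mem_statesF.1 (hf1 r hr)).2 ?_
            rw [(h1 r hr).1]; simpa using hr'
        simp only [f₀, hr, if_true]
        exact Prod.ext (h1 r hr).1 (Prod.ext (h1 r hr).2 hcol)
      · simp [f₀, hr, hf2 r hr]
    · exact fun hcon => absurd hf₀ hcon
  · -- swapping the sides of some components is an involution without fixed points
    rw [if_neg (by tauto)]
    unfold ConnIn at hconn
    push Not at hconn
    obtain ⟨Q, ⟨a, ha, hQa⟩, hstep, b, hb, hQb⟩ := hconn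
    let K : Fin n → Bool := fun r => xor (decide (Q r)) (decide (Q j₀))
    have hK0 : K j₀ = false := by simp [K]
    have hKadj : ∀ u ∈ touched R P X, ∀ w ∈ touched R P X, H.Adj u w → K u = K w := by
      intro u hu w hw huw
      have : Q u ↔ Q w := ⟨hstep u hu w hw huw, hstep w hw u hu huw.symm⟩
      simp [K, this]
    obtain ⟨d, hd, hKd⟩ : ∃ d ∈ touched R P X, K d = true := by
      by_cases hQ : Q j₀
      · exact ⟨b, hb, by simp [K, hQ, hQb]⟩
      · exact ⟨a, ha, by simp [K, hQ, hQa]⟩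
    let g : (Fin n → St) → (Fin n → St) := fun f r =>
      if r ∈ touched R P X then ((f r).1, (f r).2.1, xor (f r).2.2 (K r)) else f r
    have hg1 : ∀ f r, (g f r).1 = (f r).1 := fun f r => by simp only [g]; split_ifs <;> rfl
    have hg2 : ∀ f r, (g f r).2.1 = (f r).2.1 := fun f r => by simp only [g]; split_ifs <;> rfl
    have hg3 : ∀ f, ∀ r ∈ touched R P X, (g f r).2.2 = xor (f r).2.2 (K r) :=
      fun f r hr => by simp only [g, hr, if_true]
    have hgg : ∀ f, g (g f) = f := by
      intro f; funext r
      by_cases hr : r ∈ touched R P X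
      · refine Prod.ext (by rw [hg1, hg1]) (Prod.ext (by rw [hg2, hg2]) ?_)
        rw [hg3 _ r hr, hg3 _ r hr]; simp
      · simp [g, hr]
    rw [← Finset.sum_filter]
    refine Finset.sum_involution (fun f _ => g f) (fun _ _ => hc) ?_ ?_ (fun f _ => hgg f)
    · intro f _ _ he
      have := hg3 f d hd
      rw [he, hKd] at this
      simp at this
    · intro f hf
      obtain ⟨hf0, h1, h2, h3⟩ := Finset.mem_filter.1 hf
      obtain ⟨hf1, hf2⟩ := mem_adm.1 hf0
      refine Finset.mem_filter.2 ⟨mem_adm.2 ⟨fun r hr => ?_, fun r hr => ?_⟩, fun r hr => ?_, ?_, ?_⟩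
      · rw [mem_statesF, hg1, hg2]
        refine ⟨(mem_statesF.1 (hf1 r hr)).1, fun h0 => ?_⟩
        have hnot : r ∉ touched R P X := by
          intro ht
          rw [(h1 r hr).1] at h0
          simp [(Finset.mem_filter.1 ht).2] at h0
        simp only [g, hnot, if_false]
        exact (mem_statesF.1 (hf1 r hr)).2 h0
      · have hnot : r ∉ touched R P X := fun ht => hr (Finset.mem_filter.1 ht).1
        simp only [g, hnot, if_false]
        exact hf2 r hr
      · rw [hg1, hg2]; exact h1 r hr
      · rw [hg3 _ _ hj₀m, h2, hK0]; rfl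
      · intro u hu w hw huw
        rw [hg3 _ _ hu, hg3 _ _ hw, h3 u hu w hw huw, hKadj u hu w hw huw]

end combinatorics

end CVC
namespace CVC

/-! ### Connected vertex covers and the parts of the root -/

section root
open Classical

variable {n : ℕ} {H : SimpleGraph (Fin n)} {A : Type*} [CommRing A]
  {M R : Finset (Fin n)} {P : Fin n → Finset (Fin n)}

theorem connIn_singleton (H : SimpleGraph (Fin n)) (r : Fin n) : ConnIn H {r} := by
  rintro Q ⟨a, rfl, ha⟩ _ b rfl
  exact ha

/-- In a connected graph, every part of a nontrivial partition has an adjacent part. -/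
theorem Parts.exists_adj (hP : Parts H Finset.univ R P) (hH : H.Connected)
    (hne : ∀ r ∈ R, P r ≠ Finset.univ) {r : Fin n} (hr : r ∈ R) : ∃ s ∈ R, s ≠ r ∧ H.Adj r s := by
  by_contra hcon
  push Not at hcon
  refine hne r hr (Finset.eq_univ_iff_forall.2 fun b => ?_)
  have hc : ConnIn H Set.univ := connIn_of_preconnected
    (((SimpleGraph.induceUnivIso H).connected_iff.2 hH).preconnected)
  refine hc (· ∈ P r) ⟨r, trivial, hP.self r hr⟩ (fun u _ v _ huv hu => ?_) b trivial
  obtain ⟨s, hs, hv⟩ := hP.exists_mem (Finset.mem_univ v)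
  by_cases hrs : s = r
  · rwa [← hrs]
  · exact absurd ((hP.adj_iff hr hs (Ne.symm hrs) hu hv).1 huv) (hcon s hs hrs)

/-- A vertex cover that is not one of the parts is connected if and only if the parts that it meets
are connected. -/
theorem Parts.connIn_iff (hP : Parts H Finset.univ R P) (hH : H.Connected)
    (hne : ∀ r ∈ R, P r ≠ Finset.univ) {X : Finset (Fin n)} (hX : Covers H Finset.univ X)
    (hXP : ∀ r ∈ R, X ≠ P r) : ConnIn H (touched R P X) ↔ ConnIn H X := by
  constructor
  · intro hc
    -- every touched part has a touched neighbour, as otherwise it would be all of `X`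
    have hnb : ∀ r ∈ touched R P X, ∃ s ∈ touched R P X, H.Adj r s := by
      intro r hr
      by_contra hcon
      push Not at hcon
      have hall : ∀ s ∈ touched R P X, s = r := hc (· = r) ⟨r, hr, rfl⟩
        (by rintro a ha b hb hab rfl; exact absurd hab (hcon b hb))
      have hrR := (Finset.mem_filter.1 hr).1
      refine hXP r hrR (subset_antisymm (fun u hu => ?_) ?_)
      · obtain ⟨s, hs, hus⟩ := hP.exists_mem (Finset.mem_univ u)
        rwa [← hall s (Finset.mem_filter.2 ⟨hs, u, Finset.mem_inter.2 ⟨hu, hus⟩⟩)]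
      · obtain ⟨s, hs, hsr, hadj⟩ := hP.exists_adj hH hne hrR
        rcases (hP.covers_iff.1 hX).2 r hrR s hs hadj with h | h
        · exact Finset.inter_eq_right.1 h
        · exact absurd (hall s (Finset.mem_filter.2 ⟨hs, by rw [h]; exact ⟨s, hP.self s hs⟩⟩)) hsr
    rintro Q ⟨a, ha, hQa⟩ hstep b hb
    have hadj : ∀ r ∈ touched R P X, ∀ s ∈ touched R P X, H.Adj r s → ∀ u ∈ X ∩ P r, ∀ v ∈ X ∩ P s,
        Q u → Q v := by
      intro r hr s hs hrs u hu v hv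
      rw [Finset.mem_inter] at hu hv
      exact hstep u hu.1 v hv.1 ((hP.adj_iff (Finset.mem_filter.1 hr).1 (Finset.mem_filter.1 hs).1
        hrs.ne hu.2 hv.2).2 hrs)
    have hrep : ∀ u ∈ X, ∃ r ∈ touched R P X, u ∈ X ∩ P r := by
      intro u hu
      obtain ⟨r, hr, hur⟩ := hP.exists_mem (Finset.mem_univ u)
      have : u ∈ X ∩ P r := Finset.mem_inter.2 ⟨hu, hur⟩
      exact ⟨r, Finset.mem_filter.2 ⟨hr, u, this⟩, this⟩
    obtain ⟨r, hr, har⟩ := hrep a ha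
    obtain ⟨s, hs, hbs⟩ := hrep b hb
    -- vertices of `X` in the same part are connected by way of an adjacent part
    refine hc (fun r => ∀ u ∈ X ∩ P r, Q u) ⟨r, hr, ?_⟩ ?_ s hs b hbs
    · obtain ⟨t, ht, hrt⟩ := hnb r hr
      obtain ⟨w, hw⟩ := (Finset.mem_filter.1 ht).2
      have hQw := hadj r hr t ht hrt a har w hw hQa
      exact fun u hu => hadj t ht r hr hrt.symm w hw u hu hQw
    · intro r hr s hs hrs hall v hv
      obtain ⟨w, hw⟩ := (Finset.mem_filter.1 hr).2
      exact hadj r hr s hs hrs w hw v hv (hall w hw)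
  · rintro hc Q ⟨a, ha, hQa⟩ hstep b hb
    obtain ⟨haR, u, hu⟩ := Finset.mem_filter.1 ha
    obtain ⟨hbR, v, hv⟩ := Finset.mem_filter.1 hb
    rw [Finset.mem_inter] at hu hv
    obtain ⟨r, hr, hvr, hQr⟩ := hc (fun u => ∃ r ∈ R, u ∈ P r ∧ Q r) ⟨u, hu.1, a, haR, hu.2, hQa⟩ (by
      rintro x hx y hy hxy ⟨r, hr, hxr, hQr⟩
      obtain ⟨s, hs, hys⟩ := hP.exists_mem (Finset.mem_univ y)
      refine ⟨s, hs, hys, ?_⟩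
      by_cases hrs : r = s
      · rwa [← hrs]
      · exact hstep r (Finset.mem_filter.2 ⟨hr, x, Finset.mem_inter.2 ⟨hx, hxr⟩⟩) s
          (Finset.mem_filter.2 ⟨hs, y, Finset.mem_inter.2 ⟨hy, hys⟩⟩)
          ((hP.adj_iff hr hs hrs hxr hys).1 hxy) hQr) v hv.1
    rwa [hP.disj b hbR r hr v hv.2 hvr]

/-- Vertex covers that are single parts touch a connected set of parts, even if they are not
connected themselves. In characteristic two, adding their monomials once more removes them from the
sum. -/
theorem Parts.sum_connected (hP : Parts H Finset.univ R P) (hH : H.Connected)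
    (hne : ∀ r ∈ R, P r ≠ Finset.univ) (x : Fin n → A) (h2 : ∀ a : A, a + a = 0) :
    (∑ X ∈ Finset.univ.powerset, if Covers H Finset.univ X ∧ (touched R P X).Nonempty ∧
        ConnIn H (touched R P X) then ∏ v ∈ X, x v else 0) +
      (∑ r ∈ R, if Covers H Finset.univ (P r) ∧ ¬ ConnIn H (P r) then ∏ v ∈ P r, x v else 0) =
    ∑ X : Finset (Fin n), if Covers H Finset.univ X ∧ ConnIn H X then ∏ v ∈ X, x v else 0 := by
  have hcorr : ∀ r, (if Covers H Finset.univ (P r) ∧ ¬ ConnIn H (P r) then ∏ v ∈ P r, x v else 0) =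
      ∑ X : Finset (Fin n), if X = P r then
        (if Covers H Finset.univ X ∧ ¬ ConnIn H X then ∏ v ∈ X, x v else 0) else 0 := by
    intro r
    rw [Finset.sum_ite_eq' Finset.univ (P r)]
    simp
  rw [Finset.sum_congr rfl fun r _ => hcorr r, Finset.sum_comm, Finset.powerset_univ,
    ← Finset.sum_add_distrib]
  refine Finset.sum_congr rfl fun X _ => ?_
  by_cases hX : Covers H Finset.univ X
  swap
  · simp [hX]
  simp only [hX, true_and]
  have htn : (touched R P X).Nonempty := by
    obtain ⟨u⟩ := hH.nonempty
    obtain ⟨r, hr, -⟩ := hP.exists_mem (Finset.mem_univ u)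
    obtain ⟨s, hs, -, hadj⟩ := hP.exists_adj hH hne hr
    rcases hX r (Finset.mem_univ _) s (Finset.mem_univ _) hadj with h | h
    · exact ⟨r, Finset.mem_filter.2 ⟨hr, r, Finset.mem_inter.2 ⟨h, hP.self r hr⟩⟩⟩
    · exact ⟨s, Finset.mem_filter.2 ⟨hs, s, Finset.mem_inter.2 ⟨h, hP.self s hs⟩⟩⟩
  by_cases hXP : ∃ r ∈ R, X = P r
  · -- a single part: its monomial is counted once if it is connected, and twice if it is not
    obtain ⟨r, hr, rfl⟩ := hXP
    have hsing : touched R P (P r) = {r} := by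
      refine Finset.eq_singleton_iff_unique_mem.2 ⟨Finset.mem_filter.2 ⟨hr, r, by simp [hP.self r hr]⟩, ?_⟩
      intro s hs
      obtain ⟨hs, u, hu⟩ := Finset.mem_filter.1 hs
      rw [Finset.mem_inter] at hu
      exact hP.disj s hs r hr u hu.2 hu.1
    rw [if_pos ⟨htn, by rw [hsing, Finset.coe_singleton]; exact connIn_singleton H r⟩,
      Finset.sum_eq_single r]
    · rw [if_pos rfl]
      by_cases hc : ConnIn H (P r : Set (Fin n)) <;> simp [hc, h2]
    · intro s hs hsr
      refine if_neg fun he => hsr ?_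
      exact hP.disj s hs r hr r (he ▸ hP.self r hr) (hP.self r hr)
    · exact fun h => absurd hr h
  · push Not at hXP
    rw [Finset.sum_eq_zero fun r hr => if_neg (hXP r hr), add_zero]
    exact if_congr (by rw [hP.connIn_iff hH hne hX hXP]; simp [htn]) rfl rfl

end root

/-! ### Correctness of the recursion -/

section memo
open Classical

variable {n : ℕ} {G : Gr} {H : SimpleGraph (Fin n)}

theorem coe_map_elems {β : Type*} (n : ℕ) (S : BV) (f : ℕ → β) :
    (((elems n S).map f : List β) : Multiset β) = (fs n S).val.map fun i : Fin n => f i := by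
  have h1 : elems n S = ((List.finRange n).filter fun i : Fin n => mem S i).map Fin.val := by
    unfold elems
    rw [← List.map_coe_finRange_eq_range, List.filter_map]
    rfl
  have h2 : (fs n S).val = (((List.finRange n).filter fun i : Fin n => mem S i : List (Fin n)) : Multiset (Fin n)) := by
    refine Eq.trans (b := Multiset.filter (fun i : Fin n => mem S i = true)
      ((List.finRange n : List (Fin n)) : Multiset (Fin n))) rfl ?_
    rw [Multiset.filter_coe]
    simp
  rw [h1, h2, List.map_map, Multiset.map_coe]
  rfl

theorem sum_elems {β : Type*} [AddCommMonoid β] (n : ℕ) (S : BV) (f : ℕ → β) :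
    ((elems n S).map f).sum = ∑ i ∈ fs n S, f i := by
  rw [← Multiset.sum_coe, coe_map_elems]; rfl

theorem prod_elems {β : Type*} [CommMonoid β] (n : ℕ) (S : BV) (f : ℕ → β) :
    ((elems n S).map f).prod = ∏ i ∈ fs n S, f i := by
  rw [← Multiset.prod_coe, coe_map_elems]; rfl

/-- The partition computed by `part` in terms of finite sets. -/
theorem parts_of_split (h : Rep G H) {M : BV} (hP : Split H (vs n M) fun u => vs n (part G M u)) :
    Parts H (fs n M) (fs n (reps G M)) fun r => fs n (part G M r) := by
  have hsub : ∀ r ∈ fs n (reps G M), r ∈ vs n M := fun r hr => ((mem_reps h hP).1 hr).1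
  refine ⟨fun r hr s hs u h1 h2 => rep_unique h hP hr hs (mem_fs_vs.1 h1) (mem_fs_vs.1 h2), ?_,
    fun r hr => mem_fs_vs.2 (hP.mem_self r (hsub r hr)), fun r hr => ?_⟩
  · ext u
    rw [Finset.mem_biUnion]
    constructor
    · rintro ⟨r, hr, hu⟩
      exact mem_fs_vs.2 (hP.sub r (hsub r hr) (mem_fs_vs.1 hu))
    · intro hu
      obtain ⟨r, hr, hur⟩ := exists_rep h hP (mem_fs_vs.1 hu)
      exact ⟨r, hr, mem_fs_vs.2 hur⟩
  · rw [coe_fs]; exact hP.isModule r (hsub r hr)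

theorem card_fs (n : ℕ) (S : BV) : cardV n S = (fs n S).card := elems_length n S

theorem nontrivial_of_card {M : BV} (hc : ¬ cardV n M ≤ 1) : (vs n M).Nontrivial := by
  rw [card_fs, not_le, Finset.one_lt_card] at hc
  obtain ⟨a, ha, b, hb, hab⟩ := hc
  exact ⟨a, mem_fs_vs.1 ha, b, mem_fs_vs.1 hb, hab⟩

theorem mem_children (h : Rep G H) {M C : BV} : C ∈ children G M ↔
    ¬ cardV n M ≤ 1 ∧ ∃ r ∈ fs n (reps G M), C = part G M r := by
  unfold children
  rw [h.len]
  by_cases hc : cardV n M ≤ 1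
  · simp [hc]
  · simp only [hc, decide_false, cond_false, not_false_eq_true, true_and, parts, h.len, List.mem_map]
    constructor
    · rintro ⟨r, hr, rfl⟩
      obtain ⟨h1, h2⟩ := mem_elems.1 hr
      exact ⟨⟨r, h1⟩, mem_fs.2 h2, rfl⟩
    · rintro ⟨r, hr, rfl⟩
      exact ⟨r, mem_elems.2 ⟨r.2, mem_fs.1 hr⟩, rfl⟩

/-- Each splitting step decreases this number. -/
def potential (n : ℕ) (q : List BV) : ℕ := (q.map fun M => 2 * (fs n M).card - 1).sum

/-- A module with at least two vertices has at least two parts. -/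
theorem potential_children (h : Rep G H) {M : BV} (hM : IsModule H (vs n M)) (hne : (vs n M).Nonempty) :
    potential n (children G M) + 1 ≤ 2 * (fs n M).card - 1 := by
  have hpos : 0 < (fs n M).card := by
    obtain ⟨u, hu⟩ := hne
    exact Finset.card_pos.2 ⟨u, mem_fs_vs.2 hu⟩
  by_cases hc : cardV n M ≤ 1
  · have : children G M = [] := by
      unfold children; rw [h.len]; simp [hc]
    rw [this]; simp [potential]; omega
  · have hS := split_part h hM (nontrivial_of_card hc)
    have hP := parts_of_split h hS
    have hch : children G M = (elems n (reps G M)).map (part G M) := by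
      unfold children parts; rw [h.len]; simp [hc]
    rw [hch, potential, List.map_map, sum_elems]
    have hsum : ∑ r ∈ fs n (reps G M), (fs n (part G M r)).card = (fs n M).card := by
      rw [← hP.union, Finset.card_biUnion]
      exact fun r hr s hs hrs => Finset.disjoint_left.2 fun u h1 h2 => hrs (hP.disj r hr s hs u h1 h2)
    have hR : 1 < (fs n (reps G M)).card := by
      obtain ⟨u, hu⟩ := hne
      obtain ⟨r, hr, -⟩ := hP.exists_mem (mem_fs_vs.2 hu)
      have hrM := ((mem_reps h hS).1 hr).1
      obtain ⟨w, hw, hwr⟩ := Set.exists_of_ssubset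
        (Set.ssubset_iff_subset_ne.2 ⟨hS.sub r hrM, hS.ne r hrM⟩)
      obtain ⟨s, hs, hws⟩ := hP.exists_mem (mem_fs_vs.2 hw)
      exact Finset.one_lt_card.2 ⟨r, hr, s, hs, by rintro rfl; exact hwr (mem_fs_vs.1 hws)⟩
    have hadd : ∑ r ∈ fs n (reps G M), (2 * (fs n (part G M r)).card - 1) + (fs n (reps G M)).card =
        2 * (fs n M).card := by
      rw [← hsum, Finset.mul_sum, Finset.card_eq_sum_ones, ← Finset.sum_add_distrib]
      refine Finset.sum_congr rfl fun r hr => ?_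
      have := Finset.card_pos.2 ⟨r, hP.self r hr⟩
      omega
    simp only [Function.comp_def]
    omega

/-- The nodes are modules, and the set of all vertices and the parts of nodes are nodes. -/
theorem nodes_spec (h : Rep G H) (hn : 0 < n) : (nodes G).length ≤ 2 * n ∧
    (∀ M ∈ nodes G, (vs n M).Nonempty ∧ IsModule H (vs n M)) ∧ allV G ∈ nodes G ∧
    ∀ M ∈ nodes G, ∀ C ∈ children G M, C ∈ nodes G := by
  let Inv : ℕ → List BV × List BV → Prop := fun i s => s.2.length ≤ i ∧
    (∀ M, M ∈ s.1 ∨ M ∈ s.2 → (vs n M).Nonempty ∧ IsModule H (vs n M)) ∧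
    (allV G ∈ s.1 ∨ allV G ∈ s.2) ∧ (∀ M ∈ s.2, ∀ C ∈ children G M, C ∈ s.1 ∨ C ∈ s.2) ∧
    potential n s.1 ≤ 2 * n - 1 - i
  have hstep : ∀ i s, Inv i s → Inv (i + 1) (expandStep G s) := by
    rintro i ⟨q, d⟩ ⟨h1, h2, h3, h4, h5⟩
    unfold expandStep
    cases q with
    | nil =>
      simp only [List.isEmpty_nil, cond_true]
      refine ⟨h1.trans (Nat.le_succ _), h2, h3, h4, by simp [potential]⟩
    | cons M q =>
      simp only [List.isEmpty_cons, cond_false, List.headD_cons, List.tail_cons]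
      have hM := h2 M (Or.inl (by simp))
      refine ⟨by simpa using h1, ?_, ?_, ?_, ?_⟩
      · intro N hN
        simp only [List.mem_append, List.mem_cons] at hN
        rcases hN with (hN | hN) | rfl | hN
        · obtain ⟨hc, r, hr, rfl⟩ := (mem_children h).1 hN
          have hS := split_part h hM.2 (nontrivial_of_card hc)
          have hrM := ((mem_reps h hS).1 hr).1
          exact ⟨⟨r, hS.mem_self r hrM⟩, hS.isModule r hrM⟩
        · exact h2 N (Or.inl (by simp [hN]))
        · exact hM
        · exact h2 N (Or.inr hN)
      · simp only [List.mem_append, List.mem_cons] at h3 ⊢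
        tauto
      · intro N hN C hC
        simp only [List.mem_append, List.mem_cons] at hN ⊢
        rcases hN with rfl | hN
        · exact Or.inl (Or.inl hC)
        · have := h4 N hN C hC
          simp only [List.mem_cons] at this
          tauto
      · have := potential_children h hM.2 hM.1
        have hcons : potential n (M :: q) = (2 * (fs n M).card - 1) + potential n q := by
          simp [potential]
        have happ : potential n (children G M ++ q) = potential n (children G M) + potential n q := by
          simp [potential]
        simp only [hcons] at h5
        simp only [happ]
        omega
  have hinit : Inv 0 ([allV G], []) := by
    have huniv : vs n (allV G) = Set.univ := by
      rw [allV, h.len, vs_mkV]; simp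
    refine ⟨by simp, ?_, by simp, by simp, ?_⟩
    · intro M hM
      simp only [List.mem_singleton, List.not_mem_nil, or_false] at hM
      subst hM
      rw [huniv]
      exact ⟨⟨⟨0, hn⟩, trivial⟩, isModule_iff.2 fun _ _ _ _ _ hx => absurd trivial hx⟩
    · have : (fs n (allV G)).card ≤ n := by simpa using (fs n (allV G)).card_le_univ
      simp [potential]; omega
  have hall : ∀ (l : List ℕ) i s, Inv i s → Inv (i + l.length) (l.foldl (fun s _ => expandStep G s) s) := by
    intro l
    induction l with
    | nil => exact fun i s hs => hs
    | cons a l ih =>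
      intro i s hs
      rw [List.length_cons, ← add_assoc, add_right_comm]
      exact ih _ _ (hstep i s hs)
  have hfin := hall (List.range (2 * G.length)) 0 _ hinit
  rw [List.length_range, zero_add, h.len] at hfin
  have hnodes : nodes G = ((List.range (2 * G.length)).foldl (fun s _ => expandStep G s) ([allV G], [])).2 := rfl
  rw [← h.len] at hfin
  set s := (List.range (2 * G.length)).foldl (fun s _ => expandStep G s) ([allV G], [])
  obtain ⟨h1, h2, h3, h4, h5⟩ := hfin
  -- the potential of a nonempty queue is positive, but by now it has dropped to zero
  have hq : s.1 = [] := by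
    cases hs : s.1 with
    | nil => rfl
    | cons M q =>
      have hM := (h2 M (Or.inl (by rw [hs]; simp))).1
      have hpos : 0 < (fs n M).card := by
        obtain ⟨u, hu⟩ := hM
        exact Finset.card_pos.2 ⟨u, mem_fs_vs.2 hu⟩
      rw [hs] at h5
      simp only [potential, List.map_cons, List.sum_cons] at h5
      rw [h.len] at h5
      omega
  rw [hq] at h3 h4 h2
  simp only [List.not_mem_nil, false_or] at h2 h3 h4
  rw [hnodes]
  exact ⟨by rw [← h.len]; exact h1, h2, h3, h4⟩

theorem ev_fullP {D : ℕ} (h : Rep G H) (mo : List BV) (M : BV) :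
    ev D (fullP D G mo M) = ∏ v ∈ fs n M, ev D (mo.getD v []) := by
  rw [fullP, ev_prodP, List.map_map, h.len, ← prod_elems n M fun v => ev D (mo.getD v [])]
  rfl

theorem getD_map_range {β : Type*} (n : ℕ) (f : ℕ → β) (d : β) (v : Fin n) :
    ((List.range n).map f).getD v d = f v := by
  simp [List.getD_eq_getElem?_getD]

/-- In characteristic two, adding the monomial of the whole of `P` removes it from the sum over all
vertex covers. -/
theorem sum_nonfull {A : Type*} [CommRing A] (h2 : ∀ a : A, a + a = 0) (x : Fin n → A)
    (P : Finset (Fin n)) : (∑ Y ∈ P.powerset, if Y ≠ P ∧ Covers H P Y then ∏ v ∈ Y, x v else 0) =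
      coverSum H x P + ∏ v ∈ P, x v := by
  have : (∏ v ∈ P, x v) = ∑ Y ∈ P.powerset, if Y = P then ∏ v ∈ Y, x v else 0 := by
    rw [Finset.sum_ite_eq' P.powerset P]; simp
  rw [this, coverSum, ← Finset.sum_add_distrib]
  refine Finset.sum_congr rfl fun Y _ => ?_
  by_cases hY : Y = P
  · subst hY; simp [covers_self, h2]
  · simp [hY]

/-- The weight of a state is the sum over the vertex covers of the part that have this state. -/
theorem ev_innerW {D : ℕ} (h : Rep G H) (mo : List BV) (memo : Memo) (M : BV) (r : Fin n) {s : St}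
    (hs : s ∈ statesF) (hlook : ev D (look n memo (part G M r)) =
      coverSum H (fun v : Fin n => ev D (mo.getD v [])) (fs n (part G M r))) :
    ev D (wt (innerW D G mo memo M) r s) = ∑ Y ∈ (fs n (part G M r)).powerset,
      if s = innerState (fun r => fs n (part G M r)) r Y ∧ Covers H (fs n (part G M r)) Y then
        ∏ v ∈ Y, ev D (mo.getD v []) else 0 := by
  rw [wt, innerW, h.len, getD_map_range]
  have hfull : (∑ Y ∈ (fs n (part G M r)).powerset,
      if Y = fs n (part G M r) ∧ Covers H (fs n (part G M r)) Y then
        ∏ v ∈ Y, ev D (mo.getD v []) else 0) = ev D (fullP D G mo (part G M r)) := by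
    rw [ev_fullP h, Finset.sum_eq_single (fs n (part G M r))]
    · simp [covers_self]
    · intro Y _ hY; simp [hY]
    · intro hcon; simp at hcon
  have hno : ∀ t : St, t ≠ stE → t ≠ (true, true, false) → (∑ Y ∈ (fs n (part G M r)).powerset,
      if t = innerState (fun r => fs n (part G M r)) r Y ∧ Covers H (fs n (part G M r)) Y then
        ∏ v ∈ Y, ev D (mo.getD v []) else 0) = 0 := by
    intro t h1 h2
    refine Finset.sum_eq_zero fun Y _ => if_neg fun hcon => ?_
    have := hcon.1
    unfold innerState at this
    split_ifs at this <;> contradiction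
  simp only [statesF, states, List.toFinset_cons, List.toFinset_nil, Finset.mem_insert,
    Finset.notMem_empty, or_false] at hs
  rcases hs with rfl | rfl | rfl | rfl | rfl
  · refine Eq.trans (b := ev D (addP D (look n memo (part G M r)) (fullP D G mo (part G M r)))) rfl ?_
    rw [ev_addP, hlook, ev_fullP h, ← sum_nonfull two_TP]
    refine Finset.sum_congr rfl fun Y _ => if_congr (and_congr_left' ?_) rfl rfl
    unfold innerState
    by_cases hY : Y = fs n (part G M r)
    · simp [hY, stE]
    · simp [hY]
  · rw [hno _ (by decide) (by decide)]; exact ev_nil D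
  · rw [hno _ (by decide) (by decide)]; exact ev_nil D
  · refine Eq.trans (b := ev D (fullP D G mo (part G M r))) rfl ?_
    rw [← hfull]
    refine Finset.sum_congr rfl fun Y _ => if_congr (and_congr_left' ?_) rfl rfl
    unfold innerState
    by_cases hY : Y = fs n (part G M r)
    · simp [hY]
    · simp [hY, stE]
  · rw [hno _ (by decide) (by decide)]; exact ev_nil D

/-- If the polynomials of the parts of `M` are correct, then so is the one computed for `M`. -/
theorem ev_compute {D : ℕ} (h : Rep G H) (mo : List BV) (dec : Dec) (memo : Memo) {M : BV}
    (hM : IsModule H (vs n M)) (hne : (vs n M).Nonempty)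
    (hmemo : ∀ C ∈ children G M, ev D (look n memo C) =
      coverSum H (fun v : Fin n => ev D (mo.getD v [])) (fs n C)) :
    ev D (compute D G mo dec memo M) = coverSum H (fun v : Fin n => ev D (mo.getD v [])) (fs n M) := by
  unfold compute
  rw [h.len]
  by_cases hc : cardV n M ≤ 1
  · simp only [hc, decide_true, cond_true]
    obtain ⟨u, hu⟩ := hne
    obtain ⟨v, hv⟩ : ∃ v, fs n M = {v} := Finset.card_eq_one.1 (le_antisymm (card_fs n M ▸ hc)
      (Finset.card_pos.2 ⟨u, mem_fs_vs.2 hu⟩))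
    have hcov : ∀ Y, Covers H {v} Y := by
      intro Y a ha b hb hab
      rw [Finset.mem_singleton] at ha hb
      exact absurd (ha.trans hb.symm) hab.ne
    rw [ev_addP, ev_fullP h, ev_monoP, pow_zero, hv, coverSum]
    simp only [hcov, if_true]
    rw [← insert_empty_eq v, Finset.sum_powerset_insert (Finset.notMem_empty v)]
    simp
  · simp only [hc, decide_false, cond_false]
    have hP := parts_of_split h (split_part h hM (nontrivial_of_card hc))
    rw [ev_zval h.len h.symm h.loopless, hP.expand G (fun v : Fin n => ev D (mo.getD v []))
      (fun r s => ev D (wt (innerW D G mo memo M) r s))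
      (fun r s Y => s = innerState (fun r => fs n (part G M r)) r Y ∧ Covers H (fs n (part G M r)) Y)
      fun r hr s hs => (ev_innerW h mo memo M r hs
        (hmemo _ ((mem_children h).2 ⟨hc, r, hr, rfl⟩))).trans (by congr!)]
    refine Finset.sum_congr rfl fun X _ => ?_
    rw [← hP.sum_inner h X]
    congr!

/-- After as many rounds as there are vertices, all vertex cover polynomials are correct. -/
theorem ev_look_memoRun {D : ℕ} (h : Rep G H) (hn : 0 < n) (mo : List BV) (dec : Dec) {M : BV}
    (hM : M ∈ nodes G) : ev D (look n (memoRun D G mo dec) M) =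
      coverSum H (fun v : Fin n => ev D (mo.getD v [])) (fs n M) := by
  obtain ⟨-, hmod, -, hch⟩ := nodes_spec h hn
  let Good : ℕ → Memo → Prop := fun i memo => ∀ M ∈ nodes G, (fs n M).card ≤ i →
    ev D (look n memo M) = coverSum H (fun v : Fin n => ev D (mo.getD v [])) (fs n M)
  have hstep : ∀ i memo, Good i memo → Good (i + 1) (memoStep D G mo dec memo) := by
    intro i memo hg M hM hcard
    obtain ⟨M', hM', he, hl⟩ : ∃ M' ∈ nodes G, vs n M' = vs n M ∧
        look n (memoStep D G mo dec memo) M = compute D G mo dec memo M' := by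
      unfold look
      cases hc : (memoStep D G mo dec memo).filter fun x => eqV n x.1 M with
      | nil =>
        have : (M, compute D G mo dec memo M) ∈ (memoStep D G mo dec memo).filter fun x => eqV n x.1 M :=
          List.mem_filter.2 ⟨List.mem_map.2 ⟨M, hM, rfl⟩, eqV_iff.2 rfl⟩
        rw [hc] at this; simp at this
      | cons x l =>
        have : x ∈ (memoStep D G mo dec memo).filter fun x => eqV n x.1 M := by rw [hc]; simp
        obtain ⟨h3, h4⟩ := List.mem_filter.1 this
        obtain ⟨M', hM', rfl⟩ := List.mem_map.1 h3
        exact ⟨M', hM', eqV_iff.1 h4, rfl⟩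
    have hfs : fs n M' = fs n M := Finset.coe_injective (by rw [coe_fs, coe_fs, he])
    rw [hl, ev_compute h mo dec memo (hmod M' hM').2 (hmod M' hM').1 fun C hC => ?_, hfs]
    refine hg C (hch M' hM' C hC) ?_
    obtain ⟨hc, r, hr, rfl⟩ := (mem_children h).1 hC
    have hS := split_part h (hmod M' hM').2 (nontrivial_of_card hc)
    have hrM := ((mem_reps h hS).1 hr).1
    have : fs n (part G M' r) ⊂ fs n M' := by
      rw [← Finset.coe_ssubset, coe_fs, coe_fs]
      exact Set.ssubset_iff_subset_ne.2 ⟨hS.sub r hrM, hS.ne r hrM⟩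
    have := Finset.card_lt_card this
    rw [hfs] at this
    omega
  have hall : ∀ (l : List ℕ) i memo, Good i memo →
      Good (i + l.length) (l.foldl (fun memo _ => memoStep D G mo dec memo) memo) := by
    intro l
    induction l with
    | nil => exact fun i s hs => hs
    | cons a l ih =>
      intro i s hs
      rw [List.length_cons, ← add_assoc, add_right_comm]
      exact ih _ _ (hstep i s hs)
  have hinit : Good 0 [] := by
    intro M hM hc
    obtain ⟨u, hu⟩ := (hmod M hM).1
    have := Finset.card_pos.2 ⟨u, mem_fs_vs.2 hu⟩
    omega
  have := hall (List.range G.length) 0 [] hinit M hM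
  rw [List.length_range, zero_add, h.len] at this
  rw [memoRun, h.len]
  exact this (by simpa using (fs n M).card_le_univ)

end memo

end CVC
namespace CVC

/-! ### Correctness at the root -/

section rootcorrect
open Classical

variable {n : ℕ} {G : Gr} {H : SimpleGraph (Fin n)}

theorem allR_allR_iff {p : ℕ → ℕ → Bool} :
    allR n (fun i => allR n (p i)) = true ↔ ∀ i j : Fin n, p i j = true := by
  simp only [allR_eq_true]
  exact ⟨fun h i j => h i i.2 j j.2, fun h i hi j hj => h ⟨i, hi⟩ ⟨j, hj⟩⟩

theorem edgeless_iff (h : Rep G H) {P : BV} : edgeless G P = true ↔ Covers H (fs n P) ∅ := by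
  rw [edgeless, h.len, allR_allR_iff]
  unfold Covers
  simp only [mem_fs, Finset.notMem_empty, or_false, ← h.adj_iff]
  refine forall_congr' fun i => ⟨fun hi hiP j hjP hij => ?_, fun hi j => ?_⟩
  · simpa [hiP, hjP, hij] using hi j
  · cases h1 : mem P i <;> cases h2 : mem P j <;> cases h3 : adj G i j <;> simp
    exact hi h1 j h2 h3

theorem isVC_iff (h : Rep G H) {P : BV} : isVC G P = true ↔ Covers H Finset.univ (fs n P) := by
  rw [isVC, h.len, allR_allR_iff]
  unfold Covers
  simp only [mem_fs, Finset.mem_univ, forall_const, ← h.adj_iff]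
  refine forall₂_congr fun i j => ?_
  cases mem P i <;> cases mem P j <;> cases adj G i j <;> simp

/-- The component of the first vertex is everything if and only if the induced graph is connected.
-/
theorem firstComp_eq_iff_connIn (h : Rep G H) {M : BV} (hne : (vs n M).Nonempty) :
    vs n (firstComp G M false true) = vs n M ↔ ConnIn H (vs n M) := by
  constructor
  · rintro he Q ⟨a, ha, hQ⟩ hstep b hb
    have := firstComp_eq_of_closed h he (A := {x | x ∈ vs n M ∧ Q x}) (fun x hx => hx.1) ⟨a, ha, hQ⟩ ?_ ?_
    · rw [← this] at hb; exact hb.2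
    · intro w hw h1 _
      simp only [Bool.false_eq_true, false_or] at h1
      obtain ⟨x, hx, hxw⟩ := h1
      exact ⟨hw, hstep x hx.1 w hw hxw hx.2⟩
    · intro w hw h1 _
      simp only [Bool.false_eq_true, false_or] at h1
      obtain ⟨x, hx, hxw⟩ := h1
      exact ⟨hw, fun hQw => hx.2 ⟨hx.1, hstep w hw x hx.1 hxw.symm hQw.2⟩⟩
  · intro hc
    have hsub := firstComp_subset h hne false true
    obtain ⟨a, ha⟩ := firstComp_nonempty h hne false true
    refine subset_antisymm hsub (hc (· ∈ vs n (firstComp G M false true)) ⟨a, hsub ha, ha⟩ ?_)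
    intro x _ y hy hxy hxc
    by_contra hyc
    exact firstComp_homogeneous_false h hxc ⟨hy, hyc⟩ hxy

theorem ev_rootE {D : ℕ} (h : Rep G H) (x : Fin n → TP D) (P : BV) : ev D (rootE D G P) =
    ∑ Y ∈ (fs n P).powerset, if Y = ∅ ∧ Covers H (fs n P) Y then ∏ v ∈ Y, x v else 0 := by
  rw [Finset.sum_eq_single ∅]
  · unfold rootE
    by_cases he : Covers H (fs n P) ∅
    · rw [(edgeless_iff h).2 he]; simp [he, ev_monoP]
    · rw [Bool.eq_false_iff.2 fun h' => he ((edgeless_iff h).1 h')]; simp [he, ev_nil]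
  · intro Y _ hY; simp [hY]
  · intro hcon; simp at hcon

theorem ev_rootP {D : ℕ} (h : Rep G H) (mo : List BV) (memo : Memo) (P : BV) (hP : (fs n P).Nonempty)
    (hlook : ev D (look n memo P) = coverSum H (fun v : Fin n => ev D (mo.getD v [])) (fs n P)) :
    ev D (rootP D G mo memo P) = ∑ Y ∈ (fs n P).powerset,
      if Y ≠ ∅ ∧ Y ≠ fs n P ∧ Covers H (fs n P) Y then ∏ v ∈ Y, ev D (mo.getD v []) else 0 := by
  rw [rootP, ev_addP, ev_addP, h.len, hlook, ev_fullP h,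
    ev_rootE h (fun v : Fin n => ev D (mo.getD v [])), add_right_comm, ← sum_nonfull two_TP,
    ← Finset.sum_add_distrib]
  refine Finset.sum_congr rfl fun Y _ => ?_
  by_cases h1 : Y = ∅
  · subst h1
    by_cases h2 : Covers H (fs n P) ∅
    · simp [h2, hP.ne_empty.symm, two_TP]
    · simp [h2]
  · simp [h1]

theorem rootState_empty {P : Fin n → Finset (Fin n)} {j r : Fin n} {Y : Finset (Fin n)}
    (hne : (P r).Nonempty) : RootState H P j r stE Y ↔ r ≠ j ∧ Y = ∅ ∧ Covers H (P r) Y := by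
  have := hne.ne_empty
  unfold RootState stE
  by_cases hY : Y = ∅
  · subst hY; simp [this.symm]; tauto
  · simp [hY]

theorem rootState_partial {P : Fin n → Finset (Fin n)} {j r : Fin n} {c : Bool}
    {Y : Finset (Fin n)} : RootState H P j r (true, false, c) Y ↔
      ((r = j → c = false) ∧ ¬ r < j) ∧ Y ≠ ∅ ∧ Y ≠ P r ∧ Covers H (P r) Y := by
  unfold RootState
  by_cases hY : Y = ∅
  · simp [hY]
  · simp [hY, Finset.nonempty_iff_ne_empty]; tauto

theorem rootState_full {P : Fin n → Finset (Fin n)} {j r : Fin n} {c : Bool} {Y : Finset (Fin n)}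
    (hne : (P r).Nonempty) : RootState H P j r (true, true, c) Y ↔
      ((r = j → c = false) ∧ ¬ r < j) ∧ Y = P r := by
  have := hne.ne_empty
  unfold RootState
  by_cases hY : Y = P r
  · subst hY; simp [covers_self, hne, this]
  · simp [hY]

/-- The weight of a state is the sum over the vertex covers of the part that have this state. -/
theorem ev_rootW {D : ℕ} (h : Rep G H) (mo : List BV) (memo : Memo) (j r : Fin n) {s : St}
    (hs : s ∈ statesF) (hr : r ∈ fs n (part G (allV G) r))
    (hlook : ev D (look n memo (part G (allV G) r)) =
      coverSum H (fun v : Fin n => ev D (mo.getD v [])) (fs n (part G (allV G) r))) :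
    ev D (wt (rootW D G mo memo j) r s) = ∑ Y ∈ (fs n (part G (allV G) r)).powerset,
      if RootState H (fun r => fs n (part G (allV G) r)) j r s Y then
        ∏ v ∈ Y, ev D (mo.getD v []) else 0 := by
  rw [wt, rootW, h.len, getD_map_range]
  have hne : (fs n (part G (allV G) r)).Nonempty := ⟨r, hr⟩
  have hE := ev_rootE h (fun v : Fin n => ev D (mo.getD v [])) (part G (allV G) r)
  have hPp := ev_rootP h mo memo (part G (allV G) r) hne hlook
  have hF : ev D (fullP D G mo (part G (allV G) r)) = ∑ Y ∈ (fs n (part G (allV G) r)).powerset,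
      if Y = fs n (part G (allV G) r) then ∏ v ∈ Y, ev D (mo.getD v []) else 0 := by
    rw [ev_fullP h, Finset.sum_ite_eq' _ (fs n (part G (allV G) r))]; simp
  have hZ : ∀ {p : Finset (Fin n) → Prop}, (∀ Y, ¬ p Y) → ev D [] =
      ∑ Y ∈ (fs n (part G (allV G) r)).powerset, if p Y then ∏ v ∈ Y, ev D (mo.getD v []) else 0 := by
    intro p hp
    rw [ev_nil, Finset.sum_eq_zero fun Y _ => if_neg (hp Y)]
  simp only [statesF, states, List.toFinset_cons, List.toFinset_nil, Finset.mem_insert,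
    Finset.notMem_empty, or_false] at hs
  have hval : ∀ (X : BV) {p q : Finset (Fin n) → Prop} [DecidablePred p] [DecidablePred q], ev D X =
      (∑ Y ∈ (fs n (part G (allV G) r)).powerset, if p Y then ∏ v ∈ Y, ev D (mo.getD v []) else 0) →
      (∀ Y, q Y ↔ p Y) → ev D X = ∑ Y ∈ (fs n (part G (allV G) r)).powerset,
        if q Y then ∏ v ∈ Y, ev D (mo.getD v []) else 0 := by
    intro X p q _ _ hX hpq
    rw [hX]
    exact Finset.sum_congr rfl fun Y _ => if_congr (hpq Y).symm rfl rfl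
  have i0 := fun Y => rootState_empty (H := H) (P := fun r => fs n (part G (allV G) r)) (j := j)
    (Y := Y) hne
  have i1 := fun c Y => rootState_partial (H := H) (P := fun r => fs n (part G (allV G) r)) (j := j)
    (r := r) (c := c) (Y := Y)
  have i2 := fun c Y => rootState_full (H := H) (P := fun r => fs n (part G (allV G) r)) (j := j)
    (c := c) (Y := Y) hne
  rcases lt_trichotomy r j with hrj | rfl | hrj
  · have h1 : ((r : ℕ) == (j : ℕ)) = false := by simpa [Fin.ext_iff] using hrj.ne
    have h2 : decide ((r : ℕ) ≤ j) = true := by simpa using hrj.le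
    rw [h1, h2, cond_false, cond_true]
    rcases hs with rfl | rfl | rfl | rfl | rfl
    · refine hval (rootE D G (part G (allV G) r)) hE fun Y => ?_
      rw [i0]; simp [hrj.ne]
    · exact hZ fun Y => by rw [i1]; simp [hrj]
    · exact hZ fun Y => by rw [i1]; simp [hrj]
    · exact hZ fun Y => by rw [i2]; simp [hrj]
    · exact hZ fun Y => by rw [i2]; simp [hrj]
  · have h1 : ((r : ℕ) == (r : ℕ)) = true := by simp
    rw [h1, cond_true]
    rcases hs with rfl | rfl | rfl | rfl | rfl
    · exact hZ fun Y => by rw [i0]; simp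
    · refine hval (rootP D G mo memo (part G (allV G) r)) hPp fun Y => ?_
      rw [i1]; simp
    · exact hZ fun Y => by rw [i1]; simp
    · refine hval (fullP D G mo (part G (allV G) r)) hF fun Y => ?_
      rw [i2]; simp
    · exact hZ fun Y => by rw [i2]; simp
  · have h1 : ((r : ℕ) == (j : ℕ)) = false := by simpa [Fin.ext_iff] using hrj.ne'
    have h2 : decide ((r : ℕ) ≤ j) = false := by simpa using hrj
    rw [h1, h2, cond_false, cond_false]
    have h3 : r ≠ j := hrj.ne'
    have h4 : ¬ r < j := hrj.not_gt
    rcases hs with rfl | rfl | rfl | rfl | rfl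
    · refine hval (rootE D G (part G (allV G) r)) hE fun Y => ?_
      rw [i0]; simp [h3]
    · refine hval (rootP D G mo memo (part G (allV G) r)) hPp fun Y => ?_
      rw [i1]; simp [h3, h4]
    · refine hval (rootP D G mo memo (part G (allV G) r)) hPp fun Y => ?_
      rw [i1]; simp [h3, h4]
    · refine hval (fullP D G mo (part G (allV G) r)) hF fun Y => ?_
      rw [i2]; simp [h3, h4]
    · refine hval (fullP D G mo (part G (allV G) r)) hF fun Y => ?_
      rw [i2]; simp [h3, h4]

theorem ev_corr {D : ℕ} (h : Rep G H) (mo : List BV) (r : Fin n)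
    (hr : r ∈ fs n (part G (allV G) r)) :
    ev D (corr D G mo r) = if Covers H Finset.univ (fs n (part G (allV G) r)) ∧
      ¬ ConnIn H (fs n (part G (allV G) r) : Set (Fin n)) then
        ∏ v ∈ fs n (part G (allV G) r), ev D (mo.getD v []) else 0 := by
  have h1 : (isVC G (part G (allV G) r) && !eqV n (firstComp G (part G (allV G) r) false true)
      (part G (allV G) r)) = true ↔ Covers H Finset.univ (fs n (part G (allV G) r)) ∧
      ¬ ConnIn H (fs n (part G (allV G) r) : Set (Fin n)) := by
    rw [Bool.and_eq_true, isVC_iff h, Bool.not_eq_true', ← Bool.not_eq_true, eqV_iff,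
      firstComp_eq_iff_connIn h ⟨r, mem_fs_vs.1 hr⟩, coe_fs]
  unfold corr
  rw [h.len]
  split_ifs with hc
  · rw [h1.2 hc, cond_true, ev_fullP h]
  · rw [Bool.eq_false_iff.2 fun h' => hc (h1.1 h'), cond_false, ev_nil]

theorem vs_allV (h : Rep G H) : vs n (allV G) = Set.univ := by
  rw [allV, h.len, vs_mkV]; simp

theorem fs_allV (h : Rep G H) : fs n (allV G) = Finset.univ := by
  rw [← Finset.coe_inj, coe_fs, vs_allV h, Finset.coe_univ]

theorem isModule_univ : IsModule H Set.univ :=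
  isModule_iff.2 fun _ _ _ _ _ hx => absurd trivial hx

theorem card_allV (h : Rep G H) : cardV n (allV G) = n := by
  rw [card_fs, fs_allV h]; simp

theorem split_allV (h : Rep G H) (hn : 2 ≤ n) :
    Split H (vs n (allV G)) fun u => vs n (part G (allV G) u) :=
  split_part h (by rw [vs_allV h]; exact isModule_univ)
    (nontrivial_of_card (by rw [card_allV h]; omega))

/-- The algorithm computes the sum of the monomials of all connected vertex covers. -/
theorem ev_total {D : ℕ} (h : Rep G H) (hH : H.Connected) (hn : 2 ≤ n) (mo : List BV) (dec : Dec) :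
    ev D (total D G mo dec) = ∑ X : Finset (Fin n), if Covers H Finset.univ X ∧ ConnIn H X then
      ∏ v ∈ X, ev D (mo.getD v []) else 0 := by
  have hS := split_allV h hn
  have hP := parts_of_split h hS
  rw [fs_allV h] at hP
  obtain ⟨-, -, hroot, hch⟩ := nodes_spec h (by omega)
  have hlook : ∀ r ∈ fs n (reps G (allV G)), ev D (look n (memoRun D G mo dec) (part G (allV G) r)) =
      coverSum H (fun v : Fin n => ev D (mo.getD v [])) (fs n (part G (allV G) r)) :=
    fun r hr => ev_look_memoRun h (by omega) mo dec (hch _ hroot _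
      ((mem_children h).2 ⟨by rw [card_allV h]; omega, r, hr, rfl⟩))
  have hne : ∀ r ∈ fs n (reps G (allV G)), fs n (part G (allV G) r) ≠ Finset.univ := by
    intro r hr he
    refine hS.ne r ((mem_reps h hS).1 hr).1 ?_
    rw [← coe_fs, he, vs_allV h, Finset.coe_univ]
  rw [total, h.len, decide_eq_false (by omega), cond_false, rootVal, ev_sumP, List.map_append,
    List.sum_append, List.map_map, List.map_map, anchors, h.len, sum_elems, sum_elems,
    ← hP.sum_connected hH hne (fun v : Fin n => ev D (mo.getD v [])) two_TP]
  congr 1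
  · rw [Finset.sum_congr rfl fun X _ => (hP.sum_root h X (two_TP (∏ v ∈ X, ev D (mo.getD v [])))).symm,
      Finset.sum_comm]
    refine Finset.sum_congr rfl fun j hj => ?_
    rw [← hP.expand G (fun v : Fin n => ev D (mo.getD v []))
      (fun r s => ev D (wt (rootW D G mo (memoRun D G mo dec) j) r s)) _
      fun r hr s hs => ev_rootW h mo _ j r hs (hP.self r hr) (hlook r hr)]
    exact ev_zval h.len h.symm h.loopless _ _ _
  · exact Finset.sum_congr rfl fun r hr => ev_corr h mo r (hP.self r hr)

end rootcorrect

/-! ### The number of steps -/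

section cost
variable {n : ℕ} {G : Gr} {H : SimpleGraph (Fin n)}

theorem sum_map_le {β : Type*} (l : List β) (f : β → ℕ) (c : ℕ) (hf : ∀ x ∈ l, f x ≤ c) :
    (l.map f).sum ≤ l.length * c := by
  have := List.sum_le_card_nsmul (l.map f) c (by simpa using hf)
  simpa using this

/-- At most `2 * n` modules are processed in each of `n` rounds, and at most `n` sums are computed
at the root. -/
theorem totalCost_le (h : Rep G H) (hn : 0 < n) {dec : Dec} {k : ℕ} (hdec : RepDec H dec k) (D : ℕ)
    (mo : List BV) : totalCost D G mo dec ≤ (2 * n * n * n + n * n) * 5 ^ (k + 1) := by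
  obtain ⟨hlen, hmod, -, -⟩ := nodes_spec h hn
  unfold totalCost
  rw [h.len]
  by_cases hn1 : n ≤ 1
  · simp [hn1]
  simp only [hn1, decide_false, cond_false]
  rw [add_mul]
  refine Nat.add_le_add ?_ ?_
  · have hmemo : ∀ memo, ((nodes G).map fun M => compCost D G mo dec memo M).sum ≤
        2 * n * (n * 5 ^ (k + 1)) := by
      intro memo
      refine (sum_map_le _ _ (n * 5 ^ (k + 1)) fun M hM => ?_).trans (Nat.mul_le_mul_right _ hlen)
      unfold compCost
      rw [h.len]
      by_cases hc : cardV n M ≤ 1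
      · simp [hc]
      · simp only [hc, decide_false, cond_false]
        exact elimCost_le h.len D _ (bagOK_bags h (hmod M hM).2 (nontrivial_of_card hc) hdec)
    have hfold : ∀ (l : List ℕ) memo,
        foldCost (fun memo (_ : ℕ) => ((nodes G).map fun M => compCost D G mo dec memo M).sum)
          (fun memo _ => memoStep D G mo dec memo) memo l ≤ l.length * (2 * n * (n * 5 ^ (k + 1))) := by
      intro l
      induction l with
      | nil => simp [foldCost]
      | cons x l ih =>
        intro memo
        have h1 := ih (memoStep D G mo dec memo)
        have h2 := hmemo memo
        simp only [foldCost, List.length_cons, add_mul, one_mul]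
        omega
    refine (hfold _ _).trans (le_of_eq ?_)
    rw [List.length_range]; ring
  · unfold rootCost anchors
    rw [h.len]
    refine (sum_map_le _ _ (n * 5 ^ (k + 1)) fun j _ => ?_).trans ?_
    · exact elimCost_le h.len D _ (bagOK_bags h (by rw [vs_allV h]; exact isModule_univ)
        (nontrivial_of_card (by rw [card_allV h]; omega)) hdec)
    · rw [elems_length, mul_assoc]
      exact Nat.mul_le_mul_right _ (by simpa using (fs n (reps G (allV G))).card_le_univ)

end cost

end CVC
namespace CVC
open Polynomial

/-! ### Isolation by random weights -/

section isolation
variable {m n ℓ : ℕ}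

/-- The bits of the random string that determine the weight of `v`. -/
def block (hm : n * ℓ ≤ m) (r : Fin m → Bool) (v : Fin n) (i : Fin ℓ) : Bool :=
  r ⟨v * ℓ + i, by
    have := Nat.mul_le_mul_right ℓ (Nat.succ_le_iff.2 v.2)
    rw [Nat.succ_mul] at this
    omega⟩

theorem block_index_inj {v w : ℕ} {i j : ℕ} (hi : i < ℓ) (hj : j < ℓ)
    (h : v * ℓ + i = w * ℓ + j) : v = w ∧ i = j := by
  have hℓ : 0 < ℓ := by omega
  have h1 : (v * ℓ + i) / ℓ = v := by
    rw [mul_comm, Nat.mul_add_div hℓ, Nat.div_eq_of_lt hi, add_zero]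
  have h2 : (w * ℓ + j) / ℓ = w := by
    rw [mul_comm, Nat.mul_add_div hℓ, Nat.div_eq_of_lt hj, add_zero]
  have h3 : v = w := by rw [← h1, h, h2]
  subst h3
  exact ⟨rfl, by omega⟩

/-- The weight of `X` for fixed weights `c` and random weights `e`. -/
def weight (hm : n * ℓ ≤ m) (c : Fin n → ℕ) (e : (Fin ℓ → Bool) → ℕ) (r : Fin m → Bool)
    (X : Finset (Fin n)) : ℕ := ∑ v ∈ X, (c v + e (block hm r v))

/-- The vertex `v` lies in some but not all minimum weight members of `S`. -/
def Ambiguous (hm : n * ℓ ≤ m) (c : Fin n → ℕ) (e : (Fin ℓ → Bool) → ℕ)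
    (S : Finset (Finset (Fin n))) (v : Fin n) (r : Fin m → Bool) : Prop :=
  ∃ X ∈ S, ∃ Y ∈ S, v ∈ X ∧ v ∉ Y ∧ weight hm c e r X = weight hm c e r Y ∧
    ∀ Z ∈ S, weight hm c e r X ≤ weight hm c e r Z

theorem weight_of_notMem {hm : n * ℓ ≤ m} {c : Fin n → ℕ} {e : (Fin ℓ → Bool) → ℕ} {v : Fin n}
    {r r' : Fin m → Bool} (h : ∀ w ≠ v, block hm r w = block hm r' w) {X : Finset (Fin n)}
    (hv : v ∉ X) : weight hm c e r X = weight hm c e r' X :=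
  Finset.sum_congr rfl fun w hw => by rw [h w fun h' => hv (h' ▸ hw)]

theorem weight_of_mem {hm : n * ℓ ≤ m} {c : Fin n → ℕ} {e : (Fin ℓ → Bool) → ℕ} {v : Fin n}
    {r r' : Fin m → Bool} (h : ∀ w ≠ v, block hm r w = block hm r' w) {X : Finset (Fin n)}
    (hv : v ∈ X) : weight hm c e r X + e (block hm r' v) = weight hm c e r' X + e (block hm r v) := by
  have : ∑ w ∈ X.erase v, (c w + e (block hm r w)) = ∑ w ∈ X.erase v, (c w + e (block hm r' w)) :=
    Finset.sum_congr rfl fun w hw => by rw [h w (Finset.ne_of_mem_erase hw)]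
  unfold weight
  rw [← Finset.add_sum_erase X _ hv, ← Finset.add_sum_erase X (fun v => c v + e (block hm r' v)) hv, this]
  ring

/-- If the bits outside the block of `v` are fixed, then `v` is ambiguous for at most one weight,
namely the difference of the minimum weights of the members without `v` and, up to the random weight
of `v`, with `v`. -/
theorem Ambiguous.le {hm : n * ℓ ≤ m} {c : Fin n → ℕ} {e : (Fin ℓ → Bool) → ℕ}
    {S : Finset (Finset (Fin n))} {v : Fin n} {r r' : Fin m → Bool} (hr : Ambiguous hm c e S v r)
    (hr' : Ambiguous hm c e S v r') (h : ∀ w ≠ v, block hm r w = block hm r' w) :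
    e (block hm r v) ≤ e (block hm r' v) := by
  obtain ⟨X, hX, Y, hY, hvX, hvY, heq, hmin⟩ := hr
  obtain ⟨X', hX', Y', hY', hvX', hvY', heq', hmin'⟩ := hr'
  have h1 := hmin Y' hY'
  have h2 := hmin' X hX
  have h4 := weight_of_notMem (c := c) (e := e) h hvY'
  have h5 := weight_of_mem (c := c) (e := e) h hvX
  omega

open Classical in
/-- A vertex is ambiguous with probability at most `2 ^ (-ℓ)`. -/
theorem card_ambiguous (hm : n * ℓ ≤ m) (c : Fin n → ℕ) {e : (Fin ℓ → Bool) → ℕ}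
    (he : Function.Injective e) (S : Finset (Finset (Fin n))) (v : Fin n) :
    (Finset.univ.filter (Ambiguous hm c e S v)).card * 2 ^ ℓ ≤ 2 ^ m := by
  -- overwrite the block of `v` by arbitrary bits
  let f : (Fin m → Bool) × (Fin ℓ → Bool) → (Fin m → Bool) := fun x i =>
    if h : ∃ j : Fin ℓ, (i : ℕ) = v * ℓ + j then x.2 h.choose else x.1 i
  have hf1 : ∀ x, block hm (f x) v = x.2 := by
    intro x; funext j
    have hex : ∃ j' : Fin ℓ, (v * ℓ + j : ℕ) = v * ℓ + j' := ⟨j, rfl⟩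
    simp only [block, f]
    rw [dif_pos hex]
    have hj : hex.choose = j := Fin.ext (by have := hex.choose_spec; omega)
    exact congrArg x.2 hj
  have hf2 : ∀ x (i : Fin m), (¬ ∃ j : Fin ℓ, (i : ℕ) = v * ℓ + j) → f x i = x.1 i := fun x i h => dif_neg h
  have hcard := Finset.card_le_card_of_injOn (s := Finset.univ.filter (Ambiguous hm c e S v) ×ˢ
    (Finset.univ : Finset (Fin ℓ → Bool))) (t := (Finset.univ : Finset (Fin m → Bool))) f
    (fun _ _ => Finset.mem_univ _) (by
      rintro ⟨r, t⟩ h1 ⟨r', t'⟩ h2 h3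
      simp only [Finset.coe_product, Set.mem_prod, Finset.mem_coe, Finset.mem_filter, Finset.mem_univ,
        true_and, and_true] at h1 h2
      have ht : t = t' := (hf1 (r, t)).symm.trans ((congrArg (block hm · v) h3).trans (hf1 (r', t')))
      have hout : ∀ i : Fin m, (¬ ∃ j : Fin ℓ, (i : ℕ) = v * ℓ + j) → r i = r' i := by
        intro i hi
        have := hf2 (r, t) i hi
        rw [h3, hf2 _ i hi] at this
        exact this.symm
      have hblock : ∀ w ≠ v, block hm r w = block hm r' w := by
        intro w hw; funext i
        refine hout _ ?_
        rintro ⟨j, hj⟩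
        exact hw (Fin.ext (block_index_inj i.2 j.2 hj).1)
      have hv : block hm r v = block hm r' v :=
        he (le_antisymm (h1.le h2 hblock) (h2.le h1 fun w hw => (hblock w hw).symm))
      refine Prod.ext (funext fun i => ?_) ht
      by_cases hi : ∃ j : Fin ℓ, (i : ℕ) = v * ℓ + j
      · obtain ⟨j, hj⟩ := hi
        have := congrFun hv j
        simp only [block, ← hj] at this
        exact this
      · exact hout i hi)
  simpa [Finset.card_product] using hcard

open Classical in
/-- If every random weight is uniformly distributed on a set of size at least `2 * n`, then the
minimum weight member of `S` is unique with probability at least one half. -/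
theorem isolation (hm : n * ℓ ≤ m) (hℓ : 2 * n ≤ 2 ^ ℓ) (c : Fin n → ℕ) {e : (Fin ℓ → Bool) → ℕ}
    (he : Function.Injective e) {S : Finset (Finset (Fin n))} (hS : S.Nonempty) :
    2 * (Finset.univ.filter fun r : Fin m → Bool => ¬ ∃ X ∈ S, ∀ Y ∈ S, Y ≠ X →
      weight hm c e r X < weight hm c e r Y).card ≤ 2 ^ m := by
  have hsub : (Finset.univ.filter fun r : Fin m → Bool => ¬ ∃ X ∈ S, ∀ Y ∈ S, Y ≠ X →
      weight hm c e r X < weight hm c e r Y) ⊆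
      Finset.univ.biUnion fun v => Finset.univ.filter (Ambiguous hm c e S v) := by
    intro r hr
    simp only [Finset.mem_filter, Finset.mem_univ, true_and, Finset.mem_biUnion] at hr ⊢
    push Not at hr
    obtain ⟨X, hX, hmin⟩ := S.exists_min_image (weight hm c e r) hS
    obtain ⟨Y, hY, hYX, hle⟩ := hr X hX
    have heq : weight hm c e r X = weight hm c e r Y := le_antisymm (hmin Y hY) hle
    -- a vertex in the symmetric difference of two minimum weight sets is ambiguous
    by_cases h : X ⊆ Y
    · obtain ⟨v, hv, hvX⟩ := Finset.exists_of_ssubset (Finset.ssubset_iff_subset_ne.2 ⟨h, hYX.symm⟩)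
      exact ⟨v, Y, hY, X, hX, hv, hvX, heq.symm, fun Z hZ => heq ▸ hmin Z hZ⟩
    · obtain ⟨v, hv, hvY⟩ := Finset.not_subset.1 h
      exact ⟨v, X, hX, Y, hY, hv, hvY, heq, hmin⟩
  have h1 := (Finset.card_le_card hsub).trans Finset.card_biUnion_le
  have h2 : (∑ v : Fin n, (Finset.univ.filter (Ambiguous hm c e S v)).card) * 2 ^ ℓ ≤ n * 2 ^ m := by
    rw [Finset.sum_mul]
    refine (Finset.sum_le_card_nsmul _ _ _ fun v _ => card_ambiguous hm c he S v).trans ?_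
    simp
  have h3 := Nat.mul_le_mul_right (2 ^ ℓ) h1
  rcases Nat.eq_zero_or_pos n with rfl | hn
  · rw [Nat.le_zero.1 (h1.trans (by simp))]; simp
  · refine Nat.le_of_mul_le_mul_left ?_ hn
    refine le_trans ?_ (h3.trans h2)
    rw [← mul_assoc, mul_comm n 2, mul_comm _ (2 ^ ℓ)]
    exact Nat.mul_le_mul_right _ hℓ

end isolation

/-! ### Reading off the answer -/

section answer
open Classical

theorem length_addP (D : ℕ) (p q : BV) : (addP D p q).length = D := by simp [addP]

theorem length_sumP (D : ℕ) (l : List BV) : (sumP D l).length ≤ D := by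
  unfold sumP
  have : ∀ p : BV, p.length ≤ D → (l.foldl (addP D) p).length ≤ D := by
    induction l with
    | nil => exact fun p hp => hp
    | cons x l ih => exact fun p _ => ih _ (length_addP D p x).le
  exact this [] (Nat.zero_le _)

theorem length_total (D : ℕ) (G : Gr) (mo : List BV) (dec : Dec) : (total D G mo dec).length ≤ D := by
  unfold total
  cases decide (G.length ≤ 1)
  · exact length_sumP _ _
  · simp [monoP]

/-- A bit vector without superfluous bits has a bit set if and only if its polynomial is nonzero. -/
theorem any_iff_ev_ne_zero {D : ℕ} {p : BV} (hp : p.length ≤ D) :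
    (p.any fun b => b) = true ↔ ev D p ≠ 0 := by
  have h0 : ev D p = 0 ↔ ∀ i < D, mem p i = false := by
    rw [ev, ← map_zero (Ideal.Quotient.mk _), mk_eq_iff]
    refine forall₂_congr fun i hi => ?_
    rw [coeff_polyOf _ _ _ hi]
    cases mem p i <;> simp
  rw [Ne, h0, List.any_eq_true]
  push Not
  constructor
  · rintro ⟨b, hb, rfl⟩
    obtain ⟨i, hi, h⟩ := List.mem_iff_getElem.1 hb
    exact ⟨i, by omega, by simp [mem, hi, h]⟩
  · rintro ⟨i, -, h⟩
    refine ⟨true, ?_, rfl⟩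
    unfold mem at h
    by_cases hi : i < p.length
    · rw [List.getD_eq_getElem _ _ hi] at h
      simp only [ne_eq, Bool.not_eq_false] at h
      exact h ▸ List.getElem_mem hi
    · simp [List.getD_eq_getElem?_getD, List.getElem?_eq_none (not_lt.1 hi)] at h

variable {n D : ℕ} (C : Finset (Fin n) → Prop) (ω : Finset (Fin n) → ℕ)

/-- The sum vanishes if and only if every weight below `D` is attained by an even number of sets. -/
theorem sum_zz_eq_zero_iff : (∑ X : Finset (Fin n), if C X then zz D ^ ω X else 0) = 0 ↔
    ∀ i < D, (((Finset.univ.filter fun X => C X ∧ ω X = i).card : ℕ) : ZMod 2) = 0 := by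
  have : (∑ X : Finset (Fin n), if C X then zz D ^ ω X else 0) = Ideal.Quotient.mk _
      (∑ X : Finset (Fin n), if C X then (Polynomial.X : (ZMod 2)[X]) ^ ω X else 0) := by
    rw [map_sum]
    refine Finset.sum_congr rfl fun X _ => ?_
    split_ifs
    · rw [map_pow]; rfl
    · rw [map_zero]
  rw [this, ← map_zero (Ideal.Quotient.mk _), mk_eq_iff]
  refine forall₂_congr fun i _ => ?_
  rw [finsetSum_coeff, coeff_zero, Finset.card_filter, Nat.cast_sum]
  refine Eq.congr (Finset.sum_congr rfl fun X _ => ?_) rfl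
  by_cases h1 : C X <;> by_cases h2 : ω X = i <;> simp [h1, h2, coeff_X_pow, eq_comm]
  intro h; exact absurd h.symm h2

theorem sum_zz_eq_zero (h : ∀ X, C X → D ≤ ω X) :
    (∑ X : Finset (Fin n), if C X then zz D ^ ω X else 0) = 0 := by
  rw [sum_zz_eq_zero_iff]
  intro i hi
  rw [Finset.filter_false_of_mem, Finset.card_empty, Nat.cast_zero]
  rintro X - ⟨h1, h2⟩
  have := h X h1
  omega

/-- The monomial of a set with a unique weight does not cancel. -/
theorem sum_zz_ne_zero {X : Finset (Fin n)} (hX : C X) (hD : ω X < D)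
    (hmin : ∀ Y, C Y → Y ≠ X → ω Y ≠ ω X) :
    (∑ X : Finset (Fin n), if C X then zz D ^ ω X else 0) ≠ 0 := by
  rw [Ne, sum_zz_eq_zero_iff]
  intro h
  have h1 := h (ω X) hD
  have h2 : (Finset.univ.filter fun Y => C Y ∧ ω Y = ω X) = {X} := by
    refine Finset.eq_singleton_iff_unique_mem.2 ⟨by simp [hX], fun Y hY => ?_⟩
    obtain ⟨-, h3, h4⟩ := Finset.mem_filter.1 hY
    by_contra hne
    exact hmin Y h3 hne h4
  rw [h2] at h1
  simp at h1

end answer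

/-! ### Random weights from bits -/

/-- The powers of two reach `2 * n` after at most `2 * n` doublings. -/
theorem logPow_spec (n : ℕ) : (logPow n).2 = 2 ^ (logPow n).1 ∧ (logPow n).1 ≤ 2 * n ∧
    2 * n ≤ (logPow n).2 := by
  let Inv : ℕ → ℕ × ℕ → Prop := fun i s => s.2 = 2 ^ s.1 ∧ s.1 ≤ i ∧ (2 * n ≤ s.2 ∨ s.1 = i)
  have hall : ∀ (l : List ℕ) i s, Inv i s → Inv (i + l.length)
      (l.foldl (fun s _ => cond (decide (2 * n ≤ s.2)) s (s.1 + 1, s.2 + s.2)) s) := by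
    intro l
    induction l with
    | nil => exact fun i s hs => hs
    | cons a l ih =>
      intro i s hs
      rw [List.length_cons, ← add_assoc, add_right_comm]
      refine ih _ _ ?_
      obtain ⟨h1, h2, h3⟩ := hs
      by_cases h : 2 * n ≤ s.2
      · simp only [h, decide_true, cond_true]
        exact ⟨h1, by omega, Or.inl h⟩
      · simp only [h, decide_false, cond_false]
        refine ⟨by simp only [h1, pow_succ]; omega, by simp only; omega, Or.inr ?_⟩
        simp only; omega
  have := hall (List.range (2 * n)) 0 (0, 1) ⟨rfl, le_rfl, Or.inr rfl⟩
  rw [List.length_range, zero_add] at this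
  obtain ⟨h1, h2, h3⟩ := this
  refine ⟨h1, h2, h3.elim id fun h => ?_⟩
  have h4 : (logPow n).2 = 2 ^ (logPow n).1 := h1
  have h5 : (logPow n).1 = 2 * n := h
  rw [h4, h5]
  exact Nat.lt_two_pow_self.le

theorem bval_lt (l : List Bool) : bval l < 2 ^ l.length := by
  induction l with
  | nil => simp [bval_nil]
  | cons b l ih =>
    rw [bval_cons, List.length_cons, pow_succ]
    cases b <;> simp <;> omega

theorem bval_injective {l l' : List Bool} (hl : l.length = l'.length) (h : bval l = bval l') : l = l' := by
  induction l generalizing l' with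
  | nil => cases l' with
    | nil => rfl
    | cons b l' => simp at hl
  | cons b l ih => cases l' with
    | nil => simp at hl
    | cons b' l' =>
      rw [bval_cons, bval_cons] at h
      simp only [List.length_cons, Nat.add_right_cancel_iff] at hl
      have : b = b' ∧ bval l = bval l' := by
        cases b <;> cases b' <;> simp at h ⊢ <;> omega
      rw [this.1, ih hl this.2]

end CVC
namespace CVC
open Enc

/-! ### The input as a value of the typed language -/

section input
open Classical

/-- A set of vertices as a bit vector. -/
noncomputable def bvOf {n : ℕ} (S : Set (Fin n)) : BV := List.ofFn fun i => decide (i ∈ S)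

/-- A graph as its adjacency matrix. -/
noncomputable def grOf {n : ℕ} (H : SimpleGraph (Fin n)) : Gr := List.ofFn fun i => bvOf (H.neighborSet i)

/-- A tree decomposition of a quotient graph, with every bag replaced by the union of its
elements. -/
noncomputable def decompOf {n : ℕ} {H : SimpleGraph (Fin n)} {M : Set (Fin n)}
    (D : TreeDecomposition (nodeQuotient H M)) : Gr × List BV :=
  (grOf D.tree, List.ofFn fun t => bvOf {v : Fin n | ∃ B ∈ D.bag t, ∃ h : v ∈ M, (⟨v, h⟩ : M) ∈ B.1})

/-- The given tree decompositions as data of the typed language. -/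
noncomputable def decOf (I : Input) : Dec := I.decomps.map fun D => (bvOf D.1, decompOf D.2)

/-- The input and the random bits as data of the typed language. -/
noncomputable def inpOf (I : Input) {m : ℕ} (r : Fin m → Bool) : Inp :=
  ((grOf I.graph, ((List.ofFn fun v => BinNat.mk (I.cost v)),
    ((decide (I.budget < 0), I.budget.natAbs.bits), decOf I))), List.ofFn r)

theorem enc_grOf {n : ℕ} (H : SimpleGraph (Fin n)) : enc (grOf H) = encGraph H := by
  change encList ((List.ofFn fun i => bvOf (H.neighborSet i)).map enc) = _
  rw [List.map_ofFn]
  rfl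

theorem enc_decompOf {n : ℕ} {H : SimpleGraph (Fin n)} {M : Set (Fin n)}
    (D : TreeDecomposition (nodeQuotient H M)) : enc (decompOf D) = encDecomp D := by
  change Val.pair (enc (grOf D.tree)) (encList (List.map enc (List.ofFn _))) = _
  rw [enc_grOf, List.map_ofFn]
  rfl

/-- The typed data are represented by the prescribed encoding of the input. -/
theorem enc_inpOf (I : Input) {m : ℕ} (r : Fin m → Bool) :
    enc (inpOf I r) = withRandom I.encode r := by
  change Val.pair (.pair (enc (grOf I.graph)) (.pair (encList (List.map enc (List.ofFn _)))
    (.pair (.pair _ _) (encList (List.map enc (List.map _ _)))))) _ = _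
  rw [enc_grOf, List.map_ofFn, List.map_map]
  unfold withRandom Input.encode
  congr 5
  refine List.map_congr_left fun D _ => ?_
  change Val.pair (enc (bvOf D.1)) (enc (decompOf D.2)) = _
  rw [enc_decompOf]
  rfl

theorem mem_bvOf {n : ℕ} (S : Set (Fin n)) (i : Fin n) : mem (bvOf S) i = true ↔ i ∈ S := by
  simp [mem, bvOf]

theorem vs_bvOf {n : ℕ} (S : Set (Fin n)) : vs n (bvOf S) = S := by
  ext i; rw [mem_vs, mem_bvOf]

theorem rep_grOf {n : ℕ} (H : SimpleGraph (Fin n)) : Rep (grOf H) H := by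
  refine ⟨by simp [grOf], fun i j => ?_, fun i j hij => ?_⟩
  · have : (grOf H).getD i [] = bvOf (H.neighborSet i) := by simp [grOf]
    rw [adj, this, mem_bvOf, SimpleGraph.mem_neighborSet]
  · have hi : i < n := by
      by_contra hi
      have : (grOf H).getD i [] = [] := by
        rw [List.getD_eq_default]; simpa [grOf] using hi
      rw [adj, this, mem_nil] at hij
      simp at hij
    refine ⟨hi, ?_⟩
    by_contra hj
    have : (grOf H).getD i [] = bvOf (H.neighborSet ⟨i, hi⟩) := by simp [grOf, hi]
    rw [adj, this, mem, List.getD_eq_default _ _ (by simpa [bvOf] using hj)] at hij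
    simp at hij

theorem repDec_decOf (I : Input) {k : ℕ} (hk : I.WidthAtMost k) : RepDec I.graph (decOf I) k := by
  refine ⟨fun M hM => ?_, ?_⟩
  · obtain ⟨D, hD⟩ := (I.decomps_iff M).2 hM
    exact ⟨_, List.mem_map.2 ⟨_, hD, rfl⟩, vs_bvOf M⟩
  · intro d hd
    obtain ⟨⟨M, D⟩, hD, rfl⟩ := List.mem_map.1 hd
    refine ⟨M, vs_bvOf M, D, hk _ hD, ?_⟩
    rw [decompOf, List.map_ofFn]
    congr 1
    funext t
    exact vs_bvOf _

/-! ### The size of the input -/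

theorem size_pos (x : Val) : 1 ≤ x.size := by cases x <;> simp [Val.size]

theorem sz_list_le_size {α : Type} [Enc α] (l : List α) (h : ∀ a ∈ l, sz a ≤ (enc a).size) :
    sz l ≤ (enc l).size := by
  induction l with
  | nil => exact le_rfl
  | cons a l ih =>
    rw [sz_list_cons]
    have h1 := h a (by simp)
    have h2 := ih fun b hb => h b (by simp [hb])
    have : (enc (a :: l)).size = (enc a).size + (enc l).size + 1 := rfl
    omega

theorem sz_bv_le_size (l : BV) : sz l ≤ (enc l).size :=
  sz_list_le_size l fun _ _ => size_pos _

theorem sz_gr_le_size (l : Gr) : sz l ≤ (enc l).size := sz_list_le_size l fun a _ => sz_bv_le_size a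

theorem sz_dec_le_size (l : Dec) : sz l ≤ (enc l).size := by
  refine sz_list_le_size l fun a _ => ?_
  have h1 := sz_bv_le_size a.1
  have h2 := sz_gr_le_size a.2.1
  have h3 := sz_gr_le_size a.2.2
  have : (enc a).size = (enc a.1).size + ((enc a.2.1).size + (enc a.2.2).size + 1) + 1 := rfl
  rw [this, sz_pair, sz_pair]
  omega

theorem n_le_size (I : Input) : I.n ≤ I.size := by
  have h1 := sz_gr_le_size (grOf I.graph)
  have h2 := length_lt_sz (grOf I.graph)
  rw [(rep_grOf I.graph).len] at h2
  rw [enc_grOf] at h1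
  have : I.size = (encGraph I.graph).size + _ + 1 := rfl
  omega

/-- The size of the typed input is bounded in terms of the size of the encoding and the largest
cost, since costs count with their values and all other data with the sizes of their encodings. -/
theorem sz_inpOf (I : Input) {m : ℕ} (r : Fin m → Bool) {c : ℕ} (hc : ∀ v, I.cost v ≤ c) :
    sz (inpOf I r) ≤ I.size + (I.n * (c + 2) + 1) + (2 * m + 1) + 4 := by
  have hsz : sz (inpOf I r) = (sz (grOf I.graph) + (sz (List.ofFn fun v => BinNat.mk (I.cost v)) +
    ((1 + sz (I.budget.natAbs.bits : BV) + 1) + sz (decOf I) + 1) + 1) + 1) + sz (List.ofFn r : BV) + 1 := rfl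
  have hI : I.size = (enc (grOf I.graph)).size + ((encList (List.ofFn fun v => encNat (I.cost v))).size +
      (((encBool (decide (I.budget < 0))).size + (enc (I.budget.natAbs.bits : BV)).size + 1) +
        (enc (decOf I)).size + 1) + 1) + 1 := by
    have : I.size = _ := congrArg Val.size (Val.pair.inj (enc_inpOf I r)).1.symm
    rw [this]
    change _ + (Val.size (encList (List.map enc (List.ofFn _))) + _ + 1) + 1 = _
    rw [List.map_ofFn]
    rfl
  have h1 := sz_gr_le_size (grOf I.graph)
  have h2 := sz_bv_le_size I.budget.natAbs.bits
  have h3 := sz_dec_le_size (decOf I)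
  have h4 : sz (List.ofFn r : BV) = 2 * m + 1 := by rw [sz_bv]; simp
  have h5 := sz_list_le (l := List.ofFn fun v => BinNat.mk (I.cost v)) (Q := c + 1) (m := I.n) (by
    intro x hx
    obtain ⟨v, rfl⟩ := (List.mem_ofFn' _ _).1 hx
    exact Nat.succ_le_succ (hc v)) (by simp)
  have h6 := size_pos (encBool (decide (I.budget < 0)))
  have h7 : I.n * (c + 1 + 1) = I.n * (c + 2) := rfl
  omega

/-! ### The weights of the solutions -/

/-- The random weight given by a block of bits. -/
def bitWeight {ℓ : ℕ} (t : Fin ℓ → Bool) : ℕ := bval (List.ofFn t)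

theorem bitWeight_injective (ℓ : ℕ) : Function.Injective (bitWeight (ℓ := ℓ)) := fun _ _ h =>
  List.ofFn_injective (bval_injective (by simp) h)

theorem bitWeight_lt {ℓ : ℕ} (t : Fin ℓ → Bool) : bitWeight t < 2 ^ ℓ := by
  have := bval_lt (List.ofFn t)
  rwa [List.length_ofFn] at this

variable (I : Input) {m : ℕ} (r : Fin m → Bool)

theorem length_grOf : (inpOf I r).1.1.length = I.n := (rep_grOf I.graph).len

theorem rndAt_inpOf (hm : I.n * (logPow I.n).1 ≤ m) (v : Fin I.n) :
    rndAt (inpOf I r) v = bitWeight (block hm r v) := by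
  unfold rndAt
  rw [length_grOf, hornerCap_eq]
  have : ((inpOf I r).2.drop (v * (logPow I.n).1)).take (logPow I.n).1 =
      List.ofFn (block hm r v) := by
    have hv := Nat.mul_le_mul_right (logPow I.n).1 (Nat.succ_le_iff.2 v.2)
    rw [Nat.succ_mul] at hv
    change ((List.ofFn r).drop (v * (logPow I.n).1)).take (logPow I.n).1 = _
    apply List.ext_getElem
    · simp; omega
    · intro i h1 h2
      simp [block]
  rw [this]
  refine min_eq_left ?_
  rw [(logPow_spec I.n).1]
  exact (bitWeight_lt _).le

theorem costAt_inpOf (v : Fin I.n) : costAt (inpOf I r) v = I.cost v := by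
  change ((List.ofFn fun v => BinNat.mk (I.cost v)).map binVal).getD v 0 = _
  rw [List.map_ofFn]
  simp [binVal]

theorem costSum_inpOf : costSum (inpOf I r) = ∑ v, I.cost v := by
  change (((List.ofFn fun v => BinNat.mk (I.cost v)).map binVal).map units).flatten.length = _
  rw [List.length_flatten, List.map_map, List.map_map, List.map_ofFn, List.sum_ofFn]
  simp [units, binVal]

theorem degBound_inpOf : degBound (inpOf I r) = if I.budget < 0 then 0 else
    (min I.budget.natAbs (∑ v, I.cost v) + 1) * (I.n * (logPow I.n).2) := by
  change cond (decide (I.budget < 0)) 0 ((hornerCap (costSum (inpOf I r)) I.budget.natAbs.bits + 1) *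
    scale (inpOf I r)) = _
  rw [costSum_inpOf, hornerCap_eq, bval_bits, scale, length_grOf]
  by_cases h : I.budget < 0 <;> simp [h]

/-- The weight of a set of vertices, in which the cost dominates the random weight. -/
noncomputable def wgt (hm : I.n * (logPow I.n).1 ≤ m) (X : Finset (Fin I.n)) : ℕ :=
  weight hm (fun v => I.cost v * (I.n * (logPow I.n).2)) bitWeight r X

theorem prod_monos (hm : I.n * (logPow I.n).1 ≤ m) (X : Finset (Fin I.n)) :
    ∏ v ∈ X, ev (degBound (inpOf I r)) ((monos (inpOf I r)).getD v []) =
      zz (degBound (inpOf I r)) ^ wgt I r hm X := by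
  rw [wgt, weight, ← Finset.prod_pow_eq_pow_sum]
  refine Finset.prod_congr rfl fun v _ => ?_
  rw [monos, length_grOf, getD_map_range, ev_monoP, costAt_inpOf, rndAt_inpOf I r hm, scale, length_grOf]

/-- Truncation keeps exactly the sets within the budget: the random weights add up to less than the
factor by which the costs are scaled. -/
theorem wgt_lt_iff (hn : 0 < I.n) (hm : I.n * (logPow I.n).1 ≤ m) (X : Finset (Fin I.n)) :
    wgt I r hm X < degBound (inpOf I r) ↔ ((∑ v ∈ X, I.cost v : ℕ) : ℤ) ≤ I.budget := by
  rw [degBound_inpOf, wgt, weight, Finset.sum_add_distrib, ← Finset.sum_mul]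
  have hB : ∑ v ∈ X, bitWeight (block hm r v) < I.n * (logPow I.n).2 := by
    rw [(logPow_spec I.n).1]
    calc ∑ v ∈ X, bitWeight (block hm r v) ≤ ∑ v : Fin I.n, bitWeight (block hm r v) :=
          Finset.sum_le_sum_of_subset (Finset.subset_univ X)
      _ < ∑ _v : Fin I.n, 2 ^ (logPow I.n).1 :=
          Finset.sum_lt_sum_of_nonempty ⟨⟨0, hn⟩, Finset.mem_univ _⟩ fun v _ => bitWeight_lt _
      _ = _ := by simp
  have htot : ∑ v ∈ X, I.cost v ≤ ∑ v, I.cost v := Finset.sum_le_sum_of_subset (Finset.subset_univ X)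
  generalize ∑ v ∈ X, I.cost v = c at *
  generalize I.n * (logPow I.n).2 = B at *
  generalize ∑ v ∈ X, bitWeight (block hm r v) = ρ at *
  by_cases h : I.budget < 0
  · simp only [h, if_true]; constructor <;> intro h' <;> omega
  · simp only [h, if_false]
    constructor
    · intro h1
      have : c < min I.budget.natAbs (∑ v, I.cost v) + 1 := by
        by_contra hcon
        have := Nat.mul_le_mul_right B (not_lt.1 hcon)
        omega
      omega
    · intro h1
      have h2 : c + 1 ≤ min I.budget.natAbs (∑ v, I.cost v) + 1 := by omega
      have := Nat.mul_le_mul_right B h2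
      rw [Nat.add_mul c 1, one_mul] at this
      omega

/-! ### Correctness of the algorithm -/

theorem isConnectedVertexCover_iff {n : ℕ} {H : SimpleGraph (Fin n)} {X : Finset (Fin n)} :
    IsConnectedVertexCover H (X : Set (Fin n)) ↔ Covers H Finset.univ X ∧ ConnIn H (X : Set (Fin n)) := by
  refine and_congr ?_ ⟨connIn_of_preconnected, fun h => ?_⟩
  · unfold SimpleGraph.IsVertexCover Covers
    simp
  · rintro ⟨a, ha⟩ ⟨b, hb⟩
    obtain ⟨_, h1⟩ := h (fun x => ∃ hx : x ∈ (X : Set (Fin n)), (H.induce (X : Set (Fin n))).Reachable ⟨a, ha⟩ ⟨x, hx⟩)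
      ⟨a, ha, ha, SimpleGraph.Reachable.refl _⟩ (by
        rintro x hx y hy hxy ⟨_, h2⟩
        refine ⟨hy, h2.trans (SimpleGraph.Adj.reachable ?_)⟩
        exact hxy) b hb
    exact h1

/-- The algorithm tests whether the truncated sum over all connected vertex covers is nonzero. -/
theorem solve_iff (hH : I.graph.Connected) (hn : 2 ≤ I.n) (hm : I.n * (logPow I.n).1 ≤ m) :
    solve (inpOf I r) = true ↔ (∑ X : Finset (Fin I.n), if IsConnectedVertexCover I.graph (X : Set (Fin I.n))
      then zz (degBound (inpOf I r)) ^ wgt I r hm X else 0) ≠ 0 := by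
  rw [solve, any_iff_ev_ne_zero (length_total _ _ _ _)]
  change ev _ (total _ (grOf I.graph) _ _) ≠ 0 ↔ _
  rw [ev_total (rep_grOf I.graph) hH hn]
  refine not_congr (Eq.congr (Finset.sum_congr rfl fun X _ => ?_) rfl)
  rw [prod_monos I r hm]
  exact if_congr isConnectedVertexCover_iff.symm rfl rfl

theorem solve_of_eq_one (hn : I.n = 1) : solve (inpOf I r) = true ↔ I.IsYes := by
  have hsolve : solve (inpOf I r) = true ↔ 0 < degBound (inpOf I r) := by
    unfold solve total
    rw [length_grOf, hn]
    simp only [le_refl, decide_true, cond_true, monoP, mkV, List.any_map, List.any_eq_true, List.mem_range]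
    constructor
    · rintro ⟨x, hx, -⟩; omega
    · exact fun h => ⟨0, h, rfl⟩
  have hpos : 0 < I.n * (logPow I.n).2 := by
    rw [(logPow_spec I.n).1, hn]; positivity
  rw [hsolve, degBound_inpOf]
  by_cases h : I.budget < 0
  · simp only [h, if_true, lt_irrefl, false_iff]
    rintro ⟨X, hX, -⟩
    omega
  · simp only [h, if_false]
    refine iff_of_true (Nat.mul_pos (Nat.succ_pos _) hpos) ⟨∅, by simpa using h, ?_⟩
    refine isConnectedVertexCover_iff.2 ⟨fun u _ v _ huv => ?_, fun _ _ _ a ha => by simp at ha⟩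
    refine absurd (Fin.ext ?_) huv.ne
    have := u.2
    have := v.2
    omega

/-- There are no false positives: without a solution within the budget, all monomials are truncated.
-/
theorem solve_eq_false (hH : I.graph.Connected) (hm : I.n * (logPow I.n).1 ≤ m) (hno : ¬ I.IsYes) :
    solve (inpOf I r) = false := by
  have hn : 0 < I.n := by
    obtain ⟨v⟩ := hH.nonempty
    exact Nat.zero_lt_of_lt v.2
  rw [Bool.eq_false_iff]
  by_cases h1 : I.n = 1
  · rw [Ne, solve_of_eq_one I r h1]; exact hno
  · rw [Ne, solve_iff I r hH (by omega) hm, not_not]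
    refine sum_zz_eq_zero _ _ fun X hX => ?_
    by_contra hlt
    exact hno ⟨X, (wgt_lt_iff I r hn hm X).1 (not_le.1 hlt), hX⟩

/-- If there is a solution, then with probability at least one half the solution of minimum weight
is unique, and its monomial does not cancel. -/
theorem two_mul_card_solve_eq_false (hH : I.graph.Connected) (hm : I.n * (logPow I.n).1 ≤ m)
    (hyes : I.IsYes) :
    2 * (Finset.univ.filter fun r : Fin m → Bool => solve (inpOf I r) = false).card ≤ 2 ^ m := by
  have hn : 0 < I.n := by
    obtain ⟨v⟩ := hH.nonempty
    exact Nat.zero_lt_of_lt v.2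
  by_cases h1 : I.n = 1
  · rw [Finset.filter_false_of_mem fun r _ => by rw [(solve_of_eq_one I r h1).2 hyes]; simp]
    simp
  obtain ⟨h2, h3, h4⟩ := logPow_spec I.n
  let S : Finset (Finset (Fin I.n)) := Finset.univ.filter fun X =>
    ((∑ v ∈ X, I.cost v : ℕ) : ℤ) ≤ I.budget ∧ IsConnectedVertexCover I.graph (X : Set (Fin I.n))
  have hS : S.Nonempty := by
    obtain ⟨X, hX⟩ := hyes
    exact ⟨X, Finset.mem_filter.2 ⟨Finset.mem_univ _, hX⟩⟩
  refine le_trans (Nat.mul_le_mul_left 2 (Finset.card_le_card ?_))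
    (isolation hm (h2 ▸ h4) (fun v => I.cost v * (I.n * (logPow I.n).2)) (bitWeight_injective _) hS)
  intro r hr
  rw [Finset.mem_filter] at hr ⊢
  refine ⟨Finset.mem_univ _, ?_⟩
  rintro ⟨X, hX, hmin⟩
  obtain ⟨-, hXb, hXc⟩ := Finset.mem_filter.1 hX
  refine absurd hr.2 (Bool.not_eq_false _ ▸ ?_)
  rw [solve_iff I r hH (by omega) hm]
  have hlt := (wgt_lt_iff I r hn hm X).2 hXb
  refine sum_zz_ne_zero _ _ hXc hlt fun Y hY hYX heq => ?_
  -- a connected vertex cover of the same weight is also within the budget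
  have hYb := (wgt_lt_iff I r hn hm Y).1 (heq ▸ hlt)
  exact (hmin Y (Finset.mem_filter.2 ⟨Finset.mem_univ _, hYb, hY⟩) hYX).ne' heq

theorem solveCost_le (hn : 0 < I.n) {k : ℕ} (hk : I.WidthAtMost k) :
    solveCost (inpOf I r) ≤ (2 * I.n * I.n * I.n + I.n * I.n) * 5 ^ (k + 1) :=
  totalCost_le (rep_grOf I.graph) hn (repDec_decOf I hk) _ _

end input

end CVC


theorem mainTheorem1 :
    ∃ (A : CVC.Prog) (m : Polynomial ℕ),
      (∀ I : CVC.Input, I.graph.Connected →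
        (∀ r : Fin (m.eval I.size) → Bool,
          A.Accepts (CVC.withRandom I.encode r) ∨ A.Rejects (CVC.withRandom I.encode r)) ∧
        (¬ I.IsYes → ∀ r : Fin (m.eval I.size) → Bool,
          A.Rejects (CVC.withRandom I.encode r)) ∧
        (I.IsYes → A.rejectProb I.encode (m.eval I.size) ≤ 1 / 2)) ∧
      (∀ p : Polynomial ℕ, ∃ q : Polynomial ℕ, ∀ (I : CVC.Input) (k : ℕ),
        I.graph.Connected → (∀ v, I.cost v ≤ p.eval I.n) → I.WidthAtMost k →
        ∀ r : Fin (m.eval I.size) → Bool,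
          A.HaltsWithin (CVC.withRandom I.encode r) (5 ^ k * q.eval I.size)) := by
  obtain ⟨A, P, hA⟩ := CVC.ptk_solve
  -- every vertex needs a block of at most `2 * n` bits, and `n` is at most the size of the input
  have hm : ∀ I : CVC.Input, I.n * (CVC.logPow I.n).1 ≤ (2 * Polynomial.X * Polynomial.X : Polynomial ℕ).eval I.size := by
    intro I
    have h1 := CVC.n_le_size I
    have h2 := (CVC.logPow_spec I.n).2.1
    simp only [Polynomial.eval_mul, Polynomial.eval_X, Polynomial.eval_ofNat]
    calc I.n * (CVC.logPow I.n).1 ≤ I.size * (2 * I.size) :=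
          Nat.mul_le_mul h1 (h2.trans (Nat.mul_le_mul_left 2 h1))
      _ = _ := by ring
  have heval : ∀ (I : CVC.Input) {m : ℕ} (r : Fin m → Bool), ∃ t,
      A.Eval (CVC.withRandom I.encode r) (CVC.encBool (CVC.solve (CVC.inpOf I r))) t ∧
      t ≤ (CVC.solveCost (CVC.inpOf I r) + 1) * P.eval (CVC.Enc.sz (CVC.inpOf I r)) := by
    intro I m r
    have := (hA (CVC.inpOf I r)).1
    rwa [CVC.enc_inpOf] at this
  have hrej : ∀ (I : CVC.Input) {m : ℕ} (r : Fin m → Bool),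
      A.Rejects (CVC.withRandom I.encode r) ↔ CVC.solve (CVC.inpOf I r) = false := by
    intro I m r
    obtain ⟨t, h1, -⟩ := heval I r
    constructor
    · rintro ⟨u, h2⟩
      have := (h1.det h2).1
      cases h : CVC.solve (CVC.inpOf I r)
      · rfl
      · rw [h] at this; cases this
    · intro h
      rw [h] at h1
      exact ⟨t, h1⟩
  refine ⟨A, 2 * Polynomial.X * Polynomial.X, fun I hI => ⟨fun r => ?_, fun hno r => ?_, fun hyes => ?_⟩, fun p => ?_⟩
  · cases h : CVC.solve (CVC.inpOf I r)
    · exact Or.inr ((hrej I r).2 h)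
    · obtain ⟨t, h1, -⟩ := heval I r
      rw [h] at h1
      exact Or.inl ⟨_, _, t, h1⟩
  · exact (hrej I r).2 (CVC.solve_eq_false I r hI (hm I) hno)
  · have h1 := CVC.two_mul_card_solve_eq_false I hI (hm I) hyes
    unfold CVC.Prog.rejectProb
    rw [div_le_div_iff₀ (by positivity) (by norm_num), mul_comm, one_mul]
    simp only [hrej]
    exact_mod_cast h1
  · -- a bound for the size of the typed input when the costs are at most `p n`
    let Q : Polynomial ℕ := .X + (.X * (p + 2) + 1) + (2 * (2 * .X * .X) + 1) + 4
    -- tables have up to `5 ^ (k + 1)` entries, whence the factor `5`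
    refine ⟨(5 * (2 * .X * .X * .X + .X * .X) + 1) * P.comp Q, fun I k hI hc hk r => ?_⟩
    obtain ⟨t, h1, h2⟩ := heval I r
    refine ⟨_, t, h1, h2.trans ?_⟩
    have hn : 0 < I.n := by
      obtain ⟨v⟩ := hI.nonempty
      exact Nat.zero_lt_of_lt v.2
    have hns := CVC.n_le_size I
    have hsz : CVC.Enc.sz (CVC.inpOf I r) ≤ Q.eval I.size := by
      refine (CVC.sz_inpOf I r hc).trans ?_
      have h3 := Nat.mul_le_mul hns (Nat.add_le_add_right (CVC.polyMono p hns) 2)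
      simp only [Q, Polynomial.eval_add, Polynomial.eval_mul, Polynomial.eval_X, Polynomial.eval_ofNat,
        Polynomial.eval_one]
      omega
    have hcost := CVC.solveCost_le I r hn hk
    generalize CVC.inpOf I r = x at hsz hcost ⊢
    rw [Polynomial.eval_mul, Polynomial.eval_comp, ← mul_assoc]
    refine Nat.mul_le_mul ?_ (CVC.polyMono P hsz)
    have h5 : 1 ≤ 5 ^ k := Nat.one_le_pow _ _ (by norm_num)
    have h6 : 2 * I.n * I.n * I.n + I.n * I.n ≤ 2 * I.size * I.size * I.size + I.size * I.size := by gcongr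
    simp only [Polynomial.eval_add, Polynomial.eval_mul, Polynomial.eval_X, Polynomial.eval_ofNat,
        Polynomial.eval_one]
    calc CVC.solveCost x + 1
        ≤ (2 * I.size * I.size * I.size + I.size * I.size) * 5 ^ (k + 1) + 5 ^ k :=
          Nat.add_le_add (hcost.trans (Nat.mul_le_mul_right _ h6)) h5
      _ = _ := by ring
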